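/- **Theorem 1.** Let $n>1$, let $I\subseteq(0,\infty)$ and $J\subseteq\mathbb R$ be open intervals (the ranges of density and entropy), and let $P$ be a smooth function on $I\times J$ with $P_S\not\equiv 0$ and such that there is no non-empty open subset $U\subseteq J$ for which $P_\rho\equiv 0$ on $I\times U$. Consider the non-isentropic compressible Euler equations for velocity $u(t,x)\in\mathbb R^n$, density $\rho(t,x)\in I$ and entropy $S(t,x)\in J$, $$u_t+u\cdot\nabla u+\tfrac1\rho\nabla p=0,\qquad \rho_t+\nabla\cdot(\rho u)=0,\qquad S_t+u\cdot\nabla S=0,\qquad p=P(\rho,S),\qquad x\in\mathbb R^n .$$ A smooth function $T(t,x,u,\rho,S)$ is a *conserved density of kinematic form* if there is a vector $X$, a smooth function of $t,x,u,\rho,S$ and finitely many $x$-derivatives of $u,\rho,S$, such that $\mathcal D_tT+D_x\cdot X=0$ identically, where $\mathcal D_t$ is the total time derivative in which $u_t,\rho_t,S_t$ are eliminated by the Euler equations. A density is *trivial* if it equals $D_x\cdot\Theta$ for such a vector function $\Theta$. Let $e(\rho,S)$ be any smooth function with $e_\rho=\rho^{-2}P$. (i) The following laws hold; here $T$ is the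 conserved density and $\xi=X-Tu$ is the flux through boundaries moving with the fluid: - mass: $T=\rho$, $\xi=0$; - momentum: $T=\rho u^k$, $\xi=p\,\hat e_k$; - angular momentum: $T=\rho(u^jx^k-u^kx^j)$, $\xi=p(x^k\hat e_j-x^j\hat e_k)$; - Galilean momentum: $T=\rho(tu^k-x^k)$, $\xi=t\,p\,\hat e_k$; - energy: $T=\rho(\tfrac12|u|^2+e)$, $\xi=p\,u$; - generalized entropy: $T=\rho f(S)$ with $f$ an arbitrary smooth function on $J$, $\xi=0$. Unless $P=\kappa(S)\rho^{1+2/n}+p_0$ for some function $\kappa$ and some constant $p_0$, a smooth function $T(t,x,u,\rho,S)$ is a conserved density if and only if it is, modulo trivial densities, a linear combination with constant coefficients of these densities (*standard*). (ii) There is a conserved density of kinematic form that is not standard if and only if, up to a constant shift of the pressure, the equation of state is polytropic, $P=\kappa(S)\rho^{1+2/n}+p_0$. In that case put $\tilde p=P-p_0$, $\tilde e=\tfrac n2\kappa(S)\rho^{2/n}$ (an internal energy for $\tilde p$) and $E=\rho(\tfrac12|u|^2+\tilde e)=\tfrac12\rho|u|^2+\tfrac n2\tilde p$. Then the similarity energy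 and the dilational energy, $$T_1=tE-\tfrac12\rho\,u\cdot x,\quad \xi_1=\tilde p\,(tu-\tfrac12x),\qquad\quad T_2=t^2E-t\rho\,u\cdot x+\tfrac12\rho|x|^2,\quad \xi_2=\tilde p\,t\,(tu-x),$$ are conservation laws; a smooth function $T(t,x,u,\rho,S)$ is a conserved density if and only if $T-b_1T_1-b_2T_2$ is standard for some constants $b_1,b_2$; and $b_1T_1+b_2T_2$ is standard only if $b_1=b_2=0$. -/

import Mathlib

open Set
open scoped ContDiff

noncomputable section

namespace Euler

/-- Physical space `ℝⁿ` with its Euclidean structure. -/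
abbrev Space (n : ℕ) := EuclideanSpace ℝ (Fin n)

/-- The values `(u, ρ, S)` of velocity, density and entropy. -/
abbrev State (n : ℕ) := Space n × ℝ × ℝ

/-- The `k`-jet `(w, ∂w, …, ∂ᵏw)` at a point of a field `w = (u, ρ, S)` on space. -/
abbrev Jet (n k : ℕ) :=
  State n × ((j : Fin k) → ContinuousMultilinearMap ℝ (fun _ : Fin (j.val + 1) => Space n) (State n))

/-- The `k`-jet at `x` of the field `w`. -/
def jet {n : ℕ} (k : ℕ) (w : Space n → State n) (x : Space n) : Jet n k :=
  (w x, fun j => iteratedFDeriv ℝ (j.val + 1) w x)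

/-- Divergence of a vector field on `ℝⁿ`. -/
def divergence {n : ℕ} (F : Space n → Space n) (x : Space n) : ℝ :=
  ∑ i, (fderiv ℝ F x (EuclideanSpace.single i 1)) i

/-- `w = (u, ρ, S)` is a smooth field on `ℝⁿ` with densities in `I` and entropies in `J`. -/
def IsField {n : ℕ} (I J : Set ℝ) (w : Space n → State n) : Prop :=
  ContDiff ℝ ∞ w ∧ ∀ x, (w x).2.1 ∈ I ∧ (w x).2.2 ∈ J

/-- Functions of kinematic form `T(t, x, u, ρ, S)`. -/
abbrev Kinematic (n : ℕ) (F : Type) := ℝ → Space n → Space n → ℝ → ℝ → F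

/-- A kinematic function regarded as a function of one variable in the product space. -/
def uncurried {n : ℕ} {F : Type} (T : Kinematic n F) : ℝ × Space n × State n → F :=
  fun q => T q.1 q.2.1 q.2.2.1 q.2.2.2.1 q.2.2.2.2

/-- `T(t, x, u, ρ, S)` is smooth for `t ∈ ℝ`, `x, u ∈ ℝⁿ`, `ρ ∈ I`, `S ∈ J`. -/
def IsSmoothKinematic {n : ℕ} (I J : Set ℝ) (T : Kinematic n ℝ) : Prop :=
  ContDiffOn ℝ ∞ (uncurried T) {q | q.2.2.2.1 ∈ I ∧ q.2.2.2.2 ∈ J}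

/-- The value at `x` of a kinematic function on a field `w = (u, ρ, S)` at time `t`. -/
def onField {n : ℕ} {F : Type} (T : Kinematic n F) (t : ℝ) (w : Space n → State n)
    (x : Space n) : F :=
  T t x (w x).1 (w x).2.1 (w x).2.2

/-- A smooth vector function of `t`, `x`, `u`, `ρ`, `S` and the `x`-derivatives of `u`, `ρ`, `S`
up to order `k`. -/
def IsSmoothLocal {n k : ℕ} (I J : Set ℝ) (X : ℝ → Space n → Jet n k → Space n) : Prop :=
  ContDiffOn ℝ ∞ (fun q : ℝ × Space n × Jet n k => X q.1 q.2.1 q.2.2)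
    {q | q.2.2.1.2.1 ∈ I ∧ q.2.2.1.2.2 ∈ J}

/-- The time derivative `(u_t, ρ_t, S_t)` that the Euler equations with pressure `p = P(ρ, S)`
assign to the field `w = (u, ρ, S)`:
`u_t = -(u·∇)u - ρ⁻¹∇p`, `ρ_t = -∇·(ρu)`, `S_t = -u·∇S`. -/
def eulerRHS {n : ℕ} (P : ℝ → ℝ → ℝ) (w : Space n → State n) (x : Space n) : State n :=
  (-(fderiv ℝ (fun y => (w y).1) x (w x).1)
      - ((w x).2.1)⁻¹ • gradient (fun y => P (w y).2.1 (w y).2.2) x,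
   -divergence (fun y => (w y).2.1 • (w y).1) x,
   -(fderiv ℝ (fun y => (w y).2.2) x (w x).1))

/-- The total time derivative of `T(t, x, u, ρ, S)` at fixed `x`, with the time derivatives of
`u, ρ, S` eliminated by the Euler equations:
`T_t + T_u · u_t + T_ρ ρ_t + T_S S_t`. -/
def timeDeriv {n : ℕ} (P : ℝ → ℝ → ℝ) (T : Kinematic n ℝ) (t : ℝ) (w : Space n → State n)
    (x : Space n) : ℝ :=
  fderiv ℝ (uncurried T) (t, x, w x) (1, 0, eulerRHS P w x)

/-- `T` is a conserved density: the total time derivative of `T` on solutions plus the spatial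
divergence of some flux `X` vanishes identically, the flux being a smooth function of
`t, x, u, ρ, S` and finitely many `x`-derivatives of `u, ρ, S`. The spatial fields are arbitrary,
because the Euler equations determine the time derivatives and do not restrict the fields at a
given time. -/
def IsConserved {n : ℕ} (I J : Set ℝ) (P : ℝ → ℝ → ℝ) (T : Kinematic n ℝ) : Prop :=
  ∃ (k : ℕ) (X : ℝ → Space n → Jet n k → Space n), IsSmoothLocal I J X ∧
    ∀ (t : ℝ) (w : Space n → State n), IsField I J w → ∀ x,
      timeDeriv P T t w x + divergence (fun y => X t y (jet k w y)) x = 0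

/-- `T` is a trivial density: it is the spatial divergence of a smooth function of
`t, x, u, ρ, S` and finitely many `x`-derivatives of `u, ρ, S`. -/
def IsTrivial {n : ℕ} (I J : Set ℝ) (T : Kinematic n ℝ) : Prop :=
  ∃ (k : ℕ) (Θ : ℝ → Space n → Jet n k → Space n), IsSmoothLocal I J Θ ∧
    ∀ (t : ℝ) (w : Space n → State n), IsField I J w → ∀ x,
      onField T t w x = divergence (fun y => Θ t y (jet k w y)) x

/-- The local conservation law with density `T` and flux `ξ` through boundaries that move with the
fluid, so that the flux through a fixed boundary is `T u + ξ`. -/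
def HasMovingFlux {n : ℕ} (I J : Set ℝ) (P : ℝ → ℝ → ℝ) (T : Kinematic n ℝ)
    (ξ : Kinematic n (Space n)) : Prop :=
  ∀ (t : ℝ) (w : Space n → State n), IsField I J w → ∀ x,
    timeDeriv P T t w x
      + divergence (fun y => onField T t w y • (w y).1 + onField ξ t w y) x = 0

/-- `e` is an internal energy for the pressure `P`: `∂e/∂ρ = ρ⁻² P`. -/
def IsInternalEnergy (I J : Set ℝ) (P e : ℝ → ℝ → ℝ) : Prop :=
  ContDiffOn ℝ ∞ (fun q : ℝ × ℝ => e q.1 q.2) (I ×ˢ J) ∧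
    ∀ ρ ∈ I, ∀ S ∈ J, HasDerivAt (fun r => e r S) ((ρ ^ 2)⁻¹ * P ρ S) ρ

variable {n : ℕ}

/-- Mass density. -/
def mass : Kinematic n ℝ := fun _ _ _ ρ _ => ρ

/-- Momentum density, `k`-th component of `ρu`. -/
def momentum (k : Fin n) : Kinematic n ℝ := fun _ _ u ρ _ => ρ * u k

/-- Angular momentum density, component `(j, k)` of `ρ u ∧ x`. -/
def angularMomentum (j k : Fin n) : Kinematic n ℝ := fun _ x u ρ _ => ρ * (u j * x k - u k * x j)

/-- Galilean momentum density, `k`-th component of `ρ(tu - x)`. -/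
def galileanMomentum (k : Fin n) : Kinematic n ℝ := fun t x u ρ _ => ρ * (t * u k - x k)

/-- Energy density `E = ρ(½|u|² + e)`. -/
def energy (e : ℝ → ℝ → ℝ) : Kinematic n ℝ := fun _ _ u ρ S => ρ * (‖u‖ ^ 2 / 2 + e ρ S)

/-- Generalized entropy density `ρ f(S)`. -/
def entropy (f : ℝ → ℝ) : Kinematic n ℝ := fun _ _ _ ρ S => ρ * f S

/-- Similarity energy density `tE - ½ρ u·x`. -/
def similarityEnergy (e : ℝ → ℝ → ℝ) : Kinematic n ℝ := fun t x u ρ S =>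
  t * energy e t x u ρ S - ρ * inner ℝ u x / 2

/-- Dilational energy density `t²E - tρ u·x + ½ρ|x|²`. -/
def dilationalEnergy (e : ℝ → ℝ → ℝ) : Kinematic n ℝ := fun t x u ρ S =>
  t ^ 2 * energy e t x u ρ S - t * (ρ * inner ℝ u x) + ρ * ‖x‖ ^ 2 / 2

/-- Modulo trivial densities, `T` is a linear combination of mass, momentum, angular momentum,
Galilean momentum, energy and generalized entropy. -/
def IsStandard (I J : Set ℝ) (e : ℝ → ℝ → ℝ) (T : Kinematic n ℝ) : Prop :=
  ∃ (m b : ℝ) (a g : Fin n → ℝ) (c : Fin n → Fin n → ℝ) (f : ℝ → ℝ), ContDiffOn ℝ ∞ f J ∧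
    IsTrivial I J (T - (m • mass + ∑ k, a k • momentum k + ∑ j, ∑ k, c j k • angularMomentum j k
      + ∑ k, g k • galileanMomentum k + b • energy e + entropy f))

/-- Up to the constant shift `p₀`, the equation of state is `p = κ(S) ρ^(1 + 2/n)`. -/
def IsShiftedPolytropic (n : ℕ) (I J : Set ℝ) (P : ℝ → ℝ → ℝ) (κ : ℝ → ℝ) (p₀ : ℝ) : Prop :=
  ∀ ρ ∈ I, ∀ S ∈ J, P ρ S = κ S * ρ ^ (1 + 2 / (n : ℝ)) + p₀

/-- The polytropic internal energy `e = (n/2) κ(S) ρ^(2/n)`. -/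
def polytropicEnergy (n : ℕ) (κ : ℝ → ℝ) : ℝ → ℝ → ℝ := fun ρ S =>
  (n : ℝ) / 2 * κ S * ρ ^ (2 / (n : ℝ))

end Euler

end

open Euler

/-!
`𝒟ₜT` is affine in the first derivatives of the field `w = (u, ρ, S)`. Being a total divergence it
is a null Lagrangian, so its Euler–Lagrange expression vanishes on every field; the coefficients
of the first derivatives of `w` in that expression say that for `f = T(t, x, ·)` and every `i` the
one-form `(f - ρ f_ρ) duⁱ - ρ⁻¹ f_{uⁱ} dp` on the state space is closed. For `n > 1`, and since
`P_ρ` vanishes identically over no open range of entropies, this forces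
`T = w₀(t, x) + ρ(β(½|u|² + e) + α·u + h)` with `β, α` functions of `(t, x)` and `h` one of
`(t, x, S)`. For such a `T` the balance law holds with moving flux `P(βu + α)` up to a source
which is a cubic polynomial in `u` and must not depend on the state. Its coefficients show that
`β` depends on `t` only, that `x ↦ α` is skew up to the dilation `-½β'x`, and that
`ρ(β'e + h_t) - (n/2)β'P` is independent of `(ρ, S)`. By the last condition `P` is polytropic up
to a constant shift as soon as `β' ≠ 0` somewhere, and in that case `β` is a quadratic polynomial
in `t`, so that subtracting a combination of the similarity and the dilational energy makes `β`
constant. When `β` is constant, `α` is a Killing field depending affinely on `t`, and the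
densities that remain are the standard ones.
-/

namespace Euler

open MeasureTheory Filter Topology
open EuclideanSpace (single)

noncomputable section

/-! ### Integrals depending on a parameter -/

theorem contDiff_intervalIntegral {H F : Type*} [NormedAddCommGroup H] [NormedSpace ℝ H]
    [NormedAddCommGroup F] [NormedSpace ℝ F] {m : ℕ∞} {g : H → ℝ → F} (hg : ContDiff ℝ m ↿g)
    (a b : ℝ) : ContDiff ℝ m fun q => ∫ s in a..b, g q s := by
  obtain ⟨r, hr, hab⟩ : ∃ r : ℝ, 0 < r ∧ uIoc a b ⊆ Metric.closedBall 0 r := by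
    obtain ⟨r, hr⟩ := (isCompact_uIcc (a := a) (b := b)).isBounded.subset_closedBall 0
    exact ⟨max r 1, by positivity, uIoc_subset_uIcc.trans
      (hr.trans (Metric.closedBall_subset_closedBall (le_max_left _ _)))⟩
  let χ : ContDiffBump (0 : ℝ) := ⟨r, r + 1, hr, by linarith⟩
  -- The integral is the value at `0` of the convolution of the cut-off integrand with the
  -- indicator function of the reflected interval.
  have hconv := contDiffOn_convolution_left_with_param_comp (n := m) (μ := volume)
    (ContinuousLinearMap.lsmul ℝ ℝ : ℝ →L[ℝ] F →L[ℝ] F).flip (v := fun _ : H => (0 : ℝ))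
    contDiffOn_const
    (f := (Neg.neg ⁻¹' uIoc a b).indicator fun _ => (1 : ℝ)) (g := fun q s => χ s • g q s)
    isOpen_univ χ.hasCompactSupport.isCompact
    (fun _ s _ hs => by simp [image_eq_zero_of_notMem_tsupport hs])
    ((locallyIntegrable_const 1).indicator (measurable_neg measurableSet_uIoc))
    ((χ.contDiff.comp contDiff_snd).smul hg).contDiffOn
  rw [contDiffOn_univ] at hconv
  simp only [intervalIntegral.intervalIntegral_eq_integral_uIoc]
  convert hconv.const_smul (if a ≤ b then (1 : ℝ) else -1) using 3 with q
  rw [convolution_def, ← integral_indicator measurableSet_uIoc]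
  refine integral_congr_ae (Eventually.of_forall fun s => ?_)
  by_cases hs : s ∈ uIoc a b
  · simp [hs, χ.one_of_mem_closedBall (hab hs)]
  · simp [hs]

theorem hasDerivAt_integral_of_forall_notMem_eq_zero {G : Type*} [NormedAddCommGroup G]
    [NormedSpace ℝ G] [MeasurableSpace G] [BorelSpace G] {μ : Measure G}
    [IsLocallyFiniteMeasure μ] [μ.IsAddLeftInvariant] [μ.IsNegInvariant] {s : Set ℝ}
    (hs : IsOpen s) {K : Set G} (hK : IsCompact K) {g : ℝ → G → ℝ}
    (hgK : ∀ r ∈ s, ∀ x ∉ K, g r x = 0) (hg : ContDiffOn ℝ 1 ↿g (s ×ˢ univ)) {r : ℝ}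
    (hr : r ∈ s) :
    HasDerivAt (fun r => ∫ x, g r x ∂μ) (∫ x, deriv (fun r => g r x) r ∂μ) r := by
  have hnhds : ∀ x : G, s ×ˢ univ ∈ 𝓝 (r, x) := fun x =>
    (hs.prod isOpen_univ).mem_nhds ⟨hr, mem_univ x⟩
  have hfderiv : ∀ x, fderiv ℝ ↿g (r, x) (1, 0) = deriv (fun r => g r x) r := fun x =>
    (((hg.contDiffAt (hnhds x)).differentiableAt one_ne_zero).hasFDerivAt.comp_hasDerivAt r
      ((hasDerivAt_id r).prodMk (hasDerivAt_const r x))).deriv.symm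
  have hcont : Continuous fun x => fderiv ℝ ↿g (r, x) :=
    (hg.continuousOn_fderiv_of_isOpen (hs.prod isOpen_univ) le_rfl).comp_continuous
      (by fun_prop) fun x => ⟨hr, mem_univ x⟩
  have hsupp : HasCompactSupport fun x => fderiv ℝ ↿g (r, x) := by
    refine HasCompactSupport.intro hK fun x hx => ?_
    have hzero : (↿g : ℝ × G → ℝ) =ᶠ[𝓝 (r, x)] fun _ => 0 := by
      filter_upwards [(hs.prod hK.isClosed.isOpen_compl).mem_nhds ⟨hr, hx⟩] with p hp
      exact hgK p.1 hp.1 p.2 hp.2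
    rw [hzero.fderiv_eq, fderiv_fun_const, Pi.zero_apply]
  have h := (hasFDerivAt_convolution_right_with_param (μ := μ) (ContinuousLinearMap.mul ℝ ℝ) hs hK
    (fun r x hr => hgK r hr x) (locallyIntegrable_const (1 : ℝ)) hg (r, 0) hr).comp_hasDerivAt r
      ((hasDerivAt_id r).prodMk (hasDerivAt_const r (0 : G)))
  rw [convolution_precompR_apply _ (locallyIntegrable_const 1) hsupp hcont] at h
  simp only [convolution_def, Function.comp_def, hfderiv, ContinuousLinearMap.mul_apply', one_mul,
    id_eq, integral_sub_left_eq_self fun x => deriv (fun r => g r x) r,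
    integral_sub_left_eq_self (g _)] at h
  exact h

/-! ### Differentiation along lines -/

theorem eq_of_fderiv_apply_sub_eq_zero {F : Type*} [NormedAddCommGroup F] [NormedSpace ℝ F]
    {s : Set F} (hs : IsOpen s) (hc : Convex ℝ s) {f : F → ℝ}
    (hf : DifferentiableOn ℝ f s) {x y : F} (hx : x ∈ s) (hy : y ∈ s)
    (h : ∀ z ∈ s, fderiv ℝ f z (y - x) = 0) : f y = f x := by
  obtain ⟨z, hz, hzf⟩ := domain_mvt (f' := fderiv ℝ f)
    (fun z hz => ((hf z hz).differentiableAt (hs.mem_nhds hz)).hasFDerivAt.hasFDerivWithinAt)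
    hc hx hy
  rwa [h z (hc.segment_subset hx hy hz), sub_eq_zero] at hzf

theorem exists_contDiff_fderiv_apply_eq {E : Type*} [NormedAddCommGroup E] [NormedSpace ℝ E]
    {v : E} (hv : v ≠ 0) {m : ℕ∞} (hm : m ≠ 0) {g : E → ℝ} (hg : ContDiff ℝ m g) :
    ∃ θ : E → ℝ, ContDiff ℝ m θ ∧ ∀ x, fderiv ℝ θ x v = g x := by
  obtain ⟨ℓ, hℓ⟩ := SeparatingDual.exists_eq_one (R := ℝ) hv
  -- The primitive of `g` along the lines parallel to `v` that vanishes on the hyperplane `ℓ = 0`.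
  let θ : E → ℝ := fun x => ℓ x * ∫ s in (0 : ℝ)..1, g (x + (s * ℓ x - ℓ x) • v)
  have hθ : ContDiff ℝ m θ := by
    refine ℓ.contDiff.mul (contDiff_intervalIntegral ?_ 0 1)
    exact hg.comp (f := fun p : E × ℝ => p.1 + (p.2 * ℓ p.1 - ℓ p.1) • v) (by fun_prop)
  have hline : ∀ x (τ : ℝ), θ (x + τ • v) = ∫ σ in (0 : ℝ)..ℓ x + τ, g (x + (σ - ℓ x) • v) := by
    intro x τ
    have hτ : ℓ (x + τ • v) = ℓ x + τ := by simp [hℓ]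
    have h := intervalIntegral.mul_integral_comp_mul_right (a := 0) (b := 1)
      (f := fun σ => g (x + (σ - ℓ x) • v)) (ℓ x + τ)
    rw [zero_mul, one_mul] at h
    simp only [θ, hτ, ← h]
    congr 2 with s
    congr 1
    module
  refine ⟨θ, hθ, fun x => ?_⟩
  have hcont : Continuous fun σ : ℝ => g (x + (σ - ℓ x) • v) := by
    have := hg.continuous
    fun_prop
  have hderiv : HasDerivAt (fun τ : ℝ => θ (x + τ • v)) (g x) 0 := by
    have h := ((hcont.integral_hasStrictDerivAt 0 (ℓ x + 0)).hasDerivAt).comp_const_add (ℓ x) 0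
    simpa only [hline, add_zero, sub_self, zero_smul] using h
  have hdiff : DifferentiableAt ℝ θ x := hθ.differentiable (by exact_mod_cast hm) x
  rw [← hdiff.lineDeriv_eq_fderiv]
  exact hderiv.deriv

/-! ### The divergence -/

theorem divergence_eq_sum {n : ℕ} {F : Space n → Space n} {x : Space n}
    (hF : DifferentiableAt ℝ F x) :
    divergence F x = ∑ i, fderiv ℝ (fun y => F y i) x (single i 1) := by
  refine Finset.sum_congr rfl fun i _ => ?_
  have h : HasFDerivAt (fun y => F y i) _ x :=
    (EuclideanSpace.proj (𝕜 := ℝ) i).hasFDerivAt.comp x hF.hasFDerivAt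
  rw [h.fderiv]
  rfl

variable {n : ℕ}

theorem divergence_const (v x : Space n) : divergence (fun _ => v) x = 0 := by
  simp [divergence]

theorem divergence_add {F G : Space n → Space n} {x : Space n} (hF : DifferentiableAt ℝ F x)
    (hG : DifferentiableAt ℝ G x) :
    divergence (fun y => F y + G y) x = divergence F x + divergence G x := by
  simp only [divergence, fderiv_fun_add hF hG, ← Finset.sum_add_distrib]
  rfl

theorem divergence_sub {F G : Space n → Space n} {x : Space n} (hF : DifferentiableAt ℝ F x)
    (hG : DifferentiableAt ℝ G x) :
    divergence (fun y => F y - G y) x = divergence F x - divergence G x := by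
  simp only [divergence, fderiv_fun_sub hF hG, ← Finset.sum_sub_distrib]
  rfl

theorem divergence_neg (F : Space n → Space n) (x : Space n) :
    divergence (fun y => -F y) x = -divergence F x := by
  simp [divergence, fderiv_fun_neg]

theorem divergence_const_smul {F : Space n → Space n} {x : Space n} (hF : DifferentiableAt ℝ F x)
    (c : ℝ) : divergence (fun y => c • F y) x = c * divergence F x := by
  simp only [divergence, fderiv_fun_const_smul hF, Finset.mul_sum]
  rfl

theorem sum_coord_smul_single (v : Space n) : ∑ i, v i • single i (1 : ℝ) = v := by
  simpa using (EuclideanSpace.basisFun (Fin n) ℝ).sum_repr v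

theorem sum_coord_mul_apply_single (L : Space n →L[ℝ] ℝ) (v : Space n) :
    ∑ i, v i * L (single i 1) = L v := by
  conv_rhs => rw [← sum_coord_smul_single v]
  simp only [map_sum, map_smul, smul_eq_mul]

theorem divergence_smul {g : Space n → ℝ} {F : Space n → Space n} {x : Space n}
    (hg : DifferentiableAt ℝ g x) (hF : DifferentiableAt ℝ F x) :
    divergence (fun y => g y • F y) x = g x * divergence F x + fderiv ℝ g x (F x) := by
  rw [← sum_coord_mul_apply_single (fderiv ℝ g x)]
  simp only [divergence, fderiv_fun_smul hg hF, Finset.mul_sum, ← Finset.sum_add_distrib]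
  exact Finset.sum_congr rfl fun i _ => by simp [mul_comm]

theorem integral_fderiv_apply_eq_zero {E : Type*} [NormedAddCommGroup E] [NormedSpace ℝ E]
    [FiniteDimensional ℝ E] [MeasurableSpace E] [BorelSpace E] {μ : Measure E}
    [μ.IsAddHaarMeasure] {f : E → ℝ} (hf : ContDiff ℝ 1 f) (hs : HasCompactSupport f) (v : E) :
    ∫ x, fderiv ℝ f x v ∂μ = 0 := by
  have hcont : Continuous fun x => fderiv ℝ f x v :=
    (hf.continuous_fderiv one_ne_zero).clm_apply continuous_const
  simpa using integral_mul_fderiv_eq_neg_fderiv_mul_of_integrable (μ := μ)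
    (f := fun _ => (1 : ℝ)) (g := f) (v := v) (by simp)
    (by simpa using hcont.integrable_of_hasCompactSupport (hs.fderiv_apply ℝ v))
    (by simpa using hf.continuous.integrable_of_hasCompactSupport hs) (by simp)
    (fun x _ => hf.differentiable one_ne_zero x)

theorem integral_divergence_eq_zero {F : Space n → Space n} (hF : ContDiff ℝ 1 F)
    (hs : HasCompactSupport F) : ∫ x, divergence F x = 0 := by
  have hFi : ∀ i, ContDiff ℝ 1 fun y => F y i := contDiff_euclidean.1 hF
  have hsi : ∀ i, HasCompactSupport fun y => F y i := fun i =>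
    hs.comp_left (g := fun v : Space n => v i) rfl
  simp_rw [fun x => divergence_eq_sum (hF.differentiable one_ne_zero x)]
  rw [integral_finsetSum]
  · exact Finset.sum_eq_zero fun i _ => integral_fderiv_apply_eq_zero (hFi i) (hsi i) _
  · exact fun i _ => (((hFi i).continuous_fderiv one_ne_zero).clm_apply
      continuous_const).integrable_of_hasCompactSupport ((hsi i).fderiv_apply ℝ _)

theorem exists_divergence_eq (hn : 0 < n) {g : ℝ × Space n → ℝ} (hg : ContDiff ℝ ∞ g) :
    ∃ Θ : ℝ × Space n → Space n, ContDiff ℝ ∞ Θ ∧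
      ∀ t x, divergence (fun y => Θ (t, y)) x = g (t, x) := by
  let e : Space n := single ⟨0, hn⟩ 1
  obtain ⟨θ, hθ, hderiv⟩ := exists_contDiff_fderiv_apply_eq (E := ℝ × Space n) (v := (0, e))
    (by simp [e]) (by simp) hg
  refine ⟨fun q => θ q • e, hθ.smul contDiff_const, fun t x => ?_⟩
  have hθt : HasFDerivAt (fun y => θ (t, y)) _ x :=
    (hθ.differentiable (by simp) (t, x)).hasFDerivAt.comp x (hasFDerivAt_prodMk_right t x)
  rw [divergence_smul hθt.differentiableAt (differentiableAt_const _), divergence_const, mul_zero,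
    zero_add, hθt.fderiv]
  exact hderiv (t, x)

/-! ### Fields, jets and total divergences -/

variable {I J : Set ℝ}

/-- The set of admissible states: densities in `I`, entropies in `J`, velocities unrestricted. -/
def phase (n : ℕ) (I J : Set ℝ) : Set (State n) := {v | v.2.1 ∈ I ∧ v.2.2 ∈ J}

theorem isOpen_phase (hI : IsOpen I) (hJ : IsOpen J) : IsOpen (phase n I J) :=
  (hI.preimage (f := fun v : State n => v.2.1) (by fun_prop)).inter
    (hJ.preimage (f := fun v : State n => v.2.2) (by fun_prop))

theorem convex_phase (hI : I.OrdConnected) (hJ : J.OrdConnected) : Convex ℝ (phase n I J) :=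
  fun _ hv _ hw _ _ ha hb hab => ⟨hI.convex hv.1 hw.1 ha hb hab, hJ.convex hv.2 hw.2 ha hb hab⟩

theorem isField_const {v : State n} (hv : v ∈ phase n I J) : IsField I J fun _ => v :=
  ⟨contDiff_const, fun _ => hv⟩

theorem contDiff_jet {w : Space n → State n} (hw : ContDiff ℝ ∞ w) (k : ℕ) :
    ContDiff ℝ ∞ (jet k w) :=
  hw.prodMk (contDiff_pi.2 fun _ => hw.iteratedFDeriv_right (mod_cast le_top))

theorem jet_eq_of_eventuallyEq {w w' : Space n → State n} {x : Space n} (h : w =ᶠ[𝓝 x] w')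
    (k : ℕ) : jet k w x = jet k w' x :=
  Prod.ext h.eq_of_nhds (funext fun _ => (h.iteratedFDeriv ℝ _).eq_of_nhds)

/-- The `k`-jet underlying an `m`-jet with `k ≤ m`; it brings two local functions to a common
order. -/
def Jet.truncate {k m : ℕ} (hkm : k ≤ m) (z : Jet n m) : Jet n k :=
  (z.1, fun j => z.2 (Fin.castLE hkm j))

theorem Jet.contDiff_truncate {k m : ℕ} (hkm : k ≤ m) :
    ContDiff ℝ ∞ (Jet.truncate (n := n) hkm) :=
  contDiff_fst.prodMk (contDiff_pi.2 fun j => contDiff_pi.1 contDiff_snd (Fin.castLE hkm j))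

theorem IsSmoothLocal.contDiff (hI : IsOpen I) (hJ : IsOpen J) {k : ℕ}
    {X : ℝ → Space n → Jet n k → Space n} (hX : IsSmoothLocal I J X) {w : Space n → State n}
    (hw : IsField I J w) (t : ℝ) : ContDiff ℝ ∞ fun y => X t y (jet k w y) := by
  have hopen : IsOpen {q : ℝ × Space n × Jet n k | q.2.2.1 ∈ phase n I J} :=
    (isOpen_phase hI hJ).preimage (by fun_prop)
  refine contDiff_iff_contDiffAt.2 fun y => ?_
  exact (hX.contDiffAt (hopen.mem_nhds (hw.2 y))).comp y
    (contDiff_const.prodMk (contDiff_id.prodMk (contDiff_jet hw.1 k))).contDiffAt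

theorem exists_forall_isField_add_smul (hI : IsOpen I) (hJ : IsOpen J) {w ψ : Space n → State n}
    (hw : IsField I J w) (hψ : ContDiff ℝ ∞ ψ) (hc : HasCompactSupport ψ) :
    ∃ δ : ℝ, 0 < δ ∧ ∀ s ∈ Metric.ball (0 : ℝ) δ, IsField I J (w + s • ψ) := by
  have hsupp : ∀ᶠ s : ℝ in 𝓝 0, ∀ x ∈ tsupport ψ, w x + s • ψ x ∈ phase n I J := by
    refine hc.eventually_forall_of_forall_eventually fun x _ => ?_
    have hcont : Continuous fun z : ℝ × Space n => w z.2 + z.1 • ψ z.2 := by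
      have := hw.1.continuous
      have := hψ.continuous
      fun_prop
    refine hcont.continuousAt.eventually_mem ((isOpen_phase hI hJ).mem_nhds ?_)
    rw [zero_smul, add_zero]
    exact hw.2 x
  obtain ⟨δ, hδ, hball⟩ := Metric.eventually_nhds_iff_ball.1 hsupp
  refine ⟨δ, hδ, fun s hs => ⟨hw.1.add (hψ.const_smul s), fun x => ?_⟩⟩
  by_cases hx : x ∈ tsupport ψ
  · exact hball s hs x hx
  · simpa [image_eq_zero_of_notMem_tsupport hx] using hw.2 x

theorem exists_isField_fderiv_eq (hI : IsOpen I) (hJ : IsOpen J) (x : Space n) {v : State n}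
    (hv : v ∈ phase n I J) (M : Space n →L[ℝ] State n) :
    ∃ w : Space n → State n, IsField I J w ∧ w x = v ∧ ∃ ε > (0 : ℝ), fderiv ℝ w x = ε • M := by
  let χ : ContDiffBump x := ⟨1, 2, one_pos, one_lt_two⟩
  let ψ : Space n → State n := fun y => χ y • M (y - x)
  have hψ : ContDiff ℝ ∞ ψ := χ.contDiff.smul (M.contDiff.comp (contDiff_id.sub contDiff_const))
  have hderiv : fderiv ℝ ψ x = M := by
    have hψM : ψ =ᶠ[𝓝 x] fun y => M (y - x) := by
      filter_upwards [χ.eventuallyEq_one] with y hy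
      simp [ψ, hy]
    rw [hψM.fderiv_eq]
    exact (M.hasFDerivAt.comp x ((hasFDerivAt_id x).sub_const x)).fderiv
  obtain ⟨δ, hδ, hfield⟩ := exists_forall_isField_add_smul hI hJ (isField_const hv) hψ
    χ.hasCompactSupport.smul_right
  refine ⟨_, hfield (δ / 2) ?_, by simp [ψ], δ / 2, by positivity, ?_⟩
  · rw [mem_ball_zero_iff, Real.norm_of_nonneg (by positivity)]
    linarith
  · rw [fderiv_add (differentiableAt_const _) ((hψ.differentiable (by simp) x).const_smul _),
      fderiv_const_smul (hψ.differentiable (by simp) x), hderiv, fderiv_fun_const, Pi.zero_apply,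
      zero_add]

/-- A function of time, field and position is a total divergence if it is the spatial divergence of
a smooth function of `t, x, u, ρ, S` and finitely many `x`-derivatives of `u, ρ, S`. Triviality and
conservation of a density are both conditions of this kind. -/
def IsTotalDivergence (I J : Set ℝ) (L : ℝ → (Space n → State n) → Space n → ℝ) : Prop :=
  ∃ (k : ℕ) (X : ℝ → Space n → Jet n k → Space n), IsSmoothLocal I J X ∧
    ∀ (t : ℝ) (w : Space n → State n), IsField I J w → ∀ x,
      L t w x = divergence (fun y => X t y (jet k w y)) x

namespace IsTotalDivergence

variable {L M : ℝ → (Space n → State n) → Space n → ℝ}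

theorem congr (hL : IsTotalDivergence I J L)
    (h : ∀ t w, IsField I J w → ∀ x, M t w x = L t w x) : IsTotalDivergence I J M := by
  obtain ⟨k, X, hX, hdiv⟩ := hL
  exact ⟨k, X, hX, fun t w hw x => (h t w hw x).trans (hdiv t w hw x)⟩

theorem slice (hL : IsTotalDivergence I J L) (t₀ : ℝ) : IsTotalDivergence I J fun _ => L t₀ := by
  obtain ⟨k, X, hX, hdiv⟩ := hL
  exact ⟨k, fun _ => X t₀, hX.comp (f := fun q : ℝ × Space n × Jet n k => (t₀, q.2))
    (by fun_prop) fun _ hq => hq, fun _ => hdiv t₀⟩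

theorem const_mul (hI : IsOpen I) (hJ : IsOpen J) (hL : IsTotalDivergence I J L) (c : ℝ) :
    IsTotalDivergence I J fun t w x => c * L t w x := by
  obtain ⟨k, X, hX, hdiv⟩ := hL
  refine ⟨k, fun t y j => c • X t y j, (contDiffOn_const (c := c)).smul hX, fun t w hw x => ?_⟩
  beta_reduce
  rw [hdiv t w hw x,
    divergence_const_smul ((hX.contDiff hI hJ hw t).differentiable (by simp) x)]

theorem exists_of_le (hL : IsTotalDivergence I J L) :
    ∃ k, ∀ m, k ≤ m → ∃ X : ℝ → Space n → Jet n m → Space n, IsSmoothLocal I J X ∧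
      ∀ t w, IsField I J w → ∀ x, L t w x = divergence (fun y => X t y (jet m w y)) x := by
  obtain ⟨k, X, hX, hdiv⟩ := hL
  refine ⟨k, fun m hkm => ⟨fun t y j => X t y (j.truncate hkm), ?_, hdiv⟩⟩
  exact hX.comp (f := fun q : ℝ × Space n × Jet n m => (q.1, q.2.1, q.2.2.truncate hkm))
    (contDiff_fst.prodMk ((contDiff_fst.comp contDiff_snd).prodMk
      ((Jet.contDiff_truncate hkm).comp (contDiff_snd.comp contDiff_snd)))).contDiffOn
    fun _ hq => hq

theorem add (hI : IsOpen I) (hJ : IsOpen J) (hL : IsTotalDivergence I J L)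
    (hM : IsTotalDivergence I J M) : IsTotalDivergence I J fun t w x => L t w x + M t w x := by
  obtain ⟨k, hk⟩ := hL.exists_of_le
  obtain ⟨m, hm⟩ := hM.exists_of_le
  obtain ⟨X, hX, hL⟩ := hk _ (le_max_left k m)
  obtain ⟨Y, hY, hM⟩ := hm _ (le_max_right k m)
  refine ⟨_, fun t y j => X t y j + Y t y j, hX.add hY, fun t w hw x => ?_⟩
  beta_reduce
  rw [hL t w hw x, hM t w hw x, divergence_add
    ((hX.contDiff hI hJ hw t).differentiable (by simp) x)
    ((hY.contDiff hI hJ hw t).differentiable (by simp) x)]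

theorem integral_sub_eq_zero (hI : IsOpen I) (hJ : IsOpen J) (hL : IsTotalDivergence I J L)
    {w ψ : Space n → State n} (hw : IsField I J w) (hwψ : IsField I J (w + ψ))
    (hψ : HasCompactSupport ψ) (t : ℝ) : ∫ x, (L t (w + ψ) x - L t w x) = 0 := by
  obtain ⟨k, X, hX, hdiv⟩ := hL
  have hXw := (hX.contDiff hI hJ hw t).of_le (m := 1) (by simp)
  have hXwψ := (hX.contDiff hI hJ hwψ t).of_le (m := 1) (by simp)
  have hsupp : HasCompactSupport fun y => X t y (jet k (w + ψ) y) - X t y (jet k w y) := by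
    refine HasCompactSupport.intro hψ fun y hy => ?_
    have h : w + ψ =ᶠ[𝓝 y] w := by
      filter_upwards [notMem_tsupport_iff_eventuallyEq.1 hy] with z hz
      simp [hz]
    rw [jet_eq_of_eventuallyEq h, sub_self]
  rw [← integral_divergence_eq_zero (hXwψ.sub hXw) hsupp]
  refine integral_congr_ae (Eventually.of_forall fun x => ?_)
  beta_reduce
  rw [hdiv t _ hwψ x, hdiv t w hw x, divergence_sub (hXwψ.differentiable one_ne_zero x)
    (hXw.differentiable one_ne_zero x)]

end IsTotalDivergence

/-! ### Null Lagrangians that are affine in the first derivatives -/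

section NullLagrangian

variable {A : Space n × State n → ℝ} {B : Fin n → Space n × State n → (State n →L[ℝ] ℝ)}

/-- The Lagrangian `A(x, w) + ∑ᵢ Bᵢ(x, w) ∂ᵢw`, the form that `𝒟ₜT` takes for a density of kinematic
form. -/
def affineLagrangian (A : Space n × State n → ℝ)
    (B : Fin n → Space n × State n → (State n →L[ℝ] ℝ)) (w : Space n → State n) (x : Space n) : ℝ :=
  A (x, w x) + ∑ i, B i (x, w x) (fderiv ℝ w x (single i 1))

/-- The Euler–Lagrange expression of `affineLagrangian A B`, in the direction `a`. The second
derivatives of `w` cancel, so only first derivatives occur. -/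
def eulerLagrange (A : Space n × State n → ℝ)
    (B : Fin n → Space n × State n → (State n →L[ℝ] ℝ)) (w : Space n → State n) (a : State n)
    (x : Space n) : ℝ :=
  fderiv ℝ A (x, w x) (0, a)
    + ∑ i, (fderiv ℝ (B i) (x, w x) (0, a) (fderiv ℝ w x (single i 1))
      - fderiv ℝ (B i) (x, w x) (single i 1, fderiv ℝ w x (single i 1)) a)

theorem isOpen_preimage_phase (hI : IsOpen I) (hJ : IsOpen J) :
    IsOpen (Prod.snd ⁻¹' phase n I J : Set (Space n × State n)) :=
  (isOpen_phase hI hJ).preimage continuous_snd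

theorem continuous_eulerLagrange (hI : IsOpen I) (hJ : IsOpen J)
    (hA : ContDiffOn ℝ ∞ A (Prod.snd ⁻¹' phase n I J))
    (hB : ∀ i, ContDiffOn ℝ ∞ (B i) (Prod.snd ⁻¹' phase n I J))
    {w : Space n → State n} (hw : IsField I J w) (a : State n) :
    Continuous (eulerLagrange A B w a) := by
  have hopen := isOpen_preimage_phase (n := n) hI hJ
  have hwc := hw.1.continuous
  have hdw : Continuous (fderiv ℝ w) := hw.1.continuous_fderiv (by simp)
  have hdA : Continuous fun x => fderiv ℝ A (x, w x) :=
    (hA.continuousOn_fderiv_of_isOpen hopen (by simp)).comp_continuous (by fun_prop) hw.2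
  have hdB : ∀ i, Continuous fun x => fderiv ℝ (B i) (x, w x) := fun i =>
    ((hB i).continuousOn_fderiv_of_isOpen hopen (by simp)).comp_continuous (by fun_prop) hw.2
  unfold eulerLagrange
  fun_prop

theorem fderiv_add_smul {w ψ : Space n → State n} (hw : ContDiff ℝ ∞ w) (hψ : ContDiff ℝ ∞ ψ)
    (s : ℝ) (x : Space n) : fderiv ℝ (w + s • ψ) x = fderiv ℝ w x + s • fderiv ℝ ψ x := by
  have hψx := hψ.differentiable (by simp) x
  rw [fderiv_add (hw.differentiable (by simp) x) (hψx.const_smul s), fderiv_const_smul hψx]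

theorem contDiffOn_affineLagrangian_add_smul
    (hA : ContDiffOn ℝ ∞ A (Prod.snd ⁻¹' phase n I J))
    (hB : ∀ i, ContDiffOn ℝ ∞ (B i) (Prod.snd ⁻¹' phase n I J))
    {w ψ : Space n → State n} (hw : ContDiff ℝ ∞ w) (hψ : ContDiff ℝ ∞ ψ) {U : Set ℝ}
    (hU : ∀ s ∈ U, IsField I J (w + s • ψ)) :
    ContDiffOn ℝ ∞ (fun p : ℝ × Space n => affineLagrangian A B (w + p.1 • ψ) p.2)
      (U ×ˢ univ) := by
  have hpoint : ContDiff ℝ ∞ fun p : ℝ × Space n => (p.2, (w + p.1 • ψ) p.2) :=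
    contDiff_snd.prodMk ((hw.comp contDiff_snd).add
      (contDiff_fst.smul (hψ.comp contDiff_snd)))
  have hmaps : MapsTo (fun p : ℝ × Space n => (p.2, (w + p.1 • ψ) p.2)) (U ×ˢ univ)
      (Prod.snd ⁻¹' phase n I J) := fun p hp => (hU p.1 hp.1).2 p.2
  refine (hA.comp hpoint.contDiffOn hmaps).add (ContDiffOn.sum fun i _ =>
    ((hB i).comp hpoint.contDiffOn hmaps).clm_apply (ContDiff.contDiffOn ?_))
  have hdw : ContDiff ℝ ∞ fun p : ℝ × Space n => fderiv ℝ w p.2 :=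
    (hw.fderiv_right (by simp)).comp contDiff_snd
  have hdψ : ContDiff ℝ ∞ fun p : ℝ × Space n => fderiv ℝ ψ p.2 :=
    (hψ.fderiv_right (by simp)).comp contDiff_snd
  simp only [fderiv_add_smul hw hψ]
  exact (hdw.add (contDiff_fst.smul hdψ)).clm_apply contDiff_const

theorem hasDerivAt_affineLagrangian_add_smul {w ψ : Space n → State n} (hw : ContDiff ℝ ∞ w)
    (hψ : ContDiff ℝ ∞ ψ) {x : Space n} (hA : DifferentiableAt ℝ A (x, w x))
    (hB : ∀ i, DifferentiableAt ℝ (B i) (x, w x)) :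
    HasDerivAt (fun s : ℝ => affineLagrangian A B (w + s • ψ) x)
      (fderiv ℝ A (x, w x) (0, ψ x) + ∑ i, (fderiv ℝ (B i) (x, w x) (0, ψ x)
        (fderiv ℝ w x (single i 1)) + B i (x, w x) (fderiv ℝ ψ x (single i 1)))) 0 := by
  have hline : HasDerivAt (fun s : ℝ => (x, (w + s • ψ) x)) (0, ψ x) 0 := by
    refine (hasDerivAt_const _ _).prodMk ?_
    simpa using ((hasDerivAt_id (0 : ℝ)).smul_const (ψ x)).const_add (w x)
  have hline0 : (x, w x) = (x, (w + (0 : ℝ) • ψ) x) := by simp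
  have hgrad : ∀ v, HasDerivAt (fun s : ℝ => fderiv ℝ (w + s • ψ) x v) (fderiv ℝ ψ x v) 0 := by
    intro v
    simp only [fderiv_add_smul hw hψ]
    simpa using ((hasDerivAt_id (0 : ℝ)).smul_const (fderiv ℝ ψ x v)).const_add (fderiv ℝ w x v)
  have hAline := hA.hasFDerivAt.comp_hasDerivAt_of_eq 0 hline hline0
  have hBline := fun i => (hB i).hasFDerivAt.comp_hasDerivAt_of_eq 0 hline hline0
  have h : HasDerivAt (fun s : ℝ => affineLagrangian A B (w + s • ψ) x) _ 0 :=
    hAline.add (HasDerivAt.fun_sum fun i (_ : i ∈ Finset.univ) =>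
      (hBline i).clm_apply (hgrad (single i 1)))
  simpa using h

theorem deriv_affineLagrangian_add_smul_smul {w : Space n → State n} (hw : ContDiff ℝ ∞ w)
    {η : Space n → ℝ} (hη : ContDiff ℝ ∞ η) (a : State n) {x : Space n}
    (hA : DifferentiableAt ℝ A (x, w x)) (hB : ∀ i, DifferentiableAt ℝ (B i) (x, w x)) :
    deriv (fun s : ℝ => affineLagrangian A B (w + s • fun y => η y • a) x) 0
      = η x * eulerLagrange A B w a x
        + ∑ i, fderiv ℝ (fun z => η z * B i (z, w z) a) x (single i 1) := by
  have hηx : DifferentiableAt ℝ η x := hη.differentiable (by simp) x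
  have hψ : ∀ v, fderiv ℝ (fun y => η y • a) x v = fderiv ℝ η x v • a := fun v => by
    simp [fderiv_smul_const hηx]
  have hparts : ∀ i, fderiv ℝ (fun z => η z * B i (z, w z) a) x (single i 1)
      = η x * fderiv ℝ (B i) (x, w x) (single i 1, fderiv ℝ w x (single i 1)) a
        + B i (x, w x) a * fderiv ℝ η x (single i 1) := by
    intro i
    have hBw : HasFDerivAt (fun z => B i (z, w z)) _ x :=
      HasFDerivAt.comp (g := B i) (f := fun z => (z, w z)) x (hB i).hasFDerivAt
        ((hasFDerivAt_id x).prodMk (hw.differentiable (by simp) x).hasFDerivAt)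
    rw [(hηx.hasFDerivAt.fun_mul (hBw.clm_apply (hasFDerivAt_const a x))).fderiv]
    simp
  have hscale : ((0 : Space n), η x • a) = η x • ((0 : Space n), a) := by simp
  rw [(hasDerivAt_affineLagrangian_add_smul hw (ψ := fun y => η y • a)
    (hη.smul contDiff_const) hA hB).deriv]
  simp only [hparts, hψ, hscale, eulerLagrange, map_smul, smul_apply, smul_eq_mul, mul_add,
    Finset.mul_sum, add_assoc, ← Finset.sum_add_distrib]
  congr 1
  exact Finset.sum_congr rfl fun i _ => by ring

theorem integral_deriv_affineLagrangian_eq_zero (hI : IsOpen I) (hJ : IsOpen J)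
    (hA : ContDiffOn ℝ ∞ A (Prod.snd ⁻¹' phase n I J))
    (hB : ∀ i, ContDiffOn ℝ ∞ (B i) (Prod.snd ⁻¹' phase n I J))
    (hL : IsTotalDivergence I J fun _ => affineLagrangian A B)
    {w ψ : Space n → State n} (hw : IsField I J w) (hψ : ContDiff ℝ ∞ ψ)
    (hc : HasCompactSupport ψ) :
    ∫ x, deriv (fun s : ℝ => affineLagrangian A B (w + s • ψ) x) 0 = 0 := by
  obtain ⟨δ, hδ, hfield⟩ := exists_forall_isField_add_smul hI hJ hw hψ hc
  have h0 : (0 : ℝ) ∈ Metric.ball 0 δ := Metric.mem_ball_self hδ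
  let g : ℝ → Space n → ℝ := fun s x =>
    affineLagrangian A B (w + s • ψ) x - affineLagrangian A B w x
  have hg : ContDiffOn ℝ 1 ↿g (Metric.ball 0 δ ×ˢ univ) := by
    have hs := contDiffOn_affineLagrangian_add_smul hA hB hw.1 hψ hfield
    have h := hs.sub (hs.comp (f := fun p : ℝ × Space n => ((0 : ℝ), p.2)) (by fun_prop)
      fun p _ => ⟨h0, mem_univ _⟩)
    simp only [Function.comp_def, zero_smul, add_zero] at h
    exact h.of_le (by simp)
  have hgK : ∀ s ∈ Metric.ball (0 : ℝ) δ, ∀ x ∉ tsupport ψ, g s x = 0 := by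
    intro s _ x hx
    have hdψ : fderiv ℝ ψ x = 0 := by
      rw [(notMem_tsupport_iff_eventuallyEq.1 hx).fderiv_eq, fderiv_zero, Pi.zero_apply]
    simp [g, affineLagrangian, fderiv_add_smul hw.1 hψ, hdψ, image_eq_zero_of_notMem_tsupport hx]
  have hgint : (fun s => ∫ x, g s x) =ᶠ[𝓝 0] fun _ => 0 := by
    filter_upwards [Metric.ball_mem_nhds 0 hδ] with s hs
    exact hL.integral_sub_eq_zero hI hJ hw (hfield s hs) hc.smul_left 0
  have hderiv := hasDerivAt_integral_of_forall_notMem_eq_zero (μ := volume) Metric.isOpen_ball hc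
    hgK hg h0
  simpa only [g, deriv_sub_const] using
    hderiv.unique ((hasDerivAt_const (0 : ℝ) (0 : ℝ)).congr_of_eventuallyEq hgint)

theorem eulerLagrange_eq_zero (hI : IsOpen I) (hJ : IsOpen J)
    (hA : ContDiffOn ℝ ∞ A (Prod.snd ⁻¹' phase n I J))
    (hB : ∀ i, ContDiffOn ℝ ∞ (B i) (Prod.snd ⁻¹' phase n I J))
    (hL : IsTotalDivergence I J fun _ => affineLagrangian A B)
    {w : Space n → State n} (hw : IsField I J w) (a : State n) (x : Space n) :
    eulerLagrange A B w a x = 0 := by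
  have hnhds : ∀ x, (Prod.snd ⁻¹' phase n I J) ∈ 𝓝 (x, w x) := fun x =>
    (isOpen_preimage_phase hI hJ).mem_nhds (hw.2 x)
  have hcont := continuous_eulerLagrange hI hJ hA hB hw a
  suffices hae : ∀ᵐ x, eulerLagrange A B w a x = 0 from
    congrFun ((hcont.ae_eq_iff_eq volume continuous_const).1 hae) x
  refine ae_eq_zero_of_integral_contDiff_smul_eq_zero hcont.locallyIntegrable fun η hη hηc => ?_
  have hflux : ∀ i, ContDiff ℝ 1 fun z => η z * B i (z, w z) a := fun i => by
    refine (hη.mul (ContDiff.clm_apply ?_ contDiff_const)).of_le (m := 1) (by simp)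
    exact contDiff_iff_contDiffAt.2 fun z => ((hB i).contDiffAt (hnhds z)).comp z
      (contDiff_id.prodMk hw.1).contDiffAt
  have hfluxc : ∀ i, HasCompactSupport fun z => η z * B i (z, w z) a := fun i => hηc.mul_right
  have hfluxint : ∀ i, Integrable fun z =>
      fderiv ℝ (fun z => η z * B i (z, w z) a) z (single i 1) := fun i =>
    (((hflux i).continuous_fderiv one_ne_zero).clm_apply
      continuous_const).integrable_of_hasCompactSupport ((hfluxc i).fderiv_apply ℝ _)
  have hvar := integral_deriv_affineLagrangian_eq_zero hI hJ hA hB hL hw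
    (hη.smul contDiff_const) (ψ := fun y => η y • a) hηc.smul_right
  simp_rw [fun x => deriv_affineLagrangian_add_smul_smul hw.1 hη a
    ((hA.contDiffAt (hnhds x)).differentiableAt (by simp))
    (fun i => ((hB i).contDiffAt (hnhds x)).differentiableAt (by simp))] at hvar
  have hηint : Integrable fun z => η z * eulerLagrange A B w a z :=
    (hη.continuous.mul hcont).integrable_of_hasCompactSupport hηc.mul_right
  rw [integral_add hηint
    (integrable_finsetSum _ fun i _ => hfluxint i), integral_finsetSum _ fun i _ => hfluxint i,
    Finset.sum_eq_zero fun i _ => integral_fderiv_apply_eq_zero (hflux i) (hfluxc i) _,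
    add_zero] at hvar
  exact hvar

theorem affine_null_lagrangian (hI : IsOpen I) (hJ : IsOpen J)
    (hA : ContDiffOn ℝ ∞ A (Prod.snd ⁻¹' phase n I J))
    (hB : ∀ i, ContDiffOn ℝ ∞ (B i) (Prod.snd ⁻¹' phase n I J))
    (hL : IsTotalDivergence I J fun _ => affineLagrangian A B)
    (x : Space n) {v : State n} (hv : v ∈ phase n I J) (a : State n) :
    fderiv ℝ A (x, v) (0, a) = ∑ i, fderiv ℝ (B i) (x, v) (single i 1, 0) a ∧
      ∀ i b, fderiv ℝ (B i) (x, v) (0, a) b = fderiv ℝ (B i) (x, v) (0, b) a := by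
  have hEL : ∀ {w}, IsField I J w → eulerLagrange A B w a x = 0 := fun hw =>
    eulerLagrange_eq_zero hI hJ hA hB hL hw a x
  have hconst : fderiv ℝ A (x, v) (0, a) = ∑ i, fderiv ℝ (B i) (x, v) (single i 1, 0) a := by
    have h := hEL (isField_const hv)
    simp only [eulerLagrange, fderiv_fun_const, Pi.zero_apply, zero_apply, map_zero, zero_sub,
      Finset.sum_neg_distrib] at h
    linarith
  refine ⟨hconst, fun i b => ?_⟩
  -- Test with a field whose only nonzero derivative at `x` is `∂ᵢw = ε b`.
  obtain ⟨w, hw, rfl, ε, hε, hdw⟩ := exists_isField_fderiv_eq hI hJ x hv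
    ((EuclideanSpace.proj (𝕜 := ℝ) i).smulRight b)
  have hdw' : ∀ j, fderiv ℝ w x (single j 1) = (if j = i then ε else 0) • b := by
    intro j
    simp [hdw, eq_comm (a := i)]
  have hsplit : ∀ j (c : ℝ), fderiv ℝ (B j) (x, w x) (single j 1, c • b) a
      = fderiv ℝ (B j) (x, w x) (single j 1, 0) a + c * fderiv ℝ (B j) (x, w x) (0, b) a := by
    intro j c
    have hpair : ((single j (1 : ℝ) : Space n), c • b)
        = (single j (1 : ℝ), (0 : State n)) + c • (0, b) := by
      ext <;> simp
    rw [hpair, map_add, map_smul, add_apply, smul_apply, smul_eq_mul]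
  have h := hEL hw
  simp only [eulerLagrange, hconst, hdw', hsplit, map_smul, smul_eq_mul, ← Finset.sum_add_distrib,
    ite_mul, zero_mul] at h
  have hsum : ∑ j, (if j = i then
      ε * (fderiv ℝ (B j) (x, w x) (0, a) b - fderiv ℝ (B j) (x, w x) (0, b) a) else 0) = 0 := by
    refine (Finset.sum_congr rfl fun j _ => ?_).trans h
    split_ifs <;> ring
  rw [Finset.sum_ite_eq', if_pos (Finset.mem_univ i)] at hsum
  exact sub_eq_zero.1 ((mul_eq_zero.1 hsum).resolve_left hε.ne')

theorem IsTotalDivergence.eq_of_kinematic (hI : IsOpen I) (hJ : IsOpen J) (hI' : I.OrdConnected)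
    (hJ' : J.OrdConnected) (hA : ContDiffOn ℝ ∞ A (Prod.snd ⁻¹' phase n I J))
    (hL : IsTotalDivergence I J fun _ w x => A (x, w x))
    (x : Space n) {v w : State n} (hv : v ∈ phase n I J) (hw : w ∈ phase n I J) :
    A (x, v) = A (x, w) := by
  have hL' : IsTotalDivergence I J fun _ => affineLagrangian A fun _ _ => 0 :=
    hL.congr fun _ _ _ _ => by simp [affineLagrangian]
  refine eq_of_fderiv_apply_sub_eq_zero (isOpen_preimage_phase hI hJ)
    ((convex_phase hI' hJ').linear_preimage (LinearMap.snd ℝ (Space n) (State n)))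
    (hA.differentiableOn (by simp)) hw hv fun z hz => ?_
  simpa using (affine_null_lagrangian hI hJ hA (fun _ => contDiffOn_const) hL' z.1 (v := z.2) hz
    (v - w)).1

end NullLagrangian

/-! ### Kinematic functions -/

variable {P e : ℝ → ℝ → ℝ}

section

variable {T T₁ T₂ : Kinematic n ℝ}

namespace IsSmoothKinematic

theorem contDiffAt (hI : IsOpen I) (hJ : IsOpen J) (hT : IsSmoothKinematic I J T) (t : ℝ)
    (x : Space n) {v : State n} (hv : v ∈ phase n I J) :
    ContDiffAt ℝ ∞ (uncurried T) (t, x, v) :=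
  ContDiffOn.contDiffAt hT
    (((isOpen_phase hI hJ).preimage (continuous_snd.comp continuous_snd)).mem_nhds hv)

theorem differentiableAt (hI : IsOpen I) (hJ : IsOpen J) (hT : IsSmoothKinematic I J T) (t : ℝ)
    (x : Space n) {v : State n} (hv : v ∈ phase n I J) :
    DifferentiableAt ℝ (uncurried T) (t, x, v) :=
  (hT.contDiffAt hI hJ t x hv).differentiableAt (by simp)

theorem slice (hT : IsSmoothKinematic I J T) (t : ℝ) :
    ContDiffOn ℝ ∞ (fun q : Space n × State n => uncurried T (t, q)) (Prod.snd ⁻¹' phase n I J) :=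
  ContDiffOn.comp (g := uncurried T) hT (by fun_prop) fun _ hq => hq

theorem contDiff_apply (hI : IsOpen I) (hJ : IsOpen J) (hT : IsSmoothKinematic I J T)
    {v : State n} (hv : v ∈ phase n I J) :
    ContDiff ℝ ∞ fun q : ℝ × Space n => uncurried T (q.1, q.2, v) :=
  contDiff_iff_contDiffAt.2 fun q => (hT.contDiffAt hI hJ q.1 q.2 hv).comp q
    (f := fun q : ℝ × Space n => (q.1, q.2, v)) (by fun_prop)

end IsSmoothKinematic

theorem timeDeriv_congr (hI : IsOpen I) (hJ : IsOpen J)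
    (h : ∀ t x, ∀ u : Space n, ∀ ρ ∈ I, ∀ S ∈ J, T₁ t x u ρ S = T₂ t x u ρ S) (t : ℝ)
    {w : Space n → State n} (hw : IsField I J w) (x : Space n) :
    timeDeriv P T₁ t w x = timeDeriv P T₂ t w x := by
  have heq : uncurried T₁ =ᶠ[𝓝 (t, x, w x)] uncurried T₂ := by
    filter_upwards [((isOpen_phase hI hJ).preimage
      (continuous_snd.comp continuous_snd)).mem_nhds (x := (t, x, w x)) (hw.2 x)] with q hq
    exact h _ _ _ _ hq.1 _ hq.2
  rw [timeDeriv, heq.fderiv_eq, timeDeriv]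

theorem timeDeriv_add {t : ℝ} {w : Space n → State n} {x : Space n}
    (h₁ : DifferentiableAt ℝ (uncurried T₁) (t, x, w x))
    (h₂ : DifferentiableAt ℝ (uncurried T₂) (t, x, w x)) :
    timeDeriv P (T₁ + T₂) t w x = timeDeriv P T₁ t w x + timeDeriv P T₂ t w x :=
  DFunLike.congr_fun (fderiv_add h₁ h₂) _

theorem timeDeriv_smul {t : ℝ} {w : Space n → State n} {x : Space n}
    (h : DifferentiableAt ℝ (uncurried T) (t, x, w x)) (c : ℝ) :
    timeDeriv P (c • T) t w x = c * timeDeriv P T t w x :=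
  DFunLike.congr_fun (fderiv_const_smul h c) _

/-! ### The space of conserved densities -/

theorem isConserved_iff_isTotalDivergence :
    IsConserved I J P T ↔ IsTotalDivergence I J (timeDeriv P T) := by
  constructor
  all_goals
    rintro ⟨k, X, hX, hdiv⟩
    refine ⟨k, fun t x j => -X t x j, hX.neg, fun t w hw x => ?_⟩
    have h := hdiv t w hw x
    rw [divergence_neg]
    linarith

theorem IsConserved.congr (hI : IsOpen I) (hJ : IsOpen J) (h₁ : IsConserved I J P T₁)
    (h : ∀ t x, ∀ u : Space n, ∀ ρ ∈ I, ∀ S ∈ J, T₁ t x u ρ S = T₂ t x u ρ S) :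
    IsConserved I J P T₂ :=
  isConserved_iff_isTotalDivergence.2 ((isConserved_iff_isTotalDivergence.1 h₁).congr
    fun t _ hw x => (timeDeriv_congr hI hJ h t hw x).symm)

/-- The vector space of smooth conserved densities of kinematic form. -/
def conservedDensity (hI : IsOpen I) (hJ : IsOpen J) (P : ℝ → ℝ → ℝ) :
    Submodule ℝ (Kinematic n ℝ) where
  carrier := {T | IsSmoothKinematic I J T ∧ IsConserved I J P T}
  zero_mem' := ⟨contDiffOn_const (c := 0), isConserved_iff_isTotalDivergence.2
    ⟨0, fun _ _ _ => 0, contDiffOn_const, fun t w _ x => by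
      rw [divergence_const, timeDeriv, show uncurried (0 : Kinematic n ℝ) = 0 from rfl]
      simp⟩⟩
  add_mem' := fun h₁ h₂ => ⟨ContDiffOn.add h₁.1 h₂.1, isConserved_iff_isTotalDivergence.2 <|
    ((isConserved_iff_isTotalDivergence.1 h₁.2).add hI hJ
      (isConserved_iff_isTotalDivergence.1 h₂.2)).congr fun t _ hw x =>
        timeDeriv_add (h₁.1.differentiableAt hI hJ t x (hw.2 x))
          (h₂.1.differentiableAt hI hJ t x (hw.2 x))⟩
  smul_mem' := fun c _ h => ⟨ContDiffOn.const_smul c h.1, isConserved_iff_isTotalDivergence.2 <|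
    ((isConserved_iff_isTotalDivergence.1 h.2).const_mul hI hJ c).congr fun t _ hw x =>
      timeDeriv_smul (h.1.differentiableAt hI hJ t x (hw.2 x)) c⟩

theorem isTotalDivergence_of_contDiff (hn : 0 < n) {g : ℝ × Space n → ℝ} (hg : ContDiff ℝ ∞ g) :
    IsTotalDivergence I J fun t _ x => g (t, x) := by
  obtain ⟨Θ, hΘ, hdiv⟩ := exists_divergence_eq hn hg
  exact ⟨0, fun t x _ => Θ (t, x), (hΘ.comp (by fun_prop)).contDiffOn,
    fun t _ _ x => (hdiv t x).symm⟩

/-- The density `g(t, x)`, independent of the state of the fluid. By `IsTrivial.eq_of_mem_phase`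
the smooth trivial densities are of this form. -/
def background (g : ℝ × Space n → ℝ) : Kinematic n ℝ := fun t x _ _ _ => g (t, x)

theorem isTrivial_background (hn : 0 < n) {g : ℝ × Space n → ℝ} (hg : ContDiff ℝ ∞ g) :
    IsTrivial I J (background g) :=
  isTotalDivergence_of_contDiff hn hg

theorem timeDeriv_background {g : ℝ × Space n → ℝ} (hg : Differentiable ℝ g) (t : ℝ)
    (w : Space n → State n) (x : Space n) :
    timeDeriv P (background g) t w x = fderiv ℝ g (t, x) (1, 0) := by
  have h : HasFDerivAt (uncurried (background g)) _ (t, x, w x) :=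
    HasFDerivAt.comp (f := fun q : ℝ × Space n × State n => (q.1, q.2.1)) (t, x, w x)
      (hg (t, x)).hasFDerivAt (hasFDerivAt_fst.prodMk (hasFDerivAt_fst.comp _ hasFDerivAt_snd))
  rw [timeDeriv, h.fderiv]
  rfl

theorem isConserved_background (hn : 0 < n) {g : ℝ × Space n → ℝ} (hg : ContDiff ℝ ∞ g) :
    IsConserved I J P (background g) :=
  isConserved_iff_isTotalDivergence.2 <|
    (isTotalDivergence_of_contDiff hn
      (g := fun q => fderiv ℝ g q (1, 0)) ((hg.fderiv_right (by simp)).clm_apply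
        contDiff_const)).congr fun t w _ x =>
      timeDeriv_background (hg.differentiable (by simp)) t w x

theorem IsTrivial.eq_of_mem_phase (hI : IsOpen I) (hJ : IsOpen J) (hI' : I.OrdConnected)
    (hJ' : J.OrdConnected) (hT : IsSmoothKinematic I J T) (h : IsTrivial I J T) (t : ℝ)
    (x : Space n) {v w : State n} (hv : v ∈ phase n I J) (hw : w ∈ phase n I J) :
    uncurried T (t, x, v) = uncurried T (t, x, w) :=
  IsTotalDivergence.eq_of_kinematic hI hJ hI' hJ' (hT.slice t)
    (IsTotalDivergence.slice (L := onField T) h t) x hv hw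

theorem IsTrivial.isConserved (hn : 0 < n) (hI : IsOpen I) (hJ : IsOpen J)
    (hI' : I.OrdConnected) (hJ' : J.OrdConnected) {v : State n} (hv : v ∈ phase n I J)
    (hT : IsSmoothKinematic I J T) (h : IsTrivial I J T) : IsConserved I J P T :=
  (isConserved_background hn (hT.contDiff_apply hI hJ hv)).congr hI hJ fun t x u ρ hρ S hS =>
    h.eq_of_mem_phase hI hJ hI' hJ' hT t x hv (w := (u, ρ, S)) ⟨hρ, hS⟩

end

/-! ### Balance laws in a frame moving with the fluid -/

section

variable {T : Kinematic n ℝ}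

theorem timeDeriv_add_divergence_smul {t : ℝ} {w : Space n → State n} {x : Space n}
    (hT : DifferentiableAt ℝ (uncurried T) (t, x, w x)) (hw : DifferentiableAt ℝ w x) :
    timeDeriv P T t w x + divergence (fun y => onField T t w y • (w y).1) x
      = fderiv ℝ (uncurried T) (t, x, w x) (1, (w x).1,
          (-(((w x).2.1)⁻¹ • gradient (fun y => P (w y).2.1 (w y).2.2) x),
            -((w x).2.1 * divergence (fun y => (w y).1) x), 0))
        + onField T t w x * divergence (fun y => (w y).1) x := by
  have hTw : HasFDerivAt (onField T t w) _ x :=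
    HasFDerivAt.comp (g := uncurried T) (f := fun y => (t, y, w y)) x hT.hasFDerivAt
      ((hasFDerivAt_const t x).prodMk ((hasFDerivAt_id x).prodMk hw.hasFDerivAt))
  -- The transport terms `-(u·∇)(u, ρ, S)` of the Euler equations cancel against `u·∇T`.
  have hdir : ((1 : ℝ), (w x).1,
      (-(((w x).2.1)⁻¹ • gradient (fun y => P (w y).2.1 (w y).2.2) x),
        -((w x).2.1 * divergence (fun y => (w y).1) x), (0 : ℝ)))
      = (1, 0, eulerRHS P w x) + (0, (w x).1, fderiv ℝ w x (w x).1) := by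
    rw [eulerRHS, divergence_smul hw.snd.fst hw.fst, fderiv.fst hw, fderiv.fst hw.snd,
      fderiv.snd hw.snd, fderiv.snd hw]
    ext <;> simp
    ring
  rw [divergence_smul hTw.differentiableAt hw.fst, hTw.fderiv, hdir, map_add, timeDeriv]
  simp only [ContinuousLinearMap.comp_apply, ContinuousLinearMap.prod_apply, zero_apply,
    ContinuousLinearMap.id_apply]
  ring

/-- The densities `ρ(β(½|u|² + e) + α·u + h)` with `β, α` functions of `(t, x)` and `h` a function
of `(t, x, S)`. Up to trivial densities all conserved densities have this form. -/
def affineDensity (e : ℝ → ℝ → ℝ) (β : ℝ × Space n → ℝ) (α : ℝ × Space n → Space n)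
    (h : ℝ × Space n × ℝ → ℝ) : Kinematic n ℝ := fun t x u ρ S =>
  ρ * (β (t, x) * (‖u‖ ^ 2 / 2 + e ρ S) + inner ℝ (α (t, x)) u + h (t, x, S))

variable {β : ℝ × Space n → ℝ} {α : ℝ × Space n → Space n}
  {h : ℝ × Space n × ℝ → ℝ}

/-- The source that remains in the balance law of `affineDensity e β α h` after splitting off the
moving flux `P(βu + α)`, as a function of position and state. -/
def balanceSource (P e : ℝ → ℝ → ℝ) (β : ℝ × Space n → ℝ) (α : ℝ × Space n → Space n)
    (h : ℝ × Space n × ℝ → ℝ) (t : ℝ) (q : Space n × State n) : ℝ :=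
  q.2.2.1 * (fderiv ℝ β (t, q.1) (1, q.2.1) * (‖q.2.1‖ ^ 2 / 2 + e q.2.2.1 q.2.2.2)
      + inner ℝ (fderiv ℝ α (t, q.1) (1, q.2.1)) q.2.1
      + fderiv ℝ h (t, q.1, q.2.2.2) (1, q.2.1, 0))
    + P q.2.2.1 q.2.2.2 * (fderiv ℝ β (t, q.1) (0, q.2.1)
      + ∑ i, fderiv ℝ α (t, q.1) (0, single i 1) i)

theorem isSmoothKinematic_stateFunction {f : ℝ → ℝ → ℝ}
    (hf : ContDiffOn ℝ ∞ (fun q : ℝ × ℝ => f q.1 q.2) (I ×ˢ J)) :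
    IsSmoothKinematic (n := n) I J fun _ _ _ ρ S => f ρ S :=
  hf.comp (f := fun q : ℝ × Space n × State n => (q.2.2.2.1, q.2.2.2.2)) (by fun_prop)
    fun _ hq => hq

theorem isSmoothKinematic_affineDensity
    (he : ContDiffOn ℝ ∞ (fun q : ℝ × ℝ => e q.1 q.2) (I ×ˢ J)) (hβ : ContDiff ℝ ∞ β)
    (hα : ContDiff ℝ ∞ α) (hh : ContDiffOn ℝ ∞ h {q | q.2.2 ∈ J}) :
    IsSmoothKinematic I J (affineDensity e β α h) := by
  have hpoint : ContDiff ℝ ∞ fun q : ℝ × Space n × State n => (q.1, q.2.1) := by fun_prop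
  have hu : ContDiff ℝ ∞ fun q : ℝ × Space n × State n => q.2.2.1 := by fun_prop
  have hh' : ContDiffOn ℝ ∞ (fun q : ℝ × Space n × State n => h (q.1, q.2.1, q.2.2.2.2))
      {q | q.2.2.2.1 ∈ I ∧ q.2.2.2.2 ∈ J} :=
    hh.comp (f := fun q : ℝ × Space n × State n => (q.1, q.2.1, q.2.2.2.2)) (by fun_prop)
      fun _ hq => hq.2
  exact (ContDiff.contDiffOn (by fun_prop)).mul ((((hβ.comp hpoint).contDiffOn.mul
    (((hu.norm_sq ℝ).div_const 2).contDiffOn.add (isSmoothKinematic_stateFunction he))).add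
      ((hα.comp hpoint).inner ℝ hu).contDiffOn).add hh')

theorem hasLineDerivAt_affineDensity {e' t ρ S : ℝ} {x : Space n}
    (he : HasDerivAt (fun r => e r S) e' ρ) (hβ : DifferentiableAt ℝ β (t, x))
    (hα : DifferentiableAt ℝ α (t, x)) (hh : DifferentiableAt ℝ h (t, x, S))
    (u y a : Space n) (r : ℝ) :
    HasLineDerivAt ℝ (uncurried (affineDensity e β α h))
      (r * (β (t, x) * (‖u‖ ^ 2 / 2 + e ρ S) + inner ℝ (α (t, x)) u + h (t, x, S))
        + ρ * (fderiv ℝ β (t, x) (1, y) * (‖u‖ ^ 2 / 2 + e ρ S)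
          + β (t, x) * (inner ℝ u a + e' * r) + inner ℝ (α (t, x)) a
          + inner ℝ (fderiv ℝ α (t, x) (1, y)) u + fderiv ℝ h (t, x, S) (1, y, 0)))
      (t, x, u, ρ, S) (1, y, a, r, 0) := by
  have hρs : HasDerivAt (fun s : ℝ => ρ + s • r) r 0 := by
    simpa using ((hasDerivAt_id (0 : ℝ)).smul_const r).const_add ρ
  have hus : HasDerivAt (fun s : ℝ => u + s • a) a 0 := by
    simpa using ((hasDerivAt_id (0 : ℝ)).smul_const a).const_add u
  have hes : HasDerivAt (fun s : ℝ => e (ρ + s • r) (S + s • 0)) (e' * r) 0 := by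
    simp only [smul_zero, add_zero]
    exact he.comp_of_eq 0 hρs (by simp)
  have hβs := hβ.hasFDerivAt.hasLineDerivAt (1, y)
  have hαs := hα.hasFDerivAt.hasLineDerivAt (1, y)
  have hhs := hh.hasFDerivAt.hasLineDerivAt (1, y, 0)
  have hT := hρs.fun_mul (((HasDerivAt.fun_mul hβs ((hus.norm_sq.div_const 2).fun_add hes)).fun_add
    (HasDerivAt.inner ℝ hαs hus)).fun_add hhs)
  refine HasDerivAt.congr_deriv hT ?_
  simp only [zero_smul, smul_zero, add_zero]
  ring

theorem divergence_smul_smul_add {p b : Space n → ℝ} {u a : Space n → Space n} {x : Space n}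
    (hp : DifferentiableAt ℝ p x) (hb : DifferentiableAt ℝ b x) (hu : DifferentiableAt ℝ u x)
    (ha : DifferentiableAt ℝ a x) :
    divergence (fun y => p y • (b y • u y + a y)) x
      = p x * (b x * divergence u x + fderiv ℝ b x (u x) + divergence a x)
        + inner ℝ (gradient p x) (b x • u x + a x) := by
  rw [divergence_smul hp ((hb.fun_smul hu).fun_add ha), divergence_add (hb.fun_smul hu) ha,
    divergence_smul hb hu, gradient, InnerProductSpace.toDual_symm_apply]

theorem timeDeriv_affineDensity_add_divergence (hI : IsOpen I) (hJ : IsOpen J)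
    (hIpos : I ⊆ Ioi 0) (hP : ContDiffOn ℝ ∞ (fun q : ℝ × ℝ => P q.1 q.2) (I ×ˢ J)) {p₀ : ℝ}
    (he : IsInternalEnergy I J (fun ρ S => P ρ S - p₀) e) (hβ : ContDiff ℝ ∞ β)
    (hα : ContDiff ℝ ∞ α) (hh : ContDiffOn ℝ ∞ h {q | q.2.2 ∈ J}) (t : ℝ)
    {w : Space n → State n} (hw : IsField I J w) (x : Space n) :
    timeDeriv P (affineDensity e β α h) t w x
      + divergence (fun y => onField (affineDensity e β α h) t w y • (w y).1
          + (P (w y).2.1 (w y).2.2 - p₀) • (β (t, y) • (w y).1 + α (t, y))) x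
      = balanceSource (fun ρ S => P ρ S - p₀) e β α h t (x, w x) := by
  have hT := (isSmoothKinematic_affineDensity he.1 hβ hα hh).differentiableAt hI hJ t x (hw.2 x)
  have hwx : DifferentiableAt ℝ w x := hw.1.differentiable (by simp) x
  have hβx : DifferentiableAt ℝ β (t, x) := hβ.differentiable (by simp) _
  have hαx : DifferentiableAt ℝ α (t, x) := hα.differentiable (by simp) _
  have hhx : DifferentiableAt ℝ h (t, x, (w x).2.2) :=
    (hh.contDiffAt ((hJ.preimage (continuous_snd.comp continuous_snd)).mem_nhds
      (hw.2 x).2)).differentiableAt (by simp)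
  have hp : DifferentiableAt ℝ (fun y => P (w y).2.1 (w y).2.2) x :=
    DifferentiableAt.comp (g := fun q : ℝ × ℝ => P q.1 q.2) x
      ((hP.contDiffAt ((hI.prod hJ).mem_nhds (hw.2 x))).differentiableAt (by simp)) hwx.snd
  have hβt : HasFDerivAt (fun y => β (t, y)) _ x :=
    hβx.hasFDerivAt.comp x (hasFDerivAt_prodMk_right t x)
  have hαt : HasFDerivAt (fun y => α (t, y)) _ x :=
    hαx.hasFDerivAt.comp x (hasFDerivAt_prodMk_right t x)
  have hTw : DifferentiableAt ℝ (onField (affineDensity e β α h) t w) x :=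
    DifferentiableAt.comp (g := uncurried (affineDensity e β α h)) (f := fun y => (t, y, w y)) x
      hT (by fun_prop)
  have hdivα : divergence (fun y => α (t, y)) x = ∑ i, fderiv ℝ α (t, x) (0, single i 1) i := by
    simp [divergence, hαt.fderiv]
  have hpflux := divergence_smul_smul_add (hp.sub_const p₀) hβt.differentiableAt hwx.fst
    hαt.differentiableAt
  have hgrad : gradient (fun y => P (w y).2.1 (w y).2.2 - p₀) x
      = gradient (fun y => P (w y).2.1 (w y).2.2) x := by
    rw [gradient, fderiv_sub_const, gradient]
  rw [hdivα, hβt.fderiv, hgrad] at hpflux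
  have hline := (hT.hasFDerivAt.hasLineDerivAt _).unique (hasLineDerivAt_affineDensity
    (he.2 _ (hw.2 x).1 _ (hw.2 x).2) hβx hαx hhx (w x).1 (w x).1
    (-(((w x).2.1)⁻¹ • gradient (fun y => P (w y).2.1 (w y).2.2) x))
    (-((w x).2.1 * divergence (fun y => (w y).1) x)))
  rw [divergence_add (hTw.fun_smul hwx.fst) ((hp.sub_const p₀).fun_smul
    ((hβt.differentiableAt.fun_smul hwx.fst).fun_add hαt.differentiableAt)), ← add_assoc,
    timeDeriv_add_divergence_smul hT hwx, hline, hpflux]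
  have hρ : (w x).2.1 ≠ 0 := (hIpos (hw.2 x).1).ne'
  simp only [balanceSource, onField, affineDensity, ContinuousLinearMap.comp_apply,
    ContinuousLinearMap.inr_apply, inner_neg_right, inner_smul_right, inner_add_right,
    real_inner_comm (gradient _ x)]
  field_simp
  ring

end

/-! ### The conservation laws -/

theorem isTotalDivergence_divergence_movingFlux {T : Kinematic n ℝ} {ξ : Kinematic n (Space n)}
    (hT : IsSmoothKinematic I J T)
    (hξ : ContDiffOn ℝ ∞ (uncurried ξ) {q | q.2.2.2.1 ∈ I ∧ q.2.2.2.2 ∈ J}) :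
    IsTotalDivergence I J fun t w =>
      divergence fun y => onField T t w y • (w y).1 + onField ξ t w y := by
  have hX : ContDiffOn ℝ ∞ (fun q => uncurried T q • q.2.2.1 + uncurried ξ q)
      {q | q.2.2.2.1 ∈ I ∧ q.2.2.2.2 ∈ J} :=
    (ContDiffOn.smul (f := uncurried T) hT (by fun_prop)).add hξ
  exact ⟨0, fun t x z => uncurried T (t, x, z.1) • z.1.1 + uncurried ξ (t, x, z.1),
    hX.comp (f := fun q : ℝ × Space n × Jet n 0 => (q.1, q.2.1, q.2.2.1)) (by fun_prop)
      fun _ hq => hq, fun _ _ _ _ => rfl⟩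

theorem HasMovingFlux.mem_conservedDensity (hI : IsOpen I) (hJ : IsOpen J) {T : Kinematic n ℝ}
    {ξ : Kinematic n (Space n)} (h : HasMovingFlux I J P T ξ) (hT : IsSmoothKinematic I J T)
    (hξ : ContDiffOn ℝ ∞ (uncurried ξ) {q | q.2.2.2.1 ∈ I ∧ q.2.2.2.2 ∈ J}) :
    T ∈ conservedDensity hI hJ P := by
  refine ⟨hT, isConserved_iff_isTotalDivergence.2
    (((isTotalDivergence_divergence_movingFlux hT hξ).const_mul hI hJ (-1)).congr
      fun t w hw x => ?_)⟩
  linarith [h t w hw x]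

theorem contDiffOn_stateFunction_smul {f : ℝ → ℝ → ℝ}
    (hf : ContDiffOn ℝ ∞ (fun q : ℝ × ℝ => f q.1 q.2) (I ×ˢ J))
    {V : ℝ × Space n × State n → Space n} (hV : ContDiff ℝ ∞ V) :
    ContDiffOn ℝ ∞ (fun q => f q.2.2.2.1 q.2.2.2.2 • V q) {q | q.2.2.2.1 ∈ I ∧ q.2.2.2.2 ∈ J} :=
  ContDiffOn.smul (isSmoothKinematic_stateFunction hf) hV.contDiffOn

theorem hasMovingFlux_affineDensity {β : ℝ × Space n → ℝ} {α : ℝ × Space n → Space n}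
    {h : ℝ × Space n × ℝ → ℝ} (hI : IsOpen I) (hJ : IsOpen J) (hIpos : I ⊆ Ioi 0)
    (hP : ContDiffOn ℝ ∞ (fun q : ℝ × ℝ => P q.1 q.2) (I ×ˢ J)) {p₀ : ℝ}
    (he : IsInternalEnergy I J (fun ρ S => P ρ S - p₀) e) (hβ : ContDiff ℝ ∞ β)
    (hα : ContDiff ℝ ∞ α) (hh : ContDiffOn ℝ ∞ h {q | q.2.2 ∈ J})
    (hbalance : ∀ t x u, ∀ ρ ∈ I, ∀ S ∈ J,
      balanceSource (fun ρ S => P ρ S - p₀) e β α h t (x, u, ρ, S) = 0) :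
    HasMovingFlux I J P (affineDensity e β α h)
      (fun t x u ρ S => (P ρ S - p₀) • (β (t, x) • u + α (t, x))) := fun t w hw x =>
  (timeDeriv_affineDensity_add_divergence hI hJ hIpos hP he hβ hα hh t hw x).trans
    (hbalance t x (w x).1 _ (hw.2 x).1 _ (hw.2 x).2)

theorem IsInternalEnergy.sub_zero (he : IsInternalEnergy I J P e) :
    IsInternalEnergy I J (fun ρ S => P ρ S - 0) e := by simpa only [_root_.sub_zero]

theorem hasMovingFlux_entropy (hI : IsOpen I) (hJ : IsOpen J) (hIpos : I ⊆ Ioi 0)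
    (hP : ContDiffOn ℝ ∞ (fun q : ℝ × ℝ => P q.1 q.2) (I ×ˢ J)) (he : IsInternalEnergy I J P e)
    {f : ℝ → ℝ} (hf : ContDiffOn ℝ ∞ f J) :
    HasMovingFlux (n := n) I J P (entropy f) (fun _ _ _ _ _ => 0) := by
  have hderiv (t : ℝ) (x u : Space n) (S : ℝ) (hS : S ∈ J) :
      fderiv ℝ (fun q : ℝ × Space n × ℝ => f q.2.2) (t, x, S) (1, u, 0) = 0 := by
    have hfS := ((hf.contDiffAt (hJ.mem_nhds hS)).differentiableAt (by simp)).hasFDerivAt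
    have hcomp : HasFDerivAt (fun q : ℝ × Space n × ℝ => f q.2.2) _ (t, x, S) :=
      HasFDerivAt.comp (f := fun q : ℝ × Space n × ℝ => q.2.2) (t, x, S) hfS
        (hasFDerivAt_snd.comp _ hasFDerivAt_snd)
    simp [hcomp.fderiv]
  convert hasMovingFlux_affineDensity (β := fun _ => 0) (α := fun _ => (0 : Space n))
    (h := fun q => f q.2.2) hI hJ hIpos hP he.sub_zero contDiff_const contDiff_const
    (hf.comp (by fun_prop) fun _ hq => hq) ?_ using 1
  · simp [funext_iff, affineDensity, entropy]
  · simp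
  · intro t x u ρ _ S hS
    simp [balanceSource, hderiv t x u S hS]

theorem hasMovingFlux_mass (hI : IsOpen I) (hJ : IsOpen J) (hIpos : I ⊆ Ioi 0)
    (hP : ContDiffOn ℝ ∞ (fun q : ℝ × ℝ => P q.1 q.2) (I ×ˢ J))
    (he : IsInternalEnergy I J P e) :
    HasMovingFlux (n := n) I J P mass (fun _ _ _ _ _ => 0) := by
  have hmass : (mass : Kinematic n ℝ) = entropy fun _ => 1 := by
    simp [funext_iff, mass, entropy]
  exact hmass ▸ hasMovingFlux_entropy hI hJ hIpos hP he contDiffOn_const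

theorem hasMovingFlux_momentum (hI : IsOpen I) (hJ : IsOpen J) (hIpos : I ⊆ Ioi 0)
    (hP : ContDiffOn ℝ ∞ (fun q : ℝ × ℝ => P q.1 q.2) (I ×ˢ J)) (he : IsInternalEnergy I J P e)
    (k : Fin n) :
    HasMovingFlux I J P (momentum k) (fun _ _ _ ρ S => P ρ S • single k 1) := by
  convert hasMovingFlux_affineDensity (β := fun _ => 0) (α := fun _ => single k (1 : ℝ))
    (h := fun _ => 0) hI hJ hIpos hP he.sub_zero contDiff_const contDiff_const contDiffOn_const ?_
    using 1
  · simp [funext_iff, affineDensity, momentum, EuclideanSpace.inner_single_left]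
  · simp
  · simp [balanceSource]

theorem hasMovingFlux_angularMomentum (hI : IsOpen I) (hJ : IsOpen J) (hIpos : I ⊆ Ioi 0)
    (hP : ContDiffOn ℝ ∞ (fun q : ℝ × ℝ => P q.1 q.2) (I ×ˢ J)) (he : IsInternalEnergy I J P e)
    (j k : Fin n) :
    HasMovingFlux I J P (angularMomentum j k)
      (fun _ x _ ρ S => P ρ S • (x k • single j 1 - x j • single k 1)) := by
  let A : ℝ × Space n →L[ℝ] Space n :=
    ((EuclideanSpace.proj (𝕜 := ℝ) k).smulRight (single j (1 : ℝ))
      - (EuclideanSpace.proj (𝕜 := ℝ) j).smulRight (single k (1 : ℝ))).comp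
        (ContinuousLinearMap.snd ℝ ℝ (Space n))
  have hA (q : ℝ × Space n) : A q = q.2 k • single j 1 - q.2 j • single k 1 := rfl
  have hskew (t : ℝ) (u : Space n) : inner ℝ (A (t, u)) u = 0 := by
    simp [hA, inner_sub_left, inner_smul_left, EuclideanSpace.inner_single_left, mul_comm]
  have htrace : ∑ i, A (0, single i 1) i = 0 := by
    simp only [hA, PiLp.sub_apply, PiLp.smul_apply, PiLp.single_apply, smul_eq_mul]
    simp [Finset.sum_sub_distrib, eq_comm]
  convert hasMovingFlux_affineDensity (β := fun _ => 0) (α := A) (h := fun _ => 0) hI hJ hIpos hP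
    he.sub_zero contDiff_const A.contDiff contDiffOn_const ?_ using 1
  · simp [funext_iff, affineDensity, angularMomentum, hA, inner_sub_left, inner_smul_left,
      EuclideanSpace.inner_single_left, mul_comm]
  · simp [hA]
  · simp [balanceSource, hskew, htrace]

theorem hasMovingFlux_galileanMomentum (hI : IsOpen I) (hJ : IsOpen J) (hIpos : I ⊆ Ioi 0)
    (hP : ContDiffOn ℝ ∞ (fun q : ℝ × ℝ => P q.1 q.2) (I ×ˢ J)) (he : IsInternalEnergy I J P e)
    (k : Fin n) :
    HasMovingFlux I J P (galileanMomentum k) (fun t _ _ ρ S => (t * P ρ S) • single k 1) := by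
  let A : ℝ × Space n →L[ℝ] Space n :=
    (ContinuousLinearMap.fst ℝ ℝ (Space n)).smulRight (single k (1 : ℝ))
  let H : ℝ × Space n × ℝ →L[ℝ] ℝ := -((EuclideanSpace.proj (𝕜 := ℝ) k).comp
    ((ContinuousLinearMap.fst ℝ (Space n) ℝ).comp (ContinuousLinearMap.snd ℝ ℝ (Space n × ℝ))))
  have hA (q : ℝ × Space n) : A q = q.1 • single k 1 := rfl
  have hH (q : ℝ × Space n × ℝ) : H q = -q.2.1 k := rfl
  convert hasMovingFlux_affineDensity (β := fun _ => 0) (α := A) (h := H) hI hJ hIpos hP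
    he.sub_zero contDiff_const A.contDiff H.contDiff.contDiffOn ?_ using 1
  · simp [funext_iff, affineDensity, galileanMomentum, hA, hH, inner_smul_left,
      EuclideanSpace.inner_single_left, sub_eq_add_neg]
  · simp [hA, smul_smul, mul_comm]
  · simp [balanceSource, hA, hH, EuclideanSpace.inner_single_left]

theorem hasMovingFlux_energy (hI : IsOpen I) (hJ : IsOpen J) (hIpos : I ⊆ Ioi 0)
    (hP : ContDiffOn ℝ ∞ (fun q : ℝ × ℝ => P q.1 q.2) (I ×ˢ J))
    (he : IsInternalEnergy I J P e) :
    HasMovingFlux (n := n) I J P (energy e) (fun _ _ u ρ S => P ρ S • u) := by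
  convert hasMovingFlux_affineDensity (β := fun _ => 1) (α := fun _ => (0 : Space n))
    (h := fun _ => 0) hI hJ hIpos hP he.sub_zero contDiff_const contDiff_const contDiffOn_const ?_
    using 1
  · simp [funext_iff, affineDensity, energy]
  · simp
  · simp [balanceSource]

section Polytropic

variable {κ : ℝ → ℝ} {p₀ : ℝ}

theorem IsShiftedPolytropic.mul_polytropicEnergy (hIpos : I ⊆ Ioi 0)
    (hκ : IsShiftedPolytropic n I J P κ p₀) {ρ S : ℝ} (hρ : ρ ∈ I) (hS : S ∈ J) :
    ρ * polytropicEnergy n κ ρ S = (n : ℝ) / 2 * (P ρ S - p₀) := by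
  rw [hκ ρ hρ S hS, polytropicEnergy, Real.rpow_add (hIpos hρ), Real.rpow_one]
  ring

theorem IsShiftedPolytropic.isInternalEnergy (hn : 0 < n) (hIpos : I ⊆ Ioi 0)
    (hP : ContDiffOn ℝ ∞ (fun q : ℝ × ℝ => P q.1 q.2) (I ×ˢ J))
    (hκ : IsShiftedPolytropic n I J P κ p₀) :
    IsInternalEnergy I J (fun ρ S => P ρ S - p₀) (polytropicEnergy n κ) := by
  refine ⟨?_, fun ρ hρ S hS => ?_⟩
  -- `κ` is not assumed to be smooth, so smoothness is read off from `ẽ = (n/2)(P - p₀)/ρ`.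
  · have hsmooth : ContDiffOn ℝ ∞ (fun q : ℝ × ℝ => (n : ℝ) / 2 * (P q.1 q.2 - p₀) / q.1)
        (I ×ˢ J) :=
      (contDiffOn_const.mul (hP.sub contDiffOn_const)).div contDiffOn_fst
        fun q hq => (hIpos hq.1).ne'
    refine hsmooth.congr fun q hq => ?_
    rw [← hκ.mul_polytropicEnergy hIpos hq.1 hq.2, mul_div_cancel_left₀ _ (hIpos hq.1).ne']
  · have hpos : 0 < ρ := hIpos hρ
    have hn' : (n : ℝ) ≠ 0 := by exact_mod_cast hn.ne'
    have hrpow : ρ ^ (1 + 2 / (n : ℝ)) = ρ ^ (2 : ℕ) * ρ ^ (2 / (n : ℝ) - 1) := by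
      rw [← Real.rpow_natCast, ← Real.rpow_add hpos]
      congr 1
      push_cast
      ring
    refine ((Real.hasDerivAt_rpow_const (Or.inl hpos.ne')).const_mul _).congr_deriv ?_
    simp only [hκ ρ hρ S hS, hrpow]
    field_simp
    ring

theorem IsShiftedPolytropic.energy_polytropicEnergy (hIpos : I ⊆ Ioi 0)
    (hκ : IsShiftedPolytropic n I J P κ p₀) (t : ℝ) (x u : Space n) {ρ S : ℝ} (hρ : ρ ∈ I)
    (hS : S ∈ J) :
    energy (polytropicEnergy n κ) t x u ρ S
      = ρ * ‖u‖ ^ 2 / 2 + (n : ℝ) / 2 * (P ρ S - p₀) := by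
  rw [← hκ.mul_polytropicEnergy hIpos hρ hS, energy]
  ring

theorem similarityEnergy_eq_affineDensity (e : ℝ → ℝ → ℝ) :
    (similarityEnergy e : Kinematic n ℝ)
      = affineDensity e Prod.fst (fun q => (-(1 / 2) : ℝ) • q.2) fun _ => 0 := by
  funext t x u ρ S
  simp only [similarityEnergy, energy, affineDensity, inner_smul_left, real_inner_comm u x,
    RCLike.conj_to_real]
  ring

theorem dilationalEnergy_eq_affineDensity (e : ℝ → ℝ → ℝ) :
    (dilationalEnergy e : Kinematic n ℝ)
      = affineDensity e (fun q => q.1 ^ 2) (fun q => -(q.1 • q.2))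
        fun q => 1 / 2 * ‖q.2.1‖ ^ 2 := by
  funext t x u ρ S
  simp only [dilationalEnergy, energy, affineDensity, inner_neg_left, inner_smul_left,
    real_inner_comm u x, RCLike.conj_to_real]
  ring

theorem hasMovingFlux_similarityEnergy (hn : 0 < n) (hI : IsOpen I) (hJ : IsOpen J)
    (hIpos : I ⊆ Ioi 0) (hP : ContDiffOn ℝ ∞ (fun q : ℝ × ℝ => P q.1 q.2) (I ×ˢ J))
    (hκ : IsShiftedPolytropic n I J P κ p₀) :
    HasMovingFlux (n := n) I J P (similarityEnergy (polytropicEnergy n κ))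
      (fun t x u ρ S => (P ρ S - p₀) • (t • u - (1 / 2 : ℝ) • x)) := by
  rw [similarityEnergy_eq_affineDensity]
  convert hasMovingFlux_affineDensity (β := Prod.fst) (α := fun q => (-(1 / 2) : ℝ) • q.2)
    (h := fun _ => 0) hI hJ hIpos hP (hκ.isInternalEnergy hn hIpos hP) contDiff_fst (by fun_prop)
    contDiffOn_const ?_ using 7
  · rw [neg_smul, sub_eq_add_neg]
  · intro t x u ρ hρ S hS
    have hα (s : ℝ) (y : Space n) :
        fderiv ℝ (fun q : ℝ × Space n => (-(1 / 2) : ℝ) • q.2) (t, x) (s, y)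
          = (-(1 / 2) : ℝ) • y := by
      rw [((hasFDerivAt_snd (𝕜 := ℝ)).fun_const_smul _).fderiv]
      rfl
    have htrace : ∑ i : Fin n, ((-(1 / 2) : ℝ) • single i (1 : ℝ)) i = -(n / 2) := by
      simp [div_eq_mul_inv]
    have hp := hκ.mul_polytropicEnergy hIpos hρ hS
    simp only [balanceSource, hα, htrace, fderiv_fst, fderiv_fun_const, Pi.zero_apply, zero_apply,
      ContinuousLinearMap.coe_fst', real_inner_smul_left, real_inner_self_eq_norm_sq]
    linear_combination hp

theorem hasMovingFlux_dilationalEnergy (hn : 0 < n) (hI : IsOpen I) (hJ : IsOpen J)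
    (hIpos : I ⊆ Ioi 0) (hP : ContDiffOn ℝ ∞ (fun q : ℝ × ℝ => P q.1 q.2) (I ×ˢ J))
    (hκ : IsShiftedPolytropic n I J P κ p₀) :
    HasMovingFlux (n := n) I J P (dilationalEnergy (polytropicEnergy n κ))
      (fun t x u ρ S => ((P ρ S - p₀) * t) • (t • u - x)) := by
  rw [dilationalEnergy_eq_affineDensity]
  convert hasMovingFlux_affineDensity (β := fun q => q.1 ^ 2) (α := fun q => -(q.1 • q.2))
    (h := fun q => 1 / 2 * ‖q.2.1‖ ^ 2) hI hJ hIpos hP (hκ.isInternalEnergy hn hIpos hP)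
    (by fun_prop) (by fun_prop)
    (contDiff_const.mul ((contDiff_fst.comp contDiff_snd).norm_sq ℝ)).contDiffOn ?_ using 6
  · simp only [smul_smul, sq, mul_assoc, sub_eq_add_neg, smul_add, smul_neg]
  · intro t x u ρ hρ S hS
    have hβ (s : ℝ) (y : Space n) :
        fderiv ℝ (fun q : ℝ × Space n => q.1 ^ 2) (t, x) (s, y) = 2 * t * s := by
      rw [((hasFDerivAt_fst (𝕜 := ℝ)).pow 2).fderiv]
      simp
    have hα (s : ℝ) (y : Space n) :
        fderiv ℝ (fun q : ℝ × Space n => -(q.1 • q.2)) (t, x) (s, y) = -(t • y + s • x) := by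
      rw [((hasFDerivAt_fst (𝕜 := ℝ)).fun_smul hasFDerivAt_snd).fun_neg.fderiv]
      rfl
    have hh : fderiv ℝ (fun q : ℝ × Space n × ℝ => 1 / 2 * ‖q.2.1‖ ^ 2) (t, x, S) (1, u, 0)
        = inner ℝ x u := by
      have hx : HasFDerivAt (fun q : ℝ × Space n × ℝ => q.2.1) _ (t, x, S) :=
        (hasFDerivAt_fst (𝕜 := ℝ)).comp _ hasFDerivAt_snd
      rw [(hx.norm_sq.const_mul _).fderiv]
      simp
    have htrace : ∑ i : Fin n, (-(t • single i (1 : ℝ) + (0 : ℝ) • x)) i = -(n * t) := by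
      simp
    have hp := hκ.mul_polytropicEnergy hIpos hρ hS
    simp only [balanceSource, hβ, hα, hh, htrace, inner_neg_left, inner_add_left,
      real_inner_smul_left, real_inner_self_eq_norm_sq]
    linear_combination 2 * t * hp

end Polytropic

/-! ### The dependence of a conserved density on the state -/

theorem fderiv_eq_of_fderiv_apply_sub_eq_zero {F : Type*} [NormedAddCommGroup F]
    [NormedSpace ℝ F] {s : Set F} (hs : IsOpen s) (hc : Convex ℝ s) {f : F → ℝ}
    (hf : DifferentiableOn ℝ f s) {x y : F} (hx : x ∈ s) (hy : y ∈ s)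
    (h : ∀ z ∈ s, fderiv ℝ f z (y - x) = 0) : fderiv ℝ f y = fderiv ℝ f x := by
  have hshift : (fun z => f (z + (y - x))) =ᶠ[𝓝 x] f := by
    have hy' : ∀ᶠ z in 𝓝 x, z + (y - x) ∈ s :=
      (continuous_add_const (y - x)).continuousAt.eventually_mem
        (hs.mem_nhds (by rwa [add_sub_cancel]))
    filter_upwards [hs.mem_nhds hx, hy'] with z hz hz'
    refine eq_of_fderiv_apply_sub_eq_zero hs hc hf hz hz' ?_
    rwa [add_sub_cancel_left]
  rw [← hshift.fderiv_eq, fderiv_comp_add_right, add_sub_cancel]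

/-- The unit vector of the `k`-th velocity component in the space of states. -/
def velDir (k : Fin n) : State n := (single k 1, 0, 0)

/-- The unit vector of the density in the space of states. -/
def densDir : State n := (0, 1, 0)

/-- The unit vector of the entropy in the space of states. -/
def entDir : State n := (0, 0, 1)

theorem sum_coord_smul_velDir (a : Space n) : ∑ k, a k • velDir k = ((a, 0, 0) : State n) := by
  refine Prod.ext ?_ (by simp [velDir, Prod.snd_sum])
  simpa [velDir, Prod.fst_sum] using sum_coord_smul_single a

theorem state_eq_sum (v : State n) :
    v = (∑ k, v.1 k • velDir k) + v.2.1 • densDir + v.2.2 • entDir := by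
  rw [sum_coord_smul_velDir]
  simp [densDir, entDir]

/-- The pressure as a function of the state. -/
def pressure (P : ℝ → ℝ → ℝ) (v : State n) : ℝ := P v.2.1 v.2.2

/-- The coefficient `f - ρ f_ρ` of `∇·u` in the balance of the density `f` in the frame moving with
the fluid. -/
def dilationCoeff (f : State n → ℝ) (v : State n) : ℝ := f v - v.2.1 * fderiv ℝ f v densDir

/-- The coefficient `ρ⁻¹ f_{uᵏ}` of `-∂ₖp` in the balance of the density `f` in the frame moving
with the fluid. -/
def velCoeff (f : State n → ℝ) (k : Fin n) (v : State n) : ℝ :=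
  (v.2.1)⁻¹ * fderiv ℝ f v (velDir k)

/-- The one-form `(f - ρ f_ρ) duⁱ - ρ⁻¹ f_{uⁱ} dp`: its value at `∂ᵢ(u, ρ, S)`, summed over `i`, is
the part of the balance of the density `f` that depends on the derivatives of the fields. -/
def balanceForm (P : ℝ → ℝ → ℝ) (f : State n → ℝ) (i : Fin n) (v : State n) : State n →L[ℝ] ℝ :=
  dilationCoeff f v •
      (EuclideanSpace.proj (𝕜 := ℝ) i).comp (ContinuousLinearMap.fst ℝ (Space n) (ℝ × ℝ))
    - velCoeff f i v • fderiv ℝ (pressure P) v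

/-- All the one-forms `balanceForm P f i` are closed. -/
def HasClosedBalanceForms (I J : Set ℝ) (P : ℝ → ℝ → ℝ) (f : State n → ℝ) : Prop :=
  ∀ v ∈ phase n I J, ∀ i a b,
    fderiv ℝ (balanceForm P f i) v a b = fderiv ℝ (balanceForm P f i) v b a

theorem contDiffOn_pressure (hP : ContDiffOn ℝ ∞ (fun q : ℝ × ℝ => P q.1 q.2) (I ×ˢ J)) :
    ContDiffOn ℝ ∞ (pressure P) (phase n I J) :=
  hP.comp (f := fun v : State n => (v.2.1, v.2.2)) (by fun_prop) fun _ hv => hv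

theorem fderiv_pressure_velDir {v : State n} (hp : DifferentiableAt ℝ (pressure P) v)
    (k : Fin n) : fderiv ℝ (pressure P) v (velDir k) = 0 := by
  refine (hp.hasFDerivAt.hasLineDerivAt (velDir k)).unique
    ((hasDerivAt_const (0 : ℝ) (pressure P v)).congr_of_eventuallyEq (.of_forall fun s => ?_))
  simp [pressure, velDir]

theorem fderiv_pressure_densDir {v : State n} (hp : DifferentiableAt ℝ (pressure P) v) :
    fderiv ℝ (pressure P) v densDir = deriv (fun r => P r v.2.2) v.2.1 := by
  have hline : HasDerivAt (fun r => v + (r - v.2.1) • (densDir : State n)) densDir v.2.1 := by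
    simpa using (((hasDerivAt_id v.2.1).sub_const v.2.1).smul_const
      (densDir : State n)).const_add v
  have h := hp.hasFDerivAt.comp_hasDerivAt_of_eq v.2.1 hline (by simp)
  simpa [Function.comp_def, pressure, densDir] using h.deriv.symm

section

variable {f : State n → ℝ}

theorem contDiffOn_dilationCoeff (hI : IsOpen I) (hJ : IsOpen J)
    (hf : ContDiffOn ℝ ∞ f (phase n I J)) : ContDiffOn ℝ ∞ (dilationCoeff f) (phase n I J) :=
  hf.sub ((ContDiff.contDiffOn (by fun_prop)).mul
    ((hf.fderiv_of_isOpen (isOpen_phase hI hJ) (by simp)).clm_apply contDiffOn_const))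

theorem contDiffOn_velCoeff (hI : IsOpen I) (hJ : IsOpen J) (hIpos : I ⊆ Ioi 0)
    (hf : ContDiffOn ℝ ∞ f (phase n I J)) (k : Fin n) :
    ContDiffOn ℝ ∞ (velCoeff f k) (phase n I J) :=
  (ContDiffOn.inv (by fun_prop) fun _ hv => (hIpos hv.1).ne').mul
    ((hf.fderiv_of_isOpen (isOpen_phase hI hJ) (by simp)).clm_apply contDiffOn_const)

theorem fderiv_dilationCoeff_velDir {v : State n} (hf : ContDiffAt ℝ ∞ f v) (hv : v.2.1 ≠ 0)
    (k : Fin n) :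
    fderiv ℝ (dilationCoeff f) v (velDir k)
      = -(v.2.1 ^ 2 * fderiv ℝ (velCoeff f k) v densDir) := by
  have hfd : DifferentiableAt ℝ f v := hf.differentiableAt (by simp)
  have hf2 : DifferentiableAt ℝ (fderiv ℝ f) v :=
    (hf.fderiv_right (m := ∞) (by simp)).differentiableAt (by simp)
  have hsymm : IsSymmSndFDerivAt ℝ f v := hf.isSymmSndFDerivAt
    (by rw [minSmoothness_of_isRCLikeNormedField]; exact ENat.LEInfty.out)
  have hρ : HasFDerivAt (fun v : State n => v.2.1) _ v :=
    (hasFDerivAt_fst (𝕜 := ℝ)).comp v (hasFDerivAt_snd (𝕜 := ℝ))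
  have hW : HasFDerivAt (dilationCoeff f) _ v :=
    hfd.hasFDerivAt.fun_sub (hρ.fun_mul (hf2.hasFDerivAt.clm_apply (hasFDerivAt_const densDir v)))
  have hν : HasFDerivAt (velCoeff f k) _ v :=
    ((hasDerivAt_inv hv).comp_hasFDerivAt v hρ).fun_mul
      (hf2.hasFDerivAt.clm_apply (hasFDerivAt_const (velDir k) v))
  have hvel : (velDir k : State n).2.1 = 0 := rfl
  have hdens : (densDir : State n).2.1 = 1 := rfl
  rw [hW.fderiv, hν.fderiv]
  simp only [sub_apply, add_apply, smul_apply, ContinuousLinearMap.comp_apply,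
    ContinuousLinearMap.coe_fst', ContinuousLinearMap.coe_snd', ContinuousLinearMap.flip_apply,
    zero_apply, map_zero, smul_eq_mul, hvel, hdens, Function.comp_apply, hsymm.eq (velDir k)]
  field_simp
  ring

theorem fderiv_apply_eq_sum_velCoeff (f : State n → ℝ) {v : State n} (hv : v.2.1 ≠ 0)
    (a : Space n) (r : ℝ) :
    fderiv ℝ f v (a, r, 0) = v.2.1 * ∑ k, a k * velCoeff f k v + r * fderiv ℝ f v densDir := by
  have hsum : ((a, r, 0) : State n) = ∑ k, a k • velDir k + r • densDir := by
    rw [sum_coord_smul_velDir]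
    simp [densDir]
  rw [hsum, map_add, map_sum, map_smul, smul_eq_mul, Finset.mul_sum]
  congr 1
  refine Finset.sum_congr rfl fun k _ => ?_
  rw [map_smul, velCoeff, smul_eq_mul]
  field_simp

theorem hasLineDerivAt_inv_mul_sub {v : State n} (hf : DifferentiableAt ℝ f v) (hv : v.2.1 ≠ 0)
    (c : ℝ) (a : Space n) (r : ℝ) :
    HasLineDerivAt ℝ (fun v : State n => (v.2.1)⁻¹ * (f v - c))
      (∑ k, a k * velCoeff f k v - (v.2.1 ^ 2)⁻¹ * r * (dilationCoeff f v - c)) v (a, r, 0) := by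
  have hρ : HasDerivAt (fun s : ℝ => v.2.1 + s • r) r 0 := by
    simpa using ((hasDerivAt_id (0 : ℝ)).smul_const r).const_add v.2.1
  have hline := hf.hasFDerivAt.hasLineDerivAt ((a, r, 0) : State n)
  refine HasDerivAt.congr_deriv ((hρ.fun_inv (by simpa)).fun_mul (HasDerivAt.sub_const c hline)) ?_
  simp only [zero_smul, add_zero, fderiv_apply_eq_sum_velCoeff f hv, dilationCoeff]
  field_simp
  ring

/-- The specific density `β(½|u|² + e) + α·u` of energy and momentum, as a function of the state. -/
def specificEnergy (e : ℝ → ℝ → ℝ) (β : ℝ) (α : Space n) (v : State n) : ℝ :=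
  β * (‖v.1‖ ^ 2 / 2 + e v.2.1 v.2.2) + inner ℝ α v.1

theorem differentiableOn_specificEnergy (he : IsInternalEnergy I J P e) (β : ℝ) (α : Space n) :
    DifferentiableOn ℝ (specificEnergy e β α) (phase n I J) := by
  have hkin : ContDiff ℝ 1 fun v : State n => ‖v.1‖ ^ 2 / 2 :=
    (contDiff_fst.norm_sq ℝ).div_const 2
  have hint : DifferentiableOn ℝ (fun v : State n => e v.2.1 v.2.2) (phase n I J) :=
    (he.1.differentiableOn (by simp)).comp (f := fun v : State n => (v.2.1, v.2.2))
      (by fun_prop) fun _ hv => hv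
  have hlin : Differentiable ℝ fun v : State n => inner ℝ α v.1 :=
    (differentiable_const α).inner ℝ differentiable_fst
  exact (((hkin.differentiable one_ne_zero).differentiableOn.add hint).const_mul β).add
    hlin.differentiableOn

theorem hasLineDerivAt_specificEnergy {v : State n} {e' : ℝ}
    (he : HasDerivAt (fun r => e r v.2.2) e' v.2.1) (β : ℝ) (α a : Space n) (r : ℝ) :
    HasLineDerivAt ℝ (specificEnergy e β α) (β * (inner ℝ v.1 a + e' * r) + inner ℝ α a) v
      (a, r, 0) := by
  have hρ : HasDerivAt (fun s : ℝ => v.2.1 + s • r) r 0 := by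
    simpa using ((hasDerivAt_id (0 : ℝ)).smul_const r).const_add v.2.1
  have hu : HasDerivAt (fun s : ℝ => v.1 + s • a) a 0 := by
    simpa using ((hasDerivAt_id (0 : ℝ)).smul_const a).const_add v.1
  have hes : HasDerivAt (fun s : ℝ => e (v.2.1 + s • r) (v.2.2 + s • 0)) (e' * r) 0 := by
    simp only [smul_zero, add_zero]
    exact he.comp_of_eq 0 hρ (by simp)
  refine HasDerivAt.congr_deriv ((((hu.norm_sq.div_const 2).fun_add hes).const_mul β).fun_add
    (HasDerivAt.inner ℝ (hasDerivAt_const 0 α) hu)) ?_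
  simp

theorem fderiv_balanceForm_apply (hI : IsOpen I) (hJ : IsOpen J) (hIpos : I ⊆ Ioi 0)
    (hP : ContDiffOn ℝ ∞ (fun q : ℝ × ℝ => P q.1 q.2) (I ×ˢ J))
    (hf : ContDiffOn ℝ ∞ f (phase n I J)) {v : State n} (hv : v ∈ phase n I J) (i : Fin n)
    (a b : State n) :
    fderiv ℝ (balanceForm P f i) v a b
      = fderiv ℝ (dilationCoeff f) v a * b.1 i
        - fderiv ℝ (velCoeff f i) v a * fderiv ℝ (pressure P) v b
        - velCoeff f i v * fderiv ℝ (fderiv ℝ (pressure P)) v a b := by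
  have hnhds := (isOpen_phase hI hJ).mem_nhds hv
  have hW := ((contDiffOn_dilationCoeff hI hJ hf).contDiffAt hnhds).differentiableAt (by simp)
  have hν := ((contDiffOn_velCoeff hI hJ hIpos hf i).contDiffAt hnhds).differentiableAt (by simp)
  have hp : DifferentiableAt ℝ (fderiv ℝ (pressure P)) v :=
    (((contDiffOn_pressure hP).contDiffAt hnhds).fderiv_right (m := ∞)
      (by simp)).differentiableAt (by simp)
  have hform : HasFDerivAt (balanceForm P f i) _ v :=
    (hW.hasFDerivAt.smul_const _).fun_sub (hν.hasFDerivAt.fun_smul hp.hasFDerivAt)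
  rw [hform.fderiv]
  simp
  ring

namespace HasClosedBalanceForms

theorem fderiv_mul_sub (hI : IsOpen I) (hJ : IsOpen J) (hIpos : I ⊆ Ioi 0)
    (hP : ContDiffOn ℝ ∞ (fun q : ℝ × ℝ => P q.1 q.2) (I ×ˢ J))
    (hf : ContDiffOn ℝ ∞ f (phase n I J)) (hcl : HasClosedBalanceForms I J P f) {v : State n}
    (hv : v ∈ phase n I J) (i : Fin n) (a b : State n) :
    fderiv ℝ (dilationCoeff f) v a * b.1 i
        - fderiv ℝ (velCoeff f i) v a * fderiv ℝ (pressure P) v b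
      = fderiv ℝ (dilationCoeff f) v b * a.1 i
        - fderiv ℝ (velCoeff f i) v b * fderiv ℝ (pressure P) v a := by
  have hsymm : IsSymmSndFDerivAt ℝ (pressure P) v :=
    ((contDiffOn_pressure hP).contDiffAt ((isOpen_phase hI hJ).mem_nhds hv)).isSymmSndFDerivAt
      (by rw [minSmoothness_of_isRCLikeNormedField]; exact ENat.LEInfty.out)
  have h := hcl v hv i a b
  rw [fderiv_balanceForm_apply hI hJ hIpos hP hf hv, fderiv_balanceForm_apply hI hJ hIpos hP hf hv,
    hsymm.eq a b] at h
  linarith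

theorem fderiv_dilationCoeff_velDir_eq_zero (hn : 1 < n) (hI : IsOpen I) (hJ : IsOpen J)
    (hIpos : I ⊆ Ioi 0) (hP : ContDiffOn ℝ ∞ (fun q : ℝ × ℝ => P q.1 q.2) (I ×ˢ J))
    (hf : ContDiffOn ℝ ∞ f (phase n I J)) (hcl : HasClosedBalanceForms I J P f) {v : State n}
    (hv : v ∈ phase n I J) (k : Fin n) : fderiv ℝ (dilationCoeff f) v (velDir k) = 0 := by
  have hp := ((contDiffOn_pressure hP).contDiffAt
    ((isOpen_phase hI hJ).mem_nhds hv)).differentiableAt (by simp)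
  have : Nontrivial (Fin n) := Fin.nontrivial_iff_two_le.2 hn
  obtain ⟨i, hi⟩ := exists_ne k
  have h := hcl.fderiv_mul_sub hI hJ hIpos hP hf hv i (velDir k) (velDir i)
  rw [fderiv_pressure_velDir hp, fderiv_pressure_velDir hp] at h
  simpa [velDir, hi, hi.symm] using h

theorem fderiv_velCoeff_densDir_eq_zero (hn : 1 < n) (hI : IsOpen I) (hJ : IsOpen J)
    (hIpos : I ⊆ Ioi 0) (hP : ContDiffOn ℝ ∞ (fun q : ℝ × ℝ => P q.1 q.2) (I ×ˢ J))
    (hf : ContDiffOn ℝ ∞ f (phase n I J)) (hcl : HasClosedBalanceForms I J P f) {v : State n}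
    (hv : v ∈ phase n I J) (k : Fin n) : fderiv ℝ (velCoeff f k) v densDir = 0 := by
  have hρ : v.2.1 ≠ 0 := (hIpos hv.1).ne'
  have h := fderiv_dilationCoeff_velDir
    (hf.contDiffAt ((isOpen_phase hI hJ).mem_nhds hv)) hρ k
  rw [hcl.fderiv_dilationCoeff_velDir_eq_zero hn hI hJ hIpos hP hf hv, zero_eq_neg,
    mul_eq_zero] at h
  exact h.resolve_left (pow_ne_zero 2 hρ)

theorem fderiv_velCoeff_entDir_eq_zero (hn : 1 < n) (hI : IsOpen I) (hJ : IsOpen J)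
    (hI' : I.OrdConnected) (hJ' : J.OrdConnected) (hIpos : I ⊆ Ioi 0)
    (hP : ContDiffOn ℝ ∞ (fun q : ℝ × ℝ => P q.1 q.2) (I ×ˢ J))
    (hPρ : ∀ U ⊆ J, IsOpen U → U.Nonempty → ∃ S ∈ U, ∃ ρ ∈ I, deriv (fun r => P r S) ρ ≠ 0)
    (hf : ContDiffOn ℝ ∞ f (phase n I J)) (hcl : HasClosedBalanceForms I J P f) {v : State n}
    (hv : v ∈ phase n I J) (k : Fin n) : fderiv ℝ (velCoeff f k) v entDir = 0 := by
  obtain ⟨u, ρ, S⟩ := v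
  have hopen := isOpen_phase (n := n) hI hJ
  have hν := contDiffOn_velCoeff hI hJ hIpos hf k
  by_contra hne
  have hcont : ContinuousOn (fun S => fderiv ℝ (velCoeff f k) (u, ρ, S) entDir) J :=
    ((hν.continuousOn_fderiv_of_isOpen hopen (by simp)).comp
      (f := fun S => ((u, ρ, S) : State n)) (by fun_prop) fun S hS => ⟨hv.1, hS⟩).clm_apply
      continuousOn_const
  obtain ⟨S', ⟨hS', hne'⟩, ρ', hρ', hPne⟩ := hPρ _ inter_subset_left
    (hcont.isOpen_inter_preimage hJ (isOpen_compl_singleton (x := (0 : ℝ)))) ⟨S, hv.2, hne⟩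
  have hmem : ((u, ρ', S') : State n) ∈ phase n I J := ⟨hρ', hS'⟩
  have hmove : fderiv ℝ (velCoeff f k) (u, ρ', S') = fderiv ℝ (velCoeff f k) (u, ρ, S') := by
    refine fderiv_eq_of_fderiv_apply_sub_eq_zero hopen (convex_phase hI' hJ')
      (hν.differentiableOn (by simp)) ⟨hv.1, hS'⟩ hmem fun z hz => ?_
    have hsub : ((u, ρ', S') - (u, ρ, S') : State n) = (ρ' - ρ) • densDir := by simp [densDir]
    rw [hsub, map_smul, hcl.fderiv_velCoeff_densDir_eq_zero hn hI hJ hIpos hP hf hz, smul_zero]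
  have h := hcl.fderiv_mul_sub hI hJ hIpos hP hf hmem k entDir densDir
  rw [hcl.fderiv_velCoeff_densDir_eq_zero hn hI hJ hIpos hP hf hmem, hmove, fderiv_pressure_densDir
    (((contDiffOn_pressure hP).contDiffAt (hopen.mem_nhds hmem)).differentiableAt (by simp))] at h
  simp only [entDir, densDir, PiLp.zero_apply, mul_zero, zero_mul, sub_zero, zero_sub,
    neg_eq_zero, mul_eq_zero] at h
  exact h.elim hne' hPne

theorem fderiv_dilationCoeff_congr_vel (hn : 1 < n) (hI : IsOpen I) (hJ : IsOpen J)
    (hI' : I.OrdConnected) (hJ' : J.OrdConnected) (hIpos : I ⊆ Ioi 0)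
    (hP : ContDiffOn ℝ ∞ (fun q : ℝ × ℝ => P q.1 q.2) (I ×ˢ J))
    (hf : ContDiffOn ℝ ∞ f (phase n I J)) (hcl : HasClosedBalanceForms I J P f) (u u' : Space n)
    {ρ S : ℝ} (hρ : ρ ∈ I) (hS : S ∈ J) :
    fderiv ℝ (dilationCoeff f) (u, ρ, S) = fderiv ℝ (dilationCoeff f) (u', ρ, S) := by
  refine fderiv_eq_of_fderiv_apply_sub_eq_zero (isOpen_phase hI hJ) (convex_phase hI' hJ')
    ((contDiffOn_dilationCoeff hI hJ hf).differentiableOn (by simp)) ⟨hρ, hS⟩ ⟨hρ, hS⟩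
    fun z hz => ?_
  have hsub : ((u, ρ, S) - (u', ρ, S) : State n) = ∑ k, (u - u') k • velDir k := by
    rw [sum_coord_smul_velDir, Prod.mk_sub_mk, Prod.mk_sub_mk, sub_self, sub_self]
  simp only [hsub, map_sum, map_smul,
    hcl.fderiv_dilationCoeff_velDir_eq_zero hn hI hJ hIpos hP hf hz, smul_zero,
    Finset.sum_const_zero]

theorem fderiv_velCoeff_congr_thermo (hn : 1 < n) (hI : IsOpen I) (hJ : IsOpen J)
    (hI' : I.OrdConnected) (hJ' : J.OrdConnected) (hIpos : I ⊆ Ioi 0)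
    (hP : ContDiffOn ℝ ∞ (fun q : ℝ × ℝ => P q.1 q.2) (I ×ˢ J))
    (hPρ : ∀ U ⊆ J, IsOpen U → U.Nonempty → ∃ S ∈ U, ∃ ρ ∈ I, deriv (fun r => P r S) ρ ≠ 0)
    (hf : ContDiffOn ℝ ∞ f (phase n I J)) (hcl : HasClosedBalanceForms I J P f) (i : Fin n)
    {v : State n} (hv : v ∈ phase n I J) {ρ S : ℝ} (hρ : ρ ∈ I) (hS : S ∈ J) :
    fderiv ℝ (velCoeff f i) v = fderiv ℝ (velCoeff f i) (v.1, ρ, S) := by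
  refine fderiv_eq_of_fderiv_apply_sub_eq_zero (isOpen_phase hI hJ) (convex_phase hI' hJ')
    ((contDiffOn_velCoeff hI hJ hIpos hf i).differentiableOn (by simp)) ⟨hρ, hS⟩ hv fun z hz => ?_
  have hsub : (v - (v.1, ρ, S) : State n) = (v.2.1 - ρ) • densDir + (v.2.2 - S) • entDir := by
    ext <;> simp [densDir, entDir]
  rw [hsub, map_add, map_smul, map_smul,
    hcl.fderiv_velCoeff_densDir_eq_zero hn hI hJ hIpos hP hf hz,
    hcl.fderiv_velCoeff_entDir_eq_zero hn hI hJ hI' hJ' hIpos hP hPρ hf hz, smul_zero, smul_zero,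
    add_zero]

theorem exists_fderiv_velCoeff (hn : 1 < n) (hI : IsOpen I) (hJ : IsOpen J)
    (hI' : I.OrdConnected) (hJ' : J.OrdConnected) (hIpos : I ⊆ Ioi 0)
    (hP : ContDiffOn ℝ ∞ (fun q : ℝ × ℝ => P q.1 q.2) (I ×ˢ J)) (hJne : J.Nonempty)
    (hPρ : ∀ U ⊆ J, IsOpen U → U.Nonempty → ∃ S ∈ U, ∃ ρ ∈ I, deriv (fun r => P r S) ρ ≠ 0)
    (hf : ContDiffOn ℝ ∞ f (phase n I J)) (hcl : HasClosedBalanceForms I J P f) :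
    ∃ β : ℝ, ∀ v ∈ phase n I J, ∀ i b, fderiv ℝ (velCoeff f i) v b = β * b.1 i := by
  obtain ⟨S₀, hS₀, ρ₀, hρ₀, hPne⟩ := hPρ J subset_rfl hJ hJne
  refine ⟨-(fderiv ℝ (dilationCoeff f) (0, ρ₀, S₀) densDir / deriv (fun r => P r S₀) ρ₀),
    fun v hv i b => ?_⟩
  have hvel (k : Fin n) : fderiv ℝ (velCoeff f i) v (velDir k)
      = -(fderiv ℝ (dilationCoeff f) (0, ρ₀, S₀) densDir / deriv (fun r => P r S₀) ρ₀)
        * (velDir k : State n).1 i := by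
    have hbase : ((v.1, ρ₀, S₀) : State n) ∈ phase n I J := ⟨hρ₀, hS₀⟩
    have hp := ((contDiffOn_pressure hP).contDiffAt
      ((isOpen_phase hI hJ).mem_nhds hbase)).differentiableAt (by simp)
    have h := hcl.fderiv_mul_sub hI hJ hIpos hP hf hbase i (velDir k) densDir
    rw [fderiv_pressure_velDir hp, fderiv_pressure_densDir hp,
      hcl.fderiv_dilationCoeff_congr_vel hn hI hJ hI' hJ' hIpos hP hf v.1 0 hρ₀ hS₀] at h
    have hzero : (densDir : State n).1 i = 0 := rfl
    rw [hzero] at h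
    rw [hcl.fderiv_velCoeff_congr_thermo hn hI hJ hI' hJ' hIpos hP hPρ hf i hv hρ₀ hS₀]
    field_simp
    linarith
  have hb : b.1 i = ∑ k, b.1 k * (velDir k : State n).1 i := by
    simp [velDir]
  conv_lhs => rw [state_eq_sum b]
  rw [map_add, map_add, map_sum, map_smul, map_smul,
    hcl.fderiv_velCoeff_densDir_eq_zero hn hI hJ hIpos hP hf hv,
    hcl.fderiv_velCoeff_entDir_eq_zero hn hI hJ hI' hJ' hIpos hP hPρ hf hv, hb, Finset.mul_sum]
  simp only [map_smul, smul_eq_mul, hvel, mul_zero, add_zero]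
  exact Finset.sum_congr rfl fun k _ => by ring

theorem fderiv_dilationCoeff (hn : 1 < n) (hI : IsOpen I) (hJ : IsOpen J) (hIpos : I ⊆ Ioi 0)
    (hP : ContDiffOn ℝ ∞ (fun q : ℝ × ℝ => P q.1 q.2) (I ×ˢ J))
    (hf : ContDiffOn ℝ ∞ f (phase n I J)) (hcl : HasClosedBalanceForms I J P f) {β : ℝ}
    (hβ : ∀ v ∈ phase n I J, ∀ i b, fderiv ℝ (velCoeff f i) v b = β * b.1 i) {v : State n}
    (hv : v ∈ phase n I J) (b : State n) :
    fderiv ℝ (dilationCoeff f) v b = -(β * fderiv ℝ (pressure P) v b) := by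
  let i : Fin n := ⟨0, by lia⟩
  have h := hcl.fderiv_mul_sub hI hJ hIpos hP hf hv i (velDir i) b
  rw [hcl.fderiv_dilationCoeff_velDir_eq_zero hn hI hJ hIpos hP hf hv, hβ v hv,
    fderiv_pressure_velDir (((contDiffOn_pressure hP).contDiffAt
      ((isOpen_phase hI hJ).mem_nhds hv)).differentiableAt (by simp))] at h
  have hi : (velDir i : State n).1 i = 1 := by simp [velDir]
  rw [hi] at h
  linarith

theorem exists_velCoeff_eq (hn : 1 < n) (hI : IsOpen I) (hJ : IsOpen J) (hI' : I.OrdConnected)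
    (hJ' : J.OrdConnected) (hIpos : I ⊆ Ioi 0)
    (hP : ContDiffOn ℝ ∞ (fun q : ℝ × ℝ => P q.1 q.2) (I ×ˢ J)) (hJne : J.Nonempty)
    (hPρ : ∀ U ⊆ J, IsOpen U → U.Nonempty → ∃ S ∈ U, ∃ ρ ∈ I, deriv (fun r => P r S) ρ ≠ 0)
    (hf : ContDiffOn ℝ ∞ f (phase n I J)) (hcl : HasClosedBalanceForms I J P f) :
    ∃ (β w₀ : ℝ) (α : Space n), ∀ v ∈ phase n I J,
      (∀ i, velCoeff f i v = β * v.1 i + α i) ∧ dilationCoeff f v = w₀ - β * pressure P v := by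
  obtain ⟨β, hβ⟩ := hcl.exists_fderiv_velCoeff hn hI hJ hI' hJ' hIpos hP hJne hPρ hf
  obtain ⟨S₀, hS₀, ρ₀, hρ₀, -⟩ := hPρ J subset_rfl hJ hJne
  have hopen := isOpen_phase (n := n) hI hJ
  have hconvex := convex_phase (n := n) hI' hJ'
  have hbase : ((0, ρ₀, S₀) : State n) ∈ phase n I J := ⟨hρ₀, hS₀⟩
  refine ⟨β, dilationCoeff f (0, ρ₀, S₀) + β * P ρ₀ S₀,
    WithLp.toLp 2 fun i => velCoeff f i (0, ρ₀, S₀), fun v hv => ⟨fun i => ?_, ?_⟩⟩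
  · have hν := (contDiffOn_velCoeff hI hJ hIpos hf i).differentiableOn (by simp)
    have hcoord (z : State n) : HasFDerivAt (fun v : State n => β * v.1 i) _ z :=
      ((EuclideanSpace.proj (𝕜 := ℝ) i).hasFDerivAt.comp z (hasFDerivAt_fst (𝕜 := ℝ))).const_mul β
    have h : velCoeff f i v - β * v.1 i = velCoeff f i (0, ρ₀, S₀) - β * (0 : Space n) i := by
      refine eq_of_fderiv_apply_sub_eq_zero (f := fun v : State n => velCoeff f i v - β * v.1 i)
        hopen hconvex (hν.sub fun z _ => (hcoord z).differentiableAt.differentiableWithinAt)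
        hbase hv fun z hz => ?_
      rw [((hν.differentiableAt (hopen.mem_nhds hz)).hasFDerivAt.fun_sub (hcoord z)).fderiv,
        sub_apply, hβ z hz]
      simp
    simpa [sub_eq_iff_eq_add'] using h
  · have hW := (contDiffOn_dilationCoeff hI hJ hf).differentiableOn (by simp)
    have hp := (contDiffOn_pressure (n := n) hP).differentiableOn (by simp)
    have h : dilationCoeff f v + β * pressure P v
        = dilationCoeff f (0, ρ₀, S₀) + β * P ρ₀ S₀ := by
      refine eq_of_fderiv_apply_sub_eq_zero
        (f := fun v : State n => dilationCoeff f v + β * pressure P v)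
        hopen hconvex (hW.add (hp.const_mul β)) hbase hv fun z hz => ?_
      have hz' := hopen.mem_nhds hz
      rw [((hW.differentiableAt hz').hasFDerivAt.fun_add
        ((hp.differentiableAt hz').hasFDerivAt.const_mul β)).fderiv, add_apply,
        hcl.fderiv_dilationCoeff hn hI hJ hIpos hP hf hβ hz]
      simp
    exact eq_sub_of_add_eq h

theorem exists_eq (hn : 1 < n) (hI : IsOpen I) (hJ : IsOpen J) (hI' : I.OrdConnected)
    (hJ' : J.OrdConnected) (hIpos : I ⊆ Ioi 0)
    (hP : ContDiffOn ℝ ∞ (fun q : ℝ × ℝ => P q.1 q.2) (I ×ˢ J)) (hJne : J.Nonempty)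
    (hPρ : ∀ U ⊆ J, IsOpen U → U.Nonempty → ∃ S ∈ U, ∃ ρ ∈ I, deriv (fun r => P r S) ρ ≠ 0)
    (he : IsInternalEnergy I J P e)
    (hf : ContDiffOn ℝ ∞ f (phase n I J)) (hcl : HasClosedBalanceForms I J P f) :
    ∃ (w₀ β : ℝ) (α : Space n) (h : ℝ → ℝ), ∀ v ∈ phase n I J,
      f v = w₀ + v.2.1 * (β * (‖v.1‖ ^ 2 / 2 + e v.2.1 v.2.2) + inner ℝ α v.1 + h v.2.2) := by
  obtain ⟨β, w₀, α, hcoeff⟩ := hcl.exists_velCoeff_eq hn hI hJ hI' hJ' hIpos hP hJne hPρ hf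
  obtain ⟨-, -, ρ₀, hρ₀, -⟩ := hPρ J subset_rfl hJ hJne
  have hopen := isOpen_phase (n := n) hI hJ
  let H (v : State n) : ℝ := (v.2.1)⁻¹ * (f v - w₀) - specificEnergy e β α v
  have hH : DifferentiableOn ℝ H (phase n I J) :=
    ((DifferentiableOn.inv (by fun_prop) fun _ hv => (hIpos hv.1).ne').mul
      ((hf.differentiableOn (by simp)).sub_const w₀)).sub (differentiableOn_specificEnergy he β α)
  have hline {v : State n} (hv : v ∈ phase n I J) (a : Space n) (r : ℝ) :
      fderiv ℝ H v (a, r, 0) = 0 := by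
    have hv' := hopen.mem_nhds hv
    have hsub : HasLineDerivAt ℝ H _ v (a, r, 0) := HasDerivAt.fun_sub
      (hasLineDerivAt_inv_mul_sub (hf.contDiffAt hv' |>.differentiableAt (by simp))
        (hIpos hv.1).ne' w₀ a r)
      (hasLineDerivAt_specificEnergy (he.2 _ hv.1 _ hv.2) β α a r)
    rw [((hH.differentiableAt hv').hasFDerivAt.hasLineDerivAt _).unique hsub, (hcoeff v hv).2]
    simp only [(hcoeff v hv).1, pressure, PiLp.inner_apply, mul_add, Finset.sum_add_distrib,
      Finset.mul_sum, RCLike.inner_apply, conj_trivial]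
    simp only [mul_comm, mul_left_comm]
    ring
  refine ⟨w₀, β, α, fun S => H (0, ρ₀, S), fun v hv => ?_⟩
  have hval : H v = H (0, ρ₀, v.2.2) := by
    refine eq_of_fderiv_apply_sub_eq_zero hopen (convex_phase hI' hJ') hH
      (x := (0, ρ₀, v.2.2)) ⟨hρ₀, hv.2⟩ hv fun z hz => ?_
    have hsub : (v - (0, ρ₀, v.2.2) : State n) = (v.1, v.2.1 - ρ₀, 0) := by ext <;> simp
    rw [hsub, hline hz]
  have hρ : v.2.1 ≠ 0 := (hIpos hv.1).ne'
  beta_reduce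
  rw [← hval]
  simp only [H, specificEnergy]
  field_simp
  ring

end HasClosedBalanceForms

end

theorem IsSmoothKinematic.fderiv_slice_apply {T : Kinematic n ℝ} (hI : IsOpen I) (hJ : IsOpen J)
    (hT : IsSmoothKinematic I J T) (t : ℝ) (x : Space n) {v : State n} (hv : v ∈ phase n I J)
    (a : State n) :
    fderiv ℝ (fun v => uncurried T (t, x, v)) v a = fderiv ℝ (uncurried T) (t, x, v) (0, 0, a) := by
  have h : HasFDerivAt (fun v => uncurried T (t, x, v)) _ v :=
    HasFDerivAt.comp (f := fun v : State n => (t, x, v)) v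
      (hT.differentiableAt hI hJ t x hv).hasFDerivAt
      ((hasFDerivAt_const t v).prodMk ((hasFDerivAt_const x v).prodMk (hasFDerivAt_id v)))
  rw [h.fderiv]
  rfl

theorem sum_balanceForm_fderiv (f : State n → ℝ) {w : Space n → State n} {x : Space n}
    (hp : DifferentiableAt ℝ (pressure P) (w x)) (hw : DifferentiableAt ℝ w x) :
    ∑ i, balanceForm P f i (w x) (fderiv ℝ w x (single i 1))
      = dilationCoeff f (w x) * divergence (fun y => (w y).1) x
        - ∑ i, gradient (fun y => P (w y).2.1 (w y).2.2) x i * velCoeff f i (w x) := by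
  have hu : HasFDerivAt (fun y => (w y).1) _ x :=
    (ContinuousLinearMap.fst ℝ (Space n) (ℝ × ℝ)).hasFDerivAt.comp x hw.hasFDerivAt
  have hpw : HasFDerivAt (fun y => P (w y).2.1 (w y).2.2) _ x :=
    HasFDerivAt.comp (g := pressure P) x hp.hasFDerivAt hw.hasFDerivAt
  have hgrad (i : Fin n) : gradient (fun y => P (w y).2.1 (w y).2.2) x i
      = fderiv ℝ (pressure P) (w x) (fderiv ℝ w x (single i 1)) := by
    have h : inner ℝ (gradient (fun y => P (w y).2.1 (w y).2.2) x) (single i 1) = _ :=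
      InnerProductSpace.toDual_symm_apply
    rw [hpw.fderiv, EuclideanSpace.inner_single_right] at h
    simpa using h
  rw [divergence, hu.fderiv, Finset.mul_sum, ← Finset.sum_sub_distrib]
  refine Finset.sum_congr rfl fun i _ => ?_
  rw [hgrad]
  simp [balanceForm, mul_comm]

theorem timeDeriv_add_divergence_smul_eq_affineLagrangian {T : Kinematic n ℝ} (hI : IsOpen I)
    (hJ : IsOpen J) (hIpos : I ⊆ Ioi 0)
    (hP : ContDiffOn ℝ ∞ (fun q : ℝ × ℝ => P q.1 q.2) (I ×ˢ J))
    (hT : IsSmoothKinematic I J T) (t : ℝ) {w : Space n → State n} (hw : IsField I J w)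
    (x : Space n) :
    timeDeriv P T t w x + divergence (fun y => onField T t w y • (w y).1) x
      = affineLagrangian (fun q => fderiv ℝ (uncurried T) (t, q) (1, q.2.1, 0))
          (fun i q => balanceForm P (fun v => uncurried T (t, q.1, v)) i q.2) w x := by
  have hwx := hw.2 x
  have hwd : DifferentiableAt ℝ w x := hw.1.differentiable (by simp) x
  have hp := ((contDiffOn_pressure hP).contDiffAt
    ((isOpen_phase hI hJ).mem_nhds hwx)).differentiableAt (by simp)
  have hρ : (w x).2.1 ≠ 0 := (hIpos hwx.1).ne'
  rw [timeDeriv_add_divergence_smul (hT.differentiableAt hI hJ t x hwx) hwd, affineLagrangian,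
    sum_balanceForm_fderiv _ hp hwd]
  set g := gradient (fun y => P (w y).2.1 (w y).2.2) x
  set d := divergence (fun y => (w y).1) x
  have hsplit : ((1 : ℝ), (w x).1, -(((w x).2.1)⁻¹ • g), -((w x).2.1 * d), (0 : ℝ))
      = (1, (w x).1, 0) + (0, 0, (-(((w x).2.1)⁻¹ • g), -((w x).2.1 * d), 0)) := by simp
  have hsum : (w x).2.1 * ∑ k, (-(((w x).2.1)⁻¹ • g)) k
        * velCoeff (fun v => uncurried T (t, x, v)) k (w x)
      = -∑ k, g k * velCoeff (fun v => uncurried T (t, x, v)) k (w x) := by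
    rw [Finset.mul_sum, ← Finset.sum_neg_distrib]
    refine Finset.sum_congr rfl fun k _ => ?_
    rw [PiLp.neg_apply, PiLp.smul_apply, smul_eq_mul]
    field_simp
  rw [hsplit, map_add, ← hT.fderiv_slice_apply hI hJ t x hwx, fderiv_apply_eq_sum_velCoeff _ hρ,
    hsum, dilationCoeff, show onField T t w x = uncurried T (t, x, w x) from rfl]
  ring

theorem contDiffOn_fderiv_slice {f : Space n × State n → ℝ} (hI : IsOpen I) (hJ : IsOpen J)
    (hf : ContDiffOn ℝ ∞ f (Prod.snd ⁻¹' phase n I J)) :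
    ContDiffOn ℝ ∞ (fun q => fderiv ℝ (fun v => f (q.1, v)) q.2) (Prod.snd ⁻¹' phase n I J) := by
  intro q hq
  have hfq := hf.contDiffAt ((isOpen_preimage_phase hI hJ).mem_nhds hq)
  exact (ContDiffAt.fderiv (m := ∞) (n := ∞) (f := fun q v => f (q.1, v)) (g := Prod.snd)
    (hfq.comp (q, q.2) (f := fun r : (Space n × State n) × State n => (r.1.1, r.2)) (by fun_prop))
    contDiffAt_snd (by simp)).contDiffWithinAt

theorem contDiffOn_balanceForm_slice {f : Space n × State n → ℝ} (hI : IsOpen I) (hJ : IsOpen J)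
    (hIpos : I ⊆ Ioi 0) (hP : ContDiffOn ℝ ∞ (fun q : ℝ × ℝ => P q.1 q.2) (I ×ˢ J))
    (hf : ContDiffOn ℝ ∞ f (Prod.snd ⁻¹' phase n I J)) (i : Fin n) :
    ContDiffOn ℝ ∞ (fun q => balanceForm P (fun v => f (q.1, v)) i q.2)
      (Prod.snd ⁻¹' phase n I J) := by
  have hfv := contDiffOn_fderiv_slice hI hJ hf
  have hp : ContDiffOn ℝ ∞ (fun q : Space n × State n => fderiv ℝ (pressure P) q.2)
      (Prod.snd ⁻¹' phase n I J) :=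
    ((contDiffOn_pressure hP).fderiv_of_isOpen (isOpen_phase hI hJ) (by simp)).comp
      contDiffOn_snd fun _ hq => hq
  have hρ : ContDiffOn ℝ ∞ (fun q : Space n × State n => q.2.2.1) (Prod.snd ⁻¹' phase n I J) := by
    fun_prop
  exact ((hf.sub (hρ.mul (hfv.clm_apply contDiffOn_const))).smul contDiffOn_const).sub
    (((hρ.inv fun q hq => (hIpos hq.1).ne').mul (hfv.clm_apply contDiffOn_const)).smul hp)

namespace IsSmoothKinematic

variable {T : Kinematic n ℝ} {w₀ β : ℝ × Space n → ℝ} {α : ℝ × Space n → Space n}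
  {h : ℝ × Space n × ℝ → ℝ}

-- The coefficients of `T` are smooth because they are combinations of finitely many values of `T`.
theorem contDiff_velocityCoefficients (hn : 0 < n) (hI : IsOpen I) (hJ : IsOpen J)
    (hIpos : I ⊆ Ioi 0) (hT : IsSmoothKinematic I J T) {ρ S : ℝ} (hρ : ρ ∈ I) (hS : S ∈ J)
    (hTeq : ∀ t x, ∀ u : Space n, ∀ ρ ∈ I, ∀ S ∈ J,
      T t x u ρ S = (background w₀ + affineDensity e β α h) t x u ρ S) :
    ContDiff ℝ ∞ β ∧ ContDiff ℝ ∞ α := by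
  have hρ₀ : ρ ≠ 0 := (hIpos hρ).ne'
  have hsmooth (u : Space n) : ContDiff ℝ ∞ fun q : ℝ × Space n => T q.1 q.2 u ρ S :=
    hT.contDiff_apply (v := (u, ρ, S)) hI hJ ⟨hρ, hS⟩
  have hβ (i : Fin n) : β = fun q => (T q.1 q.2 (single i 1) ρ S + T q.1 q.2 (-single i 1) ρ S
      - 2 * T q.1 q.2 0 ρ S) / ρ := by
    funext q
    simp only [hTeq _ _ _ ρ hρ S hS, Pi.add_apply, background, affineDensity, norm_neg,
      PiLp.norm_single, norm_one, norm_zero, inner_neg_right, inner_zero_right]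
    field_simp
    ring
  have hα (i : Fin n) : (fun q => α q i)
      = fun q => (T q.1 q.2 (single i 1) ρ S - T q.1 q.2 (-single i 1) ρ S) / (2 * ρ) := by
    funext q
    simp only [hTeq _ _ _ ρ hρ S hS, Pi.add_apply, background, affineDensity, norm_neg,
      inner_neg_right, EuclideanSpace.inner_single_right, conj_trivial, one_mul]
    field_simp
    ring
  constructor
  · rw [hβ ⟨0, hn⟩]
    exact (((hsmooth _).add (hsmooth _)).sub (contDiff_const.mul (hsmooth _))).div_const ρ
  · refine contDiff_euclidean.2 fun i => ?_
    rw [hα i]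
    exact ((hsmooth _).sub (hsmooth _)).div_const _

theorem contDiff_backgroundCoefficient (hI : IsOpen I) (hJ : IsOpen J)
    (hT : IsSmoothKinematic I J T) {ρ S : ℝ} (hρ : ρ ∈ I) (hS : S ∈ J)
    (hTeq : ∀ t x, ∀ u : Space n, ∀ ρ ∈ I, ∀ S ∈ J,
      T t x u ρ S = (background w₀ + affineDensity e β α h) t x u ρ S) (hβ : ContDiff ℝ ∞ β) :
    ContDiff ℝ ∞ w₀ := by
  obtain ⟨ρ', hρ', hne⟩ := (infinite_of_mem_nhds ρ (hI.mem_nhds hρ)).nontrivial.exists_ne ρ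
  have hsmooth {r : ℝ} (hr : r ∈ I) : ContDiff ℝ ∞ fun q : ℝ × Space n => T q.1 q.2 0 r S :=
    hT.contDiff_apply (v := (0, r, S)) hI hJ ⟨hr, hS⟩
  have hw₀ : w₀ = fun q => (ρ' * T q.1 q.2 0 ρ S - ρ * T q.1 q.2 0 ρ' S
      - ρ * ρ' * (e ρ S - e ρ' S) * β q) / (ρ' - ρ) := by
    funext q
    rw [eq_div_iff (sub_ne_zero.2 hne), hTeq _ _ _ ρ hρ S hS, hTeq _ _ _ ρ' hρ' S hS]
    simp only [Pi.add_apply, background, affineDensity, norm_zero, inner_zero_right]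
    ring
  rw [hw₀]
  exact (((contDiff_const.mul (hsmooth hρ)).sub (contDiff_const.mul (hsmooth hρ'))).sub
    (contDiff_const.mul hβ)).div_const _

theorem contDiffOn_entropyCoefficient (hIpos : I ⊆ Ioi 0) (hT : IsSmoothKinematic I J T) {ρ : ℝ}
    (hρ : ρ ∈ I) (he : IsInternalEnergy I J P e)
    (hTeq : ∀ t x, ∀ u : Space n, ∀ ρ ∈ I, ∀ S ∈ J,
      T t x u ρ S = (background w₀ + affineDensity e β α h) t x u ρ S)
    (hw₀ : ContDiff ℝ ∞ w₀) (hβ : ContDiff ℝ ∞ β) : ContDiffOn ℝ ∞ h {q | q.2.2 ∈ J} := by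
  have hρ₀ : ρ ≠ 0 := (hIpos hρ).ne'
  have htx : ContDiff ℝ ∞ fun q : ℝ × Space n × ℝ => (q.1, q.2.1) := by fun_prop
  have hTS : ContDiffOn ℝ ∞ (fun q : ℝ × Space n × ℝ => T q.1 q.2.1 0 ρ q.2.2) {q | q.2.2 ∈ J} :=
    ContDiffOn.comp (g := uncurried T)
      (f := fun q : ℝ × Space n × ℝ => (q.1, q.2.1, ((0, ρ, q.2.2) : State n))) hT
      (by fun_prop) fun _ hq => ⟨hρ, hq⟩
  have heS : ContDiffOn ℝ ∞ (fun q : ℝ × Space n × ℝ => e ρ q.2.2) {q | q.2.2 ∈ J} :=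
    he.1.comp (f := fun q : ℝ × Space n × ℝ => (ρ, q.2.2)) (by fun_prop) fun _ hq => ⟨hρ, hq⟩
  refine (((hTS.sub (hw₀.comp htx).contDiffOn).div_const ρ).sub
    ((hβ.comp htx).contDiffOn.mul heS)).congr fun q hq => ?_
  simp only [hTeq _ _ _ ρ hρ _ hq, Pi.add_apply, background, affineDensity, norm_zero,
    inner_zero_right, Function.comp_apply]
  field_simp
  ring

end IsSmoothKinematic

namespace IsConserved

variable {T : Kinematic n ℝ}

theorem isTotalDivergence_affineLagrangian (hI : IsOpen I) (hJ : IsOpen J) (hIpos : I ⊆ Ioi 0)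
    (hP : ContDiffOn ℝ ∞ (fun q : ℝ × ℝ => P q.1 q.2) (I ×ˢ J))
    (hT : IsSmoothKinematic I J T) (hc : IsConserved I J P T) (t : ℝ) :
    IsTotalDivergence I J fun _ =>
      affineLagrangian (fun q => fderiv ℝ (uncurried T) (t, q) (1, q.2.1, 0))
        (fun i q => balanceForm P (fun v => uncurried T (t, q.1, v)) i q.2) := by
  have hTu : IsTotalDivergence I J fun t w =>
      divergence fun y => onField T t w y • (w y).1 :=
    ⟨0, fun t x j => uncurried T (t, x, j.1) • j.1.1,
      (ContDiffOn.comp (g := uncurried T)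
        (f := fun q : ℝ × Space n × Jet n 0 => (q.1, q.2.1, q.2.2.1)) hT (by fun_prop)
        fun _ hq => hq).smul (by fun_prop), fun _ _ _ _ => rfl⟩
  exact (((isConserved_iff_isTotalDivergence.1 hc).add hI hJ hTu).slice t).congr
    fun _ _ hw x =>
      (timeDeriv_add_divergence_smul_eq_affineLagrangian hI hJ hIpos hP hT t hw x).symm

theorem hasClosedBalanceForms (hI : IsOpen I) (hJ : IsOpen J) (hIpos : I ⊆ Ioi 0)
    (hP : ContDiffOn ℝ ∞ (fun q : ℝ × ℝ => P q.1 q.2) (I ×ˢ J))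
    (hT : IsSmoothKinematic I J T) (hc : IsConserved I J P T) (t : ℝ) (x : Space n) :
    HasClosedBalanceForms I J P fun v => uncurried T (t, x, v) := by
  intro v hv i a b
  have hB (i : Fin n) := contDiffOn_balanceForm_slice hI hJ hIpos hP (hT.slice t) i
  have hA : ContDiffOn ℝ ∞ (fun q : Space n × State n =>
      fderiv ℝ (uncurried T) (t, q) (1, q.2.1, 0)) (Prod.snd ⁻¹' phase n I J) := fun q hq =>
    (((hT.contDiffAt hI hJ t q.1 hq).fderiv_right (m := ∞) (by simp)).comp q
      (f := fun q : Space n × State n => (t, q)) (by fun_prop)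
      |>.clm_apply (by fun_prop)).contDiffWithinAt
  have hslice (c : State n) :
      fderiv ℝ (balanceForm P (fun v => uncurried T (t, x, v)) i) v c
        = fderiv ℝ (fun q : Space n × State n =>
            balanceForm P (fun v => uncurried T (t, q.1, v)) i q.2) (x, v) (0, c) := by
    have h : HasFDerivAt (balanceForm P (fun v => uncurried T (t, x, v)) i) _ v :=
      (((hB i).contDiffAt ((isOpen_preimage_phase hI hJ).mem_nhds (x := (x, v)) hv)
        ).differentiableAt (by simp)).hasFDerivAt.comp v (hasFDerivAt_prodMk_right x v)
    rw [h.fderiv]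
    rfl
  rw [hslice, hslice]
  exact (affine_null_lagrangian hI hJ hA hB
    (hc.isTotalDivergence_affineLagrangian hI hJ hIpos hP hT t) x hv a).2 i b

theorem exists_affineDensity (hn : 1 < n) (hI : IsOpen I) (hJ : IsOpen J) (hI' : I.OrdConnected)
    (hJ' : J.OrdConnected) (hIpos : I ⊆ Ioi 0)
    (hP : ContDiffOn ℝ ∞ (fun q : ℝ × ℝ => P q.1 q.2) (I ×ˢ J)) (hJne : J.Nonempty)
    (hPρ : ∀ U ⊆ J, IsOpen U → U.Nonempty → ∃ S ∈ U, ∃ ρ ∈ I, deriv (fun r => P r S) ρ ≠ 0)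
    (he : IsInternalEnergy I J P e) (hT : IsSmoothKinematic I J T) (hc : IsConserved I J P T) :
    ∃ (w₀ β : ℝ × Space n → ℝ) (α : ℝ × Space n → Space n) (h : ℝ × Space n × ℝ → ℝ),
      ContDiff ℝ ∞ w₀ ∧ ContDiff ℝ ∞ β ∧ ContDiff ℝ ∞ α ∧ ContDiffOn ℝ ∞ h {q | q.2.2 ∈ J} ∧
      ∀ t x, ∀ u : Space n, ∀ ρ ∈ I, ∀ S ∈ J,
        T t x u ρ S = (background w₀ + affineDensity e β α h) t x u ρ S := by
  have hpointwise (q : ℝ × Space n) := HasClosedBalanceForms.exists_eq hn hI hJ hI' hJ' hIpos hP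
    hJne hPρ he (f := fun v => uncurried T (q.1, q.2, v))
    (ContDiffOn.comp (g := fun r : Space n × State n => uncurried T (q.1, r)) (hT.slice q.1)
      (contDiff_prodMk_right q.2).contDiffOn fun _ hv => hv)
    (hc.hasClosedBalanceForms hI hJ hIpos hP hT q.1 q.2)
  choose w₀ β α h hform using hpointwise
  have hTeq (t x) (u : Space n) (ρ) (hρ : ρ ∈ I) (S) (hS : S ∈ J) : T t x u ρ S
      = (background w₀ + affineDensity e β α fun q => h (q.1, q.2.1) q.2.2) t x u ρ S :=
    hform (t, x) (u, ρ, S) ⟨hρ, hS⟩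
  obtain ⟨S₀, hS₀, ρ₀, hρ₀, -⟩ := hPρ J subset_rfl hJ hJne
  obtain ⟨hβ, hα⟩ := hT.contDiff_velocityCoefficients (zero_lt_one.trans hn) hI hJ hIpos hρ₀ hS₀
    hTeq
  have hw₀ := hT.contDiff_backgroundCoefficient hI hJ hρ₀ hS₀ hTeq hβ
  exact ⟨w₀, β, α, _, hw₀, hβ, hα,
    hT.contDiffOn_entropyCoefficient hIpos hρ₀ he hTeq hw₀ hβ, hTeq⟩

end IsConserved

/-! ### The determining equations -/

section

variable {T : Kinematic n ℝ} {β : ℝ × Space n → ℝ} {α : ℝ × Space n → Space n}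
  {h : ℝ × Space n × ℝ → ℝ}

theorem contDiffOn_balanceSource (hJ : IsOpen J)
    (hP : ContDiffOn ℝ ∞ (fun q : ℝ × ℝ => P q.1 q.2) (I ×ˢ J))
    (he : ContDiffOn ℝ ∞ (fun q : ℝ × ℝ => e q.1 q.2) (I ×ˢ J)) (hβ : ContDiff ℝ ∞ β)
    (hα : ContDiff ℝ ∞ α) (hh : ContDiffOn ℝ ∞ h {q | q.2.2 ∈ J}) (t : ℝ) :
    ContDiffOn ℝ ∞ (balanceSource P e β α h t) (Prod.snd ⁻¹' phase n I J) := by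
  have hpoint : ContDiff ℝ ∞ fun q : Space n × State n => (t, q.1) := by fun_prop
  have hu : ContDiff ℝ ∞ fun q : Space n × State n => q.2.1 := by fun_prop
  have hstate {f : ℝ → ℝ → ℝ} (hf : ContDiffOn ℝ ∞ (fun q : ℝ × ℝ => f q.1 q.2) (I ×ˢ J)) :
      ContDiffOn ℝ ∞ (fun q : Space n × State n => f q.2.2.1 q.2.2.2)
        (Prod.snd ⁻¹' phase n I J) :=
    hf.comp (f := fun q : Space n × State n => (q.2.2.1, q.2.2.2)) (by fun_prop) fun _ hq => hq
  have hdβ := (hβ.fderiv_right (m := ∞) (by simp)).comp hpoint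
  have hdα := (hα.fderiv_right (m := ∞) (by simp)).comp hpoint
  have hdh : ContDiffOn ℝ ∞ (fun q : Space n × State n => fderiv ℝ h (t, q.1, q.2.2.2))
      (Prod.snd ⁻¹' phase n I J) :=
    (hh.fderiv_of_isOpen (m := ∞) (hJ.preimage (continuous_snd.comp continuous_snd))
      (by simp)).comp (f := fun q : Space n × State n => (t, q.1, q.2.2.2)) (by fun_prop)
        fun _ hq => hq.2
  have hdir (s : ℝ) : ContDiff ℝ ∞ fun q : Space n × State n => (s, q.2.1) := by fun_prop
  have hdiv : ContDiff ℝ ∞ fun q : Space n × State n =>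
      ∑ i, fderiv ℝ α (t, q.1) (0, single i 1) i :=
    ContDiff.sum fun i _ => (EuclideanSpace.proj (𝕜 := ℝ) i).contDiff.comp
      (hdα.clm_apply contDiff_const)
  exact (ContDiff.contDiffOn (by fun_prop)).mul ((((hdβ.clm_apply (hdir 1)).contDiffOn.mul
    (((hu.norm_sq ℝ).div_const 2).contDiffOn.add (hstate he))).add
      ((hdα.clm_apply (hdir 1)).inner ℝ hu).contDiffOn).add
        (hdh.clm_apply (ContDiff.contDiffOn (by fun_prop)))) |>.add
    ((hstate hP).mul ((hdβ.clm_apply (hdir 0)).add hdiv).contDiffOn)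

theorem IsConserved.balanceSource_eq (hI : IsOpen I) (hJ : IsOpen J) (hI' : I.OrdConnected)
    (hJ' : J.OrdConnected) (hIpos : I ⊆ Ioi 0)
    (hP : ContDiffOn ℝ ∞ (fun q : ℝ × ℝ => P q.1 q.2) (I ×ˢ J)) (he : IsInternalEnergy I J P e)
    (hβ : ContDiff ℝ ∞ β) (hα : ContDiff ℝ ∞ α) (hh : ContDiffOn ℝ ∞ h {q | q.2.2 ∈ J})
    (hc : IsConserved I J P (affineDensity e β α h)) (t : ℝ) (x : Space n) {v w : State n}
    (hv : v ∈ phase n I J) (hw : w ∈ phase n I J) :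
    balanceSource P e β α h t (x, v) = balanceSource P e β α h t (x, w) := by
  have hpoint : ContDiff ℝ ∞ fun q : ℝ × Space n × State n => (q.1, q.2.1) := by fun_prop
  have hflux : ContDiff ℝ ∞ fun q : ℝ × Space n × State n =>
      β (q.1, q.2.1) • q.2.2.1 + α (q.1, q.2.1) :=
    ((hβ.comp hpoint).smul (by fun_prop)).add (hα.comp hpoint)
  have hdiv := (isConserved_iff_isTotalDivergence.1 hc).add hI hJ
    (isTotalDivergence_divergence_movingFlux
      (ξ := fun t x u ρ S => (P ρ S - 0) • (β (t, x) • u + α (t, x)))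
      (isSmoothKinematic_affineDensity he.1 hβ hα hh)
      (contDiffOn_stateFunction_smul (f := fun ρ S => P ρ S - 0) (hP.sub contDiffOn_const) hflux))
  have hsource : IsTotalDivergence I J fun t w x => balanceSource P e β α h t (x, w x) := by
    refine hdiv.congr fun t w hw x => ?_
    have hbalance := timeDeriv_affineDensity_add_divergence hI hJ hIpos hP he.sub_zero hβ hα hh t
      hw x
    simp only [sub_zero] at hbalance ⊢
    exact hbalance.symm
  exact IsTotalDivergence.eq_of_kinematic hI hJ hI' hJ'
    (contDiffOn_balanceSource hJ hP he.1 hβ hα hh t) (hsource.slice t) x hv hw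

theorem balanceSource_smul (t : ℝ) (x u : Space n) (ρ S s : ℝ) :
    balanceSource P e β α h t (x, s • u, ρ, S)
      = balanceSource P e β α h t (x, 0, ρ, S)
        + (s ^ 3 * (ρ * (fderiv ℝ β (t, x) (0, u) * (‖u‖ ^ 2 / 2)))
          + s ^ 2 * (ρ * (fderiv ℝ β (t, x) (1, 0) * ‖u‖ ^ 2 / 2
            + inner ℝ (fderiv ℝ α (t, x) (0, u)) u))
          + s * (ρ * (fderiv ℝ β (t, x) (0, u) * e ρ S + inner ℝ (fderiv ℝ α (t, x) (1, 0)) u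
            + fderiv ℝ h (t, x, S) (0, u, 0)) + P ρ S * fderiv ℝ β (t, x) (0, u))) := by
  have hpoint : ((1 : ℝ), s • u) = (1, 0) + s • ((0 : ℝ), u) := by simp
  have hpoint₀ : ((0 : ℝ), s • u) = s • ((0 : ℝ), u) := by simp
  have hstate : ((1 : ℝ), s • u, (0 : ℝ)) = (1, 0, 0) + s • ((0 : ℝ), u, (0 : ℝ)) := by simp
  have hzero : ((0 : ℝ), (0 : Space n)) = 0 := rfl
  simp only [balanceSource, hpoint, hpoint₀, hstate, hzero, map_add, map_smul, map_zero, norm_smul,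
    norm_zero, inner_add_left, inner_smul_left, inner_smul_right, inner_zero_right, smul_eq_mul,
    mul_pow, Real.norm_eq_abs, sq_abs, conj_trivial]
  ring

/-- The equations for the coefficients of a conserved density `affineDensity e β α h`: the source
`balanceSource P e β α h` is a polynomial in `u` that has to be independent of the state. -/
structure DeterminingEquations (I J : Set ℝ) (P e : ℝ → ℝ → ℝ) (β : ℝ × Space n → ℝ)
    (α : ℝ × Space n → Space n) (h : ℝ × Space n × ℝ → ℝ) : Prop where
  contDiff_β : ContDiff ℝ ∞ β
  contDiff_α : ContDiff ℝ ∞ α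
  contDiffOn_h : ContDiffOn ℝ ∞ h {q | q.2.2 ∈ J}
  β_space : ∀ t x u, fderiv ℝ β (t, x) (0, u) = 0
  α_space : ∀ t x u, fderiv ℝ β (t, x) (1, 0) * ‖u‖ ^ 2 / 2
    + inner ℝ (fderiv ℝ α (t, x) (0, u)) u = 0
  α_time : ∀ t x u, ∀ S ∈ J,
    inner ℝ (fderiv ℝ α (t, x) (1, 0)) u + fderiv ℝ h (t, x, S) (0, u, 0) = 0
  pressure : ∀ t x, ∀ ρ ∈ I, ∀ S ∈ J, ∀ ρ' ∈ I, ∀ S' ∈ J,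
    ρ * (fderiv ℝ β (t, x) (1, 0) * e ρ S + fderiv ℝ h (t, x, S) (1, 0, 0))
        - n / 2 * fderiv ℝ β (t, x) (1, 0) * P ρ S
      = ρ' * (fderiv ℝ β (t, x) (1, 0) * e ρ' S' + fderiv ℝ h (t, x, S') (1, 0, 0))
        - n / 2 * fderiv ℝ β (t, x) (1, 0) * P ρ' S'

theorem eq_zero_of_forall_cubic_eq_zero {a b c : ℝ}
    (h : ∀ s : ℝ, s ^ 3 * a + s ^ 2 * b + s * c = 0) : a = 0 ∧ b = 0 ∧ c = 0 := by
  have h₁ := h 1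
  have h₂ := h (-1)
  have h₃ := h 2
  exact ⟨by linarith, by linarith, by linarith⟩

theorem coeff_eq_zero_of_balanceSource_eq {t ρ S : ℝ} {x : Space n} (hρ : ρ ≠ 0)
    (hsource : ∀ u, balanceSource P e β α h t (x, u, ρ, S)
      = balanceSource P e β α h t (x, 0, ρ, S)) (u : Space n) :
    fderiv ℝ β (t, x) (0, u) = 0
      ∧ fderiv ℝ β (t, x) (1, 0) * ‖u‖ ^ 2 / 2 + inner ℝ (fderiv ℝ α (t, x) (0, u)) u = 0
      ∧ inner ℝ (fderiv ℝ α (t, x) (1, 0)) u + fderiv ℝ h (t, x, S) (0, u, 0) = 0 := by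
  obtain ⟨hcubic, hquadratic, hlinear⟩ := eq_zero_of_forall_cubic_eq_zero fun s =>
    add_eq_left.1 ((balanceSource_smul (α := α) (h := h) t x u ρ S s).symm.trans
      (hsource (s • u)))
  have hβ : fderiv ℝ β (t, x) (0, u) = 0 := by
    rcases eq_or_ne u 0 with rfl | hu
    · exact map_zero (fderiv ℝ β (t, x))
    · simpa [hρ, hu] using hcubic
  rw [hβ] at hlinear
  exact ⟨hβ, (mul_eq_zero.1 hquadratic).resolve_left hρ, by simpa [hρ] using hlinear⟩

theorem sum_apply_single_of_inner_self {L : Space n →ₗ[ℝ] Space n} {c : ℝ}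
    (hL : ∀ u, inner ℝ (L u) u = c * ‖u‖ ^ 2) : ∑ i, L (single i 1) i = n * c := by
  have hdiag (i : Fin n) : L (single i 1) i = c := by
    simpa [EuclideanSpace.inner_single_right] using hL (single i 1)
  simp [hdiag]

theorem DeterminingEquations.of_balanceSource_eq (hIpos : I ⊆ Ioi 0) (hIne : I.Nonempty)
    (hJne : J.Nonempty) (hβ : ContDiff ℝ ∞ β) (hα : ContDiff ℝ ∞ α)
    (hh : ContDiffOn ℝ ∞ h {q | q.2.2 ∈ J})
    (hsource : ∀ t x, ∀ v ∈ phase n I J, ∀ w ∈ phase n I J,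
      balanceSource P e β α h t (x, v) = balanceSource P e β α h t (x, w)) :
    DeterminingEquations I J P e β α h := by
  obtain ⟨ρ₀, hρ₀⟩ := hIne
  obtain ⟨S₀, hS₀⟩ := hJne
  have hcoeff (t : ℝ) (x u : Space n) {S : ℝ} (hS : S ∈ J) :=
    coeff_eq_zero_of_balanceSource_eq (hIpos hρ₀).ne'
      (fun u => hsource t x (u, ρ₀, S) ⟨hρ₀, hS⟩ (0, ρ₀, S) ⟨hρ₀, hS⟩) u
  have hα_space (t : ℝ) (x u : Space n) := (hcoeff t x u hS₀).2.1
  refine ⟨hβ, hα, hh, fun t x u => (hcoeff t x u hS₀).1, hα_space,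
    fun t x u S hS => (hcoeff t x u hS).2.2, fun t x ρ hρ S hS ρ' hρ' S' hS' => ?_⟩
  have htrace : ∑ i, fderiv ℝ α (t, x) (0, single i 1) i = n * (-(fderiv ℝ β (t, x) (1, 0) / 2)) :=
    sum_apply_single_of_inner_self
      (L := (fderiv ℝ α (t, x)).toLinearMap ∘ₗ LinearMap.inr ℝ ℝ (Space n)) fun u => by
        simp only [LinearMap.comp_apply, LinearMap.inr_apply, ContinuousLinearMap.coe_coe]
        linarith [hα_space t x u]
  have heq := hsource t x (0, ρ, S) ⟨hρ, hS⟩ (0, ρ', S') ⟨hρ', hS'⟩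
  have hzero : ((0 : ℝ), (0 : Space n)) = 0 := rfl
  simp only [balanceSource, htrace, hzero, map_zero, norm_zero, inner_zero_right] at heq
  linear_combination heq

theorem IsConserved.exists_determiningEquations (hn : 1 < n) (hI : IsOpen I) (hJ : IsOpen J)
    (hI' : I.OrdConnected) (hJ' : J.OrdConnected) (hIpos : I ⊆ Ioi 0)
    (hP : ContDiffOn ℝ ∞ (fun q : ℝ × ℝ => P q.1 q.2) (I ×ˢ J)) (hJne : J.Nonempty)
    (hPρ : ∀ U ⊆ J, IsOpen U → U.Nonempty → ∃ S ∈ U, ∃ ρ ∈ I, deriv (fun r => P r S) ρ ≠ 0)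
    (he : IsInternalEnergy I J P e) (hT : IsSmoothKinematic I J T) (hc : IsConserved I J P T) :
    ∃ (w₀ β : ℝ × Space n → ℝ) (α : ℝ × Space n → Space n) (h : ℝ × Space n × ℝ → ℝ),
      ContDiff ℝ ∞ w₀ ∧ DeterminingEquations I J P e β α h ∧
      ∀ t x, ∀ u : Space n, ∀ ρ ∈ I, ∀ S ∈ J,
        T t x u ρ S = (background w₀ + affineDensity e β α h) t x u ρ S := by
  obtain ⟨_, _, ρ, hρ, _⟩ := hPρ J subset_rfl hJ hJne
  obtain ⟨w₀, β, α, h, hw₀, hβ, hα, hh, heq⟩ :=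
    hc.exists_affineDensity hn hI hJ hI' hJ' hIpos hP hJne hPρ he hT
  have hbackground : background w₀ ∈ conservedDensity hI hJ P :=
    ⟨(hw₀.comp (contDiff_fst.prodMk (contDiff_fst.comp contDiff_snd))).contDiffOn,
      isConserved_background (zero_lt_one.trans hn) hw₀⟩
  have hc' : IsConserved I J P (affineDensity e β α h) :=
    (Submodule.sub_mem (conservedDensity hI hJ P) ⟨hT, hc⟩ hbackground).2.congr hI hJ
      fun t x u ρ hρ S hS => sub_eq_of_eq_add' (heq t x u ρ hρ S hS)
  exact ⟨w₀, β, α, h, hw₀, .of_balanceSource_eq hIpos ⟨ρ, hρ⟩ hJne hβ hα hh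
    fun t x _ hv _ hw => hc'.balanceSource_eq hI hJ hI' hJ' hIpos hP he hβ hα hh t x hv
      hw, heq⟩

/-! ### Integration of the determining equations -/

theorem eq_add_smul_of_hasDerivAt {F : Type*} [NormedAddCommGroup F] [NormedSpace ℝ F] {f : ℝ → F}
    {c : F} (hf : ∀ t, HasDerivAt f c t) (t : ℝ) : f t = f 0 + t • c := by
  have hderiv (s : ℝ) : HasDerivAt (fun s => f s - s • c) 0 s := by
    simpa using (hf s).fun_sub ((hasDerivAt_id s).smul_const c)
  have hconst := is_const_of_deriv_eq_zero (fun s => (hderiv s).differentiableAt)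
    (fun s => (hderiv s).deriv) t 0
  rw [← sub_eq_iff_eq_add, hconst, zero_smul, sub_zero]

theorem add_eq_of_hasLineDerivAt {E F : Type*} [AddCommGroup E] [Module ℝ E]
    [NormedAddCommGroup F] [NormedSpace ℝ F] {f : E → F} {x v : E} {c : F}
    (hf : ∀ s : ℝ, HasLineDerivAt ℝ f c (x + s • v) v) : f (x + v) = f x + c := by
  have hderiv (s : ℝ) : HasDerivAt (fun r : ℝ => f (x + r • v)) c s := by
    have := HasDerivAt.comp_sub_const s s (by rw [sub_self]; exact hf s)
    simpa only [add_assoc, ← add_smul, add_sub_cancel] using this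
  simpa using eq_add_smul_of_hasDerivAt hderiv 1

theorem hasDerivAt_prodMk_right {E F : Type*} [NormedAddCommGroup E] [NormedSpace ℝ E]
    [NormedAddCommGroup F] [NormedSpace ℝ F] {f : ℝ × E → F} {t : ℝ} {y : E}
    (hf : DifferentiableAt ℝ f (t, y)) :
    HasDerivAt (fun t => f (t, y)) (fderiv ℝ f (t, y) (1, 0)) t :=
  hf.hasFDerivAt.comp_hasDerivAt t ((hasDerivAt_id t).prodMk (hasDerivAt_const t y))

theorem hasLineDerivAt_prodMk_left {E F : Type*} [NormedAddCommGroup E] [NormedSpace ℝ E]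
    [NormedAddCommGroup F] [NormedSpace ℝ F] {f : ℝ × E → F} {t : ℝ} {y : E}
    (hf : DifferentiableAt ℝ f (t, y)) (v : E) :
    HasLineDerivAt ℝ (fun y => f (t, y)) (fderiv ℝ f (t, y) (0, v)) y v :=
  (hf.hasFDerivAt.comp y (hasFDerivAt_prodMk_right t y)).hasLineDerivAt v

theorem add_eq_of_hasLineDerivAt_inner {E : Type*} [NormedAddCommGroup E] [InnerProductSpace ℝ E]
    {φ : E → ℝ} {F : E → E} (hF : ∀ x u, inner ℝ (F (x + u) - F x) u = 0)
    (hφ : ∀ x u, HasLineDerivAt ℝ φ (inner ℝ (F x) u) x u) (x u : E) :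
    φ (x + u) = φ x + inner ℝ (F x) u := by
  refine add_eq_of_hasLineDerivAt fun s => ?_
  have hline : inner ℝ (F (x + s • u)) u = inner ℝ (F x) u := by
    rcases eq_or_ne s 0 with rfl | hs
    · simp
    · simpa [inner_smul_right, hs, inner_sub_left, sub_eq_zero] using hF x (s • u)
  exact hline ▸ hφ (x + s • u) u

theorem eq_apply_zero_of_hasLineDerivAt_inner {E : Type*} [NormedAddCommGroup E]
    [InnerProductSpace ℝ E] {φ : E → ℝ} {F : E → E}
    (hF : ∀ x u, inner ℝ (F (x + u) - F x) u = 0)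
    (hφ : ∀ x u, HasLineDerivAt ℝ φ (inner ℝ (F x) u) x u) (x : E) : F x = F 0 := by
  refine ext_inner_right ℝ fun u => ?_
  have hadd := add_eq_of_hasLineDerivAt_inner hF hφ
  have h₀ := hadd 0 x
  have h₁ := hadd 0 (x + u)
  rw [zero_add] at h₀ h₁
  rw [inner_add_right] at h₁
  linarith [hadd x u]

theorem exists_eq_of_inner_sub_eq_zero {F : Space n → Space n}
    (hF : ∀ x u, inner ℝ (F (x + u) - F x) u = 0) :
    ∃ c : Fin n → Fin n → ℝ, ∀ x,
      F x = F 0 + ∑ j, ∑ k, c j k • (x k • single j 1 - x j • single k 1) := by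
  have hself (x : Space n) : inner ℝ (F x - F 0) x = 0 := by simpa using hF 0 x
  have hskew (x y : Space n) : inner ℝ (F x - F 0) y = -inner ℝ (F y - F 0) x := by
    have hxy := hF y (x - y)
    rw [add_sub_cancel, ← sub_sub_sub_cancel_right _ _ (F 0), inner_sub_left, inner_sub_right,
      inner_sub_right, hself, hself] at hxy
    linarith
  have hcoord (x : Space n) (i : Fin n) : (F x - F 0) i = -inner ℝ (F (single i 1) - F 0) x := by
    simpa [EuclideanSpace.inner_single_right] using hskew x (single i 1)
  refine ⟨fun j k => -(F (single j 1) - F 0) k / 2, fun x => ?_⟩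
  rw [← sub_eq_iff_eq_add']
  ext i
  have hanti (k : Fin n) : (F (single k 1) - F 0) i = -(F (single i 1) - F 0) k := by
    simpa [EuclideanSpace.inner_single_right] using hcoord (single k 1) i
  simp only [WithLp.ofLp_sum, Finset.sum_apply, PiLp.smul_apply, PiLp.sub_apply, PiLp.single_apply,
    smul_eq_mul, mul_sub, Finset.sum_sub_distrib, mul_ite, mul_one, mul_zero,
    Finset.sum_ite_irrel, Finset.sum_ite_eq, Finset.mem_univ, if_true, Finset.sum_const_zero]
  rw [← PiLp.sub_apply, hcoord, PiLp.inner_apply, ← Finset.sum_neg_distrib,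
    ← Finset.sum_sub_distrib]
  refine Finset.sum_congr rfl fun k _ => ?_
  have hk := hanti k
  simp only [PiLp.sub_apply] at hk
  simp only [PiLp.sub_apply, RCLike.inner_apply, conj_trivial]
  linear_combination -(1 / 2) * x k * hk

namespace DeterminingEquations

theorem differentiableAt_h (D : DeterminingEquations I J P e β α h) (hJ : IsOpen J) (t : ℝ)
    (x : Space n) {S : ℝ} (hS : S ∈ J) : DifferentiableAt ℝ h (t, x, S) :=
  (D.contDiffOn_h.contDiffAt ((hJ.preimage (continuous_snd.comp continuous_snd)).mem_nhds
    hS)).differentiableAt (by simp)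

theorem β_eq (D : DeterminingEquations I J P e β α h) (t : ℝ) (x : Space n) :
    β (t, x) = β (t, 0) := by
  simpa using add_eq_of_hasLineDerivAt (f := fun x => β (t, x)) (x := 0) (v := x) (c := 0) fun s =>
    D.β_space t (0 + s • x) x ▸
      hasLineDerivAt_prodMk_left (D.contDiff_β.differentiable (by simp) (t, 0 + s • x)) x

theorem fderiv_β_eq (D : DeterminingEquations I J P e β α h) (t : ℝ) (x : Space n) :
    fderiv ℝ β (t, x) (1, 0) = fderiv ℝ β (t, 0) (1, 0) := by
  have hdiff := D.contDiff_β.differentiable (by simp)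
  refine (hasDerivAt_prodMk_right (hdiff (t, x))).unique ?_
  simpa only [D.β_eq _ x] using hasDerivAt_prodMk_right (hdiff (t, 0))

theorem inner_α_sub (D : DeterminingEquations I J P e β α h) (t : ℝ) (x u : Space n) :
    inner ℝ (α (t, x + u) - α (t, x)) u = -(fderiv ℝ β (t, 0) (1, 0) * ‖u‖ ^ 2 / 2) := by
  have hline := add_eq_of_hasLineDerivAt (f := fun x => inner ℝ (α (t, x)) u) (x := x) (v := u)
    (c := -(fderiv ℝ β (t, 0) (1, 0) * ‖u‖ ^ 2 / 2)) fun s => by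
      have hα := hasLineDerivAt_prodMk_left
        (D.contDiff_α.differentiable (by simp) (t, x + s • u)) u
      rw [← D.fderiv_β_eq t (x + s • u), ← eq_neg_of_add_eq_zero_right (D.α_space t (x + s • u) u)]
      simpa [HasLineDerivAt] using HasDerivAt.inner ℝ hα (hasDerivAt_const 0 u)
  rw [inner_sub_left, hline, add_sub_cancel_left]

section

variable {S k : ℝ}

theorem h_eq (D : DeterminingEquations I J P e β α h) (hJ : IsOpen J) (hS : S ∈ J)
    (hk : ∀ t x, fderiv ℝ h (t, x, S) (1, 0, 0) + fderiv ℝ β (t, x) (1, 0) * k = 0)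
    (t : ℝ) (x : Space n) : h (t, x, S) = h (0, x, S) + (β (0, 0) - β (t, 0)) * k := by
  have hline := eq_add_smul_of_hasDerivAt (f := fun t => h (t, x, S) + β (t, x) * k) (c := 0)
    (fun t => by
      rw [← hk t x]
      exact (hasDerivAt_prodMk_right (D.differentiableAt_h hJ t x hS)).fun_add
        ((hasDerivAt_prodMk_right (D.contDiff_β.differentiable (by simp) (t, x))).mul_const k)) t
  simp only [D.β_eq _ x, smul_zero] at hline
  linarith

theorem fderiv_α_time_eq (D : DeterminingEquations I J P e β α h) (hJ : IsOpen J) (hS : S ∈ J)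
    (hk : ∀ t x, fderiv ℝ h (t, x, S) (1, 0, 0) + fderiv ℝ β (t, x) (1, 0) * k = 0)
    (t : ℝ) (x : Space n) : fderiv ℝ α (t, x) (1, 0) = fderiv ℝ α (0, x) (1, 0) := by
  refine ext_inner_right ℝ fun u => ?_
  have hspace : fderiv ℝ h (t, x, S) (0, u, 0) = fderiv ℝ h (0, x, S) (0, u, 0) := by
    simp only [← (D.differentiableAt_h hJ _ x hS).lineDeriv_eq_fderiv, lineDeriv, Prod.smul_mk,
      Prod.mk_add_mk, smul_zero, add_zero, D.h_eq hJ hS hk t, deriv_add_const]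
  linarith [D.α_time t x u S hS, D.α_time 0 x u S hS]

theorem α_eq (D : DeterminingEquations I J P e β α h) (hJ : IsOpen J) (hS : S ∈ J)
    (hk : ∀ t x, fderiv ℝ h (t, x, S) (1, 0, 0) + fderiv ℝ β (t, x) (1, 0) * k = 0)
    (t : ℝ) (x : Space n) : α (t, x) = α (0, x) + t • fderiv ℝ α (0, x) (1, 0) :=
  eq_add_smul_of_hasDerivAt (f := fun t => α (t, x)) (fun s => D.fderiv_α_time_eq hJ hS hk s x ▸
    hasDerivAt_prodMk_right (D.contDiff_α.differentiable (by simp) (s, x))) t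

theorem exists_fderiv_β_eq_add_mul (D : DeterminingEquations I J P e β α h) (hn : 0 < n)
    (hJ : IsOpen J) (hS : S ∈ J)
    (hk : ∀ t x, fderiv ℝ h (t, x, S) (1, 0, 0) + fderiv ℝ β (t, x) (1, 0) * k = 0) :
    ∃ c₁ c₂ : ℝ, ∀ t, fderiv ℝ β (t, 0) (1, 0) = c₁ + c₂ * t := by
  let u : Space n := single ⟨0, hn⟩ 1
  refine ⟨-2 * inner ℝ (α (0, u) - α (0, 0)) u,
    -2 * inner ℝ (fderiv ℝ α (0, u) (1, 0) - fderiv ℝ α (0, 0) (1, 0)) u, fun t => ?_⟩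
  have hsub := D.inner_α_sub t 0 u
  rw [zero_add, D.α_eq hJ hS hk t u, D.α_eq hJ hS hk t 0, add_sub_add_comm, ← smul_sub,
    inner_add_left, inner_smul_left] at hsub
  have hu : ‖u‖ = 1 := by simp [u]
  rw [hu, one_pow, mul_one, RCLike.conj_to_real] at hsub
  linarith

theorem exists_β_eq_quadratic (D : DeterminingEquations I J P e β α h) (hn : 0 < n)
    (hJ : IsOpen J) (hS : S ∈ J)
    (hk : ∀ t x, fderiv ℝ h (t, x, S) (1, 0, 0) + fderiv ℝ β (t, x) (1, 0) * k = 0) :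
    ∃ b₁ b₂ : ℝ, ∀ t x, β (t, x) = β (0, 0) + b₁ * t + b₂ * t ^ 2 := by
  obtain ⟨c₁, c₂, hc⟩ := D.exists_fderiv_β_eq_add_mul hn hJ hS hk
  refine ⟨c₁, c₂ / 2, fun t x => ?_⟩
  have hline := eq_add_smul_of_hasDerivAt
    (f := fun t : ℝ => β (t, 0) - (c₁ * t + c₂ / 2 * t ^ 2)) (c := 0) (fun t => by
      refine ((hasDerivAt_prodMk_right (D.contDiff_β.differentiable (by simp) (t, 0))).fun_sub
        (((hasDerivAt_id t).const_mul c₁).fun_add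
          ((hasDerivAt_pow 2 t).const_mul (c₂ / 2)))).congr_deriv ?_
      rw [hc t]
      ring) t
  simp only [smul_zero] at hline
  rw [D.β_eq]
  linarith

end

end DeterminingEquations

/-! ### Standard densities -/

/-- The linear combinations of mass, momentum, angular momentum, Galilean momentum, energy and
generalized entropy that occur in `IsStandard`; the coefficients `a` of momentum and `g` of
Galilean momentum are taken as vectors. -/
def standardDensity (e : ℝ → ℝ → ℝ) (m b : ℝ) (a g : Space n) (c : Fin n → Fin n → ℝ)
    (f : ℝ → ℝ) : Kinematic n ℝ :=
  m • mass + ∑ k, a k • momentum k + ∑ j, ∑ k, c j k • angularMomentum j k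
    + ∑ k, g k • galileanMomentum k + b • energy e + entropy f

theorem isStandard_iff :
    IsStandard I J e T ↔ ∃ (m b : ℝ) (a g : Space n) (c : Fin n → Fin n → ℝ) (f : ℝ → ℝ),
      ContDiffOn ℝ ∞ f J ∧ IsTrivial I J (T - standardDensity e m b a g c f) :=
  ⟨fun ⟨m, b, a, g, c, f, hf, h⟩ => ⟨m, b, WithLp.toLp 2 a, WithLp.toLp 2 g, c, f, hf, h⟩,
    fun ⟨m, b, a, g, c, f, hf, h⟩ => ⟨m, b, a, g, c, f, hf, h⟩⟩

theorem standardDensity_eq_affineDensity (e : ℝ → ℝ → ℝ) (m b : ℝ) (a g : Space n)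
    (c : Fin n → Fin n → ℝ) (f : ℝ → ℝ) :
    standardDensity e m b a g c f = affineDensity e (fun _ => b)
      (fun q => a + ∑ j, ∑ k, c j k • (q.2 k • single j 1 - q.2 j • single k 1) + q.1 • g)
      fun q => m - inner ℝ g q.2.1 + f q.2.2 := by
  funext t x u ρ S
  have hcoord (v y : Space n) : inner ℝ v y = ∑ k, v k * y k := by
    simp [PiLp.inner_apply, mul_comm]
  have hrot : inner ℝ (∑ j, ∑ k, c j k • (x k • single j (1 : ℝ) - x j • single k 1)) u
      = ∑ j, ∑ k, c j k * (u j * x k - u k * x j) := by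
    simp [sum_inner, inner_smul_left, inner_sub_left, EuclideanSpace.inner_single_left, mul_comm]
  simp only [standardDensity, affineDensity, Pi.add_apply, Pi.smul_apply, Finset.sum_apply,
    smul_eq_mul, mass, momentum, angularMomentum, galileanMomentum, energy, entropy,
    inner_add_left, inner_smul_left, RCLike.conj_to_real, hrot]
  simp only [hcoord, mul_sub, mul_add, Finset.mul_sum, Finset.sum_sub_distrib, mul_left_comm _ ρ,
    mul_left_comm (g _) t]
  ring

theorem standardDensity_mem_conservedDensity (hI : IsOpen I) (hJ : IsOpen J) (hIpos : I ⊆ Ioi 0)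
    (hP : ContDiffOn ℝ ∞ (fun q : ℝ × ℝ => P q.1 q.2) (I ×ˢ J)) (he : IsInternalEnergy I J P e)
    (m b : ℝ) (a g : Space n) (c : Fin n → Fin n → ℝ) {f : ℝ → ℝ} (hf : ContDiffOn ℝ ∞ f J) :
    standardDensity e m b a g c f ∈ conservedDensity hI hJ P := by
  have hρ : ContDiff ℝ ∞ fun q : ℝ × Space n × State n => q.2.2.2.1 := by fun_prop
  have hu : ContDiff ℝ ∞ fun q : ℝ × Space n × State n => q.2.2.1 := by fun_prop
  refine add_mem (add_mem (add_mem (add_mem (add_mem ?mass ?momentum) ?angular) ?galilean) ?energy)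
    ?entropy
  case mass =>
    exact Submodule.smul_mem _ m ((hasMovingFlux_mass hI hJ hIpos hP he).mem_conservedDensity hI hJ
      hρ.contDiffOn contDiffOn_const)
  case momentum =>
    refine sum_mem fun k _ => Submodule.smul_mem _ _
      ((hasMovingFlux_momentum hI hJ hIpos hP he k).mem_conservedDensity hI hJ ?_
        (contDiffOn_stateFunction_smul hP contDiff_const))
    unfold IsSmoothKinematic uncurried momentum
    fun_prop
  case angular =>
    refine sum_mem fun j _ => sum_mem fun k _ => Submodule.smul_mem _ _
      ((hasMovingFlux_angularMomentum hI hJ hIpos hP he j k).mem_conservedDensity hI hJ ?_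
        (contDiffOn_stateFunction_smul hP (by fun_prop)))
    unfold IsSmoothKinematic uncurried angularMomentum
    fun_prop
  case galilean =>
    refine sum_mem fun k _ => Submodule.smul_mem _ _
      ((hasMovingFlux_galileanMomentum hI hJ hIpos hP he k).mem_conservedDensity hI hJ ?_ ?_)
    · unfold IsSmoothKinematic uncurried galileanMomentum
      fun_prop
    · exact (ContDiffOn.mul contDiffOn_fst (isSmoothKinematic_stateFunction hP)).smul
        contDiffOn_const
  case energy =>
    exact Submodule.smul_mem _ b ((hasMovingFlux_energy hI hJ hIpos hP he).mem_conservedDensity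
      hI hJ (hρ.contDiffOn.mul (((hu.norm_sq ℝ).div_const 2).contDiffOn.add
        (isSmoothKinematic_stateFunction he.1))) (contDiffOn_stateFunction_smul hP hu))
  case entropy =>
    exact (hasMovingFlux_entropy hI hJ hIpos hP he hf).mem_conservedDensity hI hJ
      (hρ.contDiffOn.mul (hf.comp (by fun_prop) fun _ hq => hq.2)) contDiffOn_const

theorem IsStandard.isConserved (hn : 0 < n) (hI : IsOpen I) (hJ : IsOpen J)
    (hI' : I.OrdConnected) (hJ' : J.OrdConnected) (hIpos : I ⊆ Ioi 0)
    (hP : ContDiffOn ℝ ∞ (fun q : ℝ × ℝ => P q.1 q.2) (I ×ˢ J)) (hIne : I.Nonempty)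
    (hJne : J.Nonempty) (he : IsInternalEnergy I J P e) (hT : IsSmoothKinematic I J T)
    (h : IsStandard I J e T) : IsConserved I J P T := by
  obtain ⟨⟨ρ, hρ⟩, ⟨S, hS⟩⟩ := And.intro hIne hJne
  obtain ⟨m, b, a, g, c, f, hf, htriv⟩ := isStandard_iff.1 h
  have hstd := standardDensity_mem_conservedDensity hI hJ hIpos hP he m b a g c hf
  have hsub : IsSmoothKinematic I J (T - standardDensity e m b a g c f) :=
    ContDiffOn.sub hT hstd.1
  rw [← sub_add_cancel T (standardDensity e m b a g c f)]
  exact (Submodule.add_mem (conservedDensity hI hJ P)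
    ⟨hsub, htriv.isConserved hn hI hJ hI' hJ' (v := (0, ρ, S)) ⟨hρ, hS⟩ hsub⟩ hstd).2

theorem isStandard_of_eq_background_add_standardDensity (hn : 0 < n) {w₀ : ℝ × Space n → ℝ}
    (hw₀ : ContDiff ℝ ∞ w₀) {m b : ℝ} {a g : Space n} {c : Fin n → Fin n → ℝ} {f : ℝ → ℝ}
    (hf : ContDiffOn ℝ ∞ f J)
    (hT : ∀ t x, ∀ u : Space n, ∀ ρ ∈ I, ∀ S ∈ J,
      T t x u ρ S = (background w₀ + standardDensity e m b a g c f) t x u ρ S) :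
    IsStandard I J e T :=
  isStandard_iff.2 ⟨m, b, a, g, c, f, hf, IsTotalDivergence.congr (isTrivial_background hn hw₀)
    fun t w hw x => sub_eq_of_eq_add (hT t x (w x).1 _ (hw.2 x).1 _ (hw.2 x).2)⟩

/-! ### Constant kinetic coefficient -/

theorem DeterminingEquations.fderiv_h_time_add_eq_zero (D : DeterminingEquations I J P e β α h)
    (hI : IsOpen I) (hIne : I.Nonempty) {t S k d : ℝ} {x : Space n} (hS : S ∈ J)
    (hk : ∀ ρ ∈ I, fderiv ℝ β (t, x) (1, 0) * (ρ * e ρ S - n / 2 * P ρ S)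
      = fderiv ℝ β (t, x) (1, 0) * (ρ * k + d)) :
    fderiv ℝ h (t, x, S) (1, 0, 0) + fderiv ℝ β (t, x) (1, 0) * k = 0 := by
  obtain ⟨ρ, hρ⟩ := hIne
  obtain ⟨ρ', hρ', hne⟩ := (infinite_of_mem_nhds ρ (hI.mem_nhds hρ)).nontrivial.exists_ne ρ
  refine (mul_eq_zero.1 ?_).resolve_left (sub_ne_zero.2 hne)
  linear_combination hk ρ hρ - hk ρ' hρ' - D.pressure t x ρ hρ S hS ρ' hρ' S hS

namespace DeterminingEquations

theorem fderiv_h_time_eq_zero (D : DeterminingEquations I J P e β α h) (hI : IsOpen I)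
    (hIne : I.Nonempty) (hβ : ∀ t, fderiv ℝ β (t, 0) (1, 0) = 0) {S : ℝ} (hS : S ∈ J) (t : ℝ)
    (x : Space n) : fderiv ℝ h (t, x, S) (1, 0, 0) + fderiv ℝ β (t, x) (1, 0) * 0 = 0 :=
  D.fderiv_h_time_add_eq_zero hI hIne (d := 0) hS fun ρ _ => by
    rw [D.fderiv_β_eq, hβ, zero_mul, zero_mul]

theorem β_const (D : DeterminingEquations I J P e β α h)
    (hβ : ∀ t, fderiv ℝ β (t, 0) (1, 0) = 0) (t : ℝ) (x : Space n) : β (t, x) = β (0, 0) := by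
  rw [D.β_eq]
  simpa using eq_add_smul_of_hasDerivAt (f := fun t => β (t, 0)) (c := 0) (fun s => hβ s ▸
    hasDerivAt_prodMk_right (D.contDiff_β.differentiable (by simp) (s, 0))) t

theorem inner_α_sub_eq_zero (D : DeterminingEquations I J P e β α h)
    (hβ : ∀ t, fderiv ℝ β (t, 0) (1, 0) = 0) (t : ℝ) (x u : Space n) :
    inner ℝ (α (t, x + u) - α (t, x)) u = 0 := by
  rw [D.inner_α_sub, hβ, zero_mul, zero_div, neg_zero]

theorem inner_fderiv_α_time_sub_eq_zero (D : DeterminingEquations I J P e β α h) (hI : IsOpen I)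
    (hJ : IsOpen J) (hIne : I.Nonempty) (hJne : J.Nonempty)
    (hβ : ∀ t, fderiv ℝ β (t, 0) (1, 0) = 0) (x u : Space n) :
    inner ℝ (fderiv ℝ α (0, x + u) (1, 0) - fderiv ℝ α (0, x) (1, 0)) u = 0 := by
  obtain ⟨S, hS⟩ := hJne
  have hα := D.α_eq hJ hS (D.fderiv_h_time_eq_zero hI hIne hβ hS) 1
  have hrigid := D.inner_α_sub_eq_zero hβ 1 x u
  rwa [hα, hα, add_sub_add_comm, inner_add_left, D.inner_α_sub_eq_zero hβ 0, zero_add, one_smul,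
    one_smul] at hrigid

theorem hasLineDerivAt_h (D : DeterminingEquations I J P e β α h) (hJ : IsOpen J) {S : ℝ}
    (hS : S ∈ J) (t : ℝ) (x u : Space n) :
    HasLineDerivAt ℝ (fun x => h (t, x, S)) (inner ℝ (-fderiv ℝ α (t, x) (1, 0)) u) x u := by
  rw [inner_neg_left, neg_eq_of_add_eq_zero_right (D.α_time t x u S hS)]
  exact ((D.differentiableAt_h hJ t x hS).hasFDerivAt.comp (f := fun x => (t, x, S)) x
    ((hasFDerivAt_const t x).prodMk
      ((hasFDerivAt_id x).prodMk (hasFDerivAt_const S x)))).hasLineDerivAt u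

theorem fderiv_α_time_const (D : DeterminingEquations I J P e β α h) (hI : IsOpen I)
    (hJ : IsOpen J) (hIne : I.Nonempty) (hJne : J.Nonempty)
    (hβ : ∀ t, fderiv ℝ β (t, 0) (1, 0) = 0) (t : ℝ) (x : Space n) :
    fderiv ℝ α (t, x) (1, 0) = fderiv ℝ α (0, 0) (1, 0) := by
  have hrigid := D.inner_fderiv_α_time_sub_eq_zero hI hJ hIne hJne hβ
  obtain ⟨S, hS⟩ := hJne
  rw [D.fderiv_α_time_eq hJ hS (D.fderiv_h_time_eq_zero hI hIne hβ hS), ← neg_inj]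
  exact eq_apply_zero_of_hasLineDerivAt_inner (F := fun x => -fderiv ℝ α (0, x) (1, 0))
    (fun x u => by rw [← neg_sub', inner_neg_left, hrigid, neg_zero])
    (D.hasLineDerivAt_h hJ hS 0) x

theorem h_eq_sub_inner (D : DeterminingEquations I J P e β α h) (hI : IsOpen I)
    (hJ : IsOpen J) (hIne : I.Nonempty) (hβ : ∀ t, fderiv ℝ β (t, 0) (1, 0) = 0) {S : ℝ}
    (hS : S ∈ J) (t : ℝ) (x : Space n) :
    h (t, x, S) = h (0, 0, S) - inner ℝ (fderiv ℝ α (0, 0) (1, 0)) x := by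
  have hline := add_eq_of_hasLineDerivAt (x := 0) (v := x) fun s =>
    D.fderiv_α_time_const hI hJ hIne ⟨S, hS⟩ hβ 0 (0 + s • x) ▸
      D.hasLineDerivAt_h hJ hS 0 (0 + s • x) x
  rw [D.h_eq hJ hS (D.fderiv_h_time_eq_zero hI hIne hβ hS) t x, mul_zero, add_zero,
    sub_eq_add_neg, ← inner_neg_left, ← hline, zero_add]

theorem exists_affineDensity_eq_standardDensity (D : DeterminingEquations I J P e β α h)
    (hI : IsOpen I) (hJ : IsOpen J) (hIne : I.Nonempty) (hJne : J.Nonempty)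
    (hβ : ∀ t, fderiv ℝ β (t, 0) (1, 0) = 0) :
    ∃ (m b : ℝ) (a g : Space n) (c : Fin n → Fin n → ℝ) (f : ℝ → ℝ), ContDiffOn ℝ ∞ f J ∧
      ∀ t x u ρ, ∀ S ∈ J,
        affineDensity e β α h t x u ρ S = standardDensity e m b a g c f t x u ρ S := by
  obtain ⟨c, hc⟩ := exists_eq_of_inner_sub_eq_zero (F := fun x => α (0, x))
    (D.inner_α_sub_eq_zero hβ 0)
  refine ⟨0, β (0, 0), α (0, 0), fderiv ℝ α (0, 0) (1, 0), c, fun S => h (0, 0, S),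
    D.contDiffOn_h.comp (f := fun S => (0, 0, S)) (by fun_prop) fun _ hS => hS,
    fun t x u ρ S hS => ?_⟩
  have hα := D.α_eq hJ hS (D.fderiv_h_time_eq_zero hI hIne hβ hS) t x
  rw [D.fderiv_α_time_const hI hJ hIne hJne hβ, hc] at hα
  rw [standardDensity_eq_affineDensity, affineDensity, affineDensity, D.β_const hβ, hα,
    D.h_eq_sub_inner hI hJ hIne hβ hS]
  ring

theorem isStandard (D : DeterminingEquations I J P e β α h) (hn : 0 < n)
    (hI : IsOpen I) (hJ : IsOpen J) (hIne : I.Nonempty) (hJne : J.Nonempty)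
    (hβ : ∀ t, fderiv ℝ β (t, 0) (1, 0) = 0) {w₀ : ℝ × Space n → ℝ} (hw₀ : ContDiff ℝ ∞ w₀)
    (hT : ∀ t x, ∀ u : Space n, ∀ ρ ∈ I, ∀ S ∈ J,
        T t x u ρ S = (background w₀ + affineDensity e β α h) t x u ρ S) :
    IsStandard I J e T := by
  obtain ⟨m, b, a, g, c, f, hf, heq⟩ :=
    D.exists_affineDensity_eq_standardDensity hI hJ hIne hJne hβ
  exact isStandard_of_eq_background_add_standardDensity hn hw₀ hf fun t x u ρ hρ S hS =>
    (hT t x u ρ hρ S hS).trans (congrArg (w₀ (t, x) + ·) (heq t x u ρ S hS))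

end DeterminingEquations

/-! ### The equation of state -/

theorem hasDerivAt_pressure (hI : IsOpen I) (hJ : IsOpen J)
    (hP : ContDiffOn ℝ ∞ (fun q : ℝ × ℝ => P q.1 q.2) (I ×ˢ J)) {ρ S : ℝ} (hρ : ρ ∈ I)
    (hS : S ∈ J) : HasDerivAt (fun r => P r S) (deriv (fun r => P r S) ρ) ρ := by
  have hdiff : DifferentiableAt ℝ (fun q : ℝ × ℝ => P q.1 q.2) (ρ, S) :=
    (hP.contDiffAt ((hI.prod hJ).mem_nhds ⟨hρ, hS⟩)).differentiableAt (by simp)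
  exact (hdiff.comp (f := fun r => (r, S)) ρ (by fun_prop)).hasDerivAt

theorem eq_of_hasDerivAt_zero {f : ℝ → ℝ} (hI : IsOpen I) (hI' : I.OrdConnected)
    (hf : ∀ r ∈ I, HasDerivAt f 0 r) {r₁ r₂ : ℝ} (h₁ : r₁ ∈ I) (h₂ : r₂ ∈ I) : f r₁ = f r₂ :=
  hI.is_const_of_deriv_eq_zero hI'.isPreconnected
    (fun r hr => (hf r hr).differentiableAt.differentiableWithinAt)
    (fun r hr => (hf r hr).deriv) h₁ h₂

theorem eq_mul_rpow_of_mul_deriv_eq {p p' : ℝ → ℝ} {γ ρ₀ ρ : ℝ} (hI : IsOpen I)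
    (hI' : I.OrdConnected) (hIpos : I ⊆ Ioi 0) (hp : ∀ r ∈ I, HasDerivAt p (p' r) r)
    (hode : ∀ r ∈ I, r * p' r = γ * p r) (hρ₀ : ρ₀ ∈ I) (hρ : ρ ∈ I) :
    p ρ = p ρ₀ * ρ₀ ^ (-γ) * ρ ^ γ := by
  have hconst : p ρ * ρ ^ (-γ) = p ρ₀ * ρ₀ ^ (-γ) := by
    refine eq_of_hasDerivAt_zero (f := fun r => p r * r ^ (-γ)) hI hI' (fun r hr => ?_) hρ hρ₀
    have hr₀ : r ≠ 0 := (hIpos hr).ne'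
    refine ((hp r hr).fun_mul (Real.hasDerivAt_rpow_const (Or.inl hr₀))).congr_deriv ?_
    have hpow : r ^ (-γ) = r * r ^ (-γ - 1) := by
      rw [Real.rpow_sub_one hr₀, mul_div_cancel₀ _ hr₀]
    rw [hpow]
    linear_combination r ^ (-γ - 1) * hode r hr
  rw [← hconst, mul_assoc, ← Real.rpow_add (hIpos hρ), neg_add_cancel, Real.rpow_zero, mul_one]

theorem IsInternalEnergy.mul_deriv_eq (he : IsInternalEnergy I J P e) (hI : IsOpen I)
    (hIpos : I ⊆ Ioi 0) {ν a b c p' ρ S : ℝ} (hρ : ρ ∈ I) (hS : S ∈ J)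
    (hP : HasDerivAt (fun r => P r S) p' ρ)
    (hF : ∀ r ∈ I, r * (b * e r S + a) - ν / 2 * b * P r S = c) :
    ν * b * (ρ * p') = 2 * c + (ν + 2) * b * P ρ S := by
  have hρ₀ : ρ ≠ 0 := (hIpos hρ).ne'
  have hderiv := ((hasDerivAt_id' ρ).fun_mul (((he.2 ρ hρ S hS).const_mul b).add_const a)).fun_sub
    (hP.const_mul (ν / 2 * b))
  have hzero := hderiv.unique ((hasDerivAt_const ρ c).congr_of_eventuallyEq
    (eventually_of_mem (hI.mem_nhds hρ) hF))
  have hcancel : ρ ^ 2 * ((ρ ^ 2)⁻¹ * P ρ S) = P ρ S := by field_simp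
  linear_combination 2 * hF ρ hρ - 2 * ρ * hzero + 2 * b * hcancel

theorem IsInternalEnergy.exists_isShiftedPolytropic (hn : 0 < n) (hI : IsOpen I) (hJ : IsOpen J)
    (hI' : I.OrdConnected) (hIpos : I ⊆ Ioi 0)
    (hP : ContDiffOn ℝ ∞ (fun q : ℝ × ℝ => P q.1 q.2) (I ×ˢ J)) (he : IsInternalEnergy I J P e)
    (hIne : I.Nonempty) {a : ℝ → ℝ} {b c : ℝ} (hb : b ≠ 0)
    (hF : ∀ ρ ∈ I, ∀ S ∈ J, ρ * (b * e ρ S + a S) - n / 2 * b * P ρ S = c) :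
    ∃ κ p₀, IsShiftedPolytropic n I J P κ p₀ := by
  obtain ⟨ρ₀, hρ₀⟩ := hIne
  have hn₀ : (n : ℝ) ≠ 0 := by exact_mod_cast hn.ne'
  have hn₂ : (n : ℝ) + 2 ≠ 0 := by positivity
  let p₀ : ℝ := -(2 * c / (b * (n + 2)))
  refine ⟨fun S => (P ρ₀ S - p₀) * ρ₀ ^ (-(1 + 2 / (n : ℝ))), p₀, fun ρ hρ S hS => ?_⟩
  have hode (r : ℝ) (hr : r ∈ I) :
      r * deriv (fun r => P r S) r = (1 + 2 / n) * (P r S - p₀) := by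
    have hmul := he.mul_deriv_eq hI hIpos hr hS (hasDerivAt_pressure hI hJ hP hr hS)
      fun r hr => hF r hr S hS
    refine mul_left_cancel₀ (mul_ne_zero hn₀ hb) (hmul.trans ?_)
    simp only [p₀]
    field_simp
    ring
  exact sub_eq_iff_eq_add.1 (eq_mul_rpow_of_mul_deriv_eq hI hI' hIpos
    (fun r hr => (hasDerivAt_pressure hI hJ hP hr hS).sub_const p₀) hode hρ₀ hρ)

theorem IsShiftedPolytropic.exists_mul_internalEnergy_eq {κ : ℝ → ℝ} {p₀ : ℝ} (hn : 0 < n)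
    (hI : IsOpen I) (hI' : I.OrdConnected) (hIpos : I ⊆ Ioi 0)
    (hP : ContDiffOn ℝ ∞ (fun q : ℝ × ℝ => P q.1 q.2) (I ×ˢ J))
    (hκ : IsShiftedPolytropic n I J P κ p₀) (he : IsInternalEnergy I J P e) (hIne : I.Nonempty)
    {S : ℝ} (hS : S ∈ J) :
    ∃ k, ∀ ρ ∈ I, ρ * e ρ S = n / 2 * (P ρ S - p₀) + ρ * k - p₀ := by
  obtain ⟨ρ₀, hρ₀⟩ := hIne
  let k (r : ℝ) : ℝ := e r S - polytropicEnergy n κ r S + p₀ * r⁻¹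
  have hderiv (r : ℝ) (hr : r ∈ I) : HasDerivAt k 0 r := by
    refine (((he.2 r hr S hS).fun_sub ((hκ.isInternalEnergy hn hIpos hP).2 r hr S hS)).fun_add
      ((hasDerivAt_inv (hIpos hr).ne').const_mul p₀)).congr_deriv ?_
    ring
  refine ⟨k ρ₀, fun ρ hρ => ?_⟩
  have hcancel : ρ * ρ⁻¹ = 1 := mul_inv_cancel₀ (hIpos hρ).ne'
  rw [← hκ.mul_polytropicEnergy hIpos hρ hS, ← eq_of_hasDerivAt_zero hI hI' hderiv hρ hρ₀]
  linear_combination -p₀ * hcancel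

/-! ### Classification -/

variable {κ : ℝ → ℝ} {p₀ : ℝ}

theorem DeterminingEquations.exists_isShiftedPolytropic (D : DeterminingEquations I J P e β α h)
    (hn : 0 < n) (hI : IsOpen I) (hJ : IsOpen J) (hI' : I.OrdConnected) (hIpos : I ⊆ Ioi 0)
    (hP : ContDiffOn ℝ ∞ (fun q : ℝ × ℝ => P q.1 q.2) (I ×ˢ J)) (he : IsInternalEnergy I J P e)
    (hIne : I.Nonempty) (hJne : J.Nonempty) {t : ℝ} {x : Space n}
    (hβ : fderiv ℝ β (t, x) (1, 0) ≠ 0) : ∃ κ p₀, IsShiftedPolytropic n I J P κ p₀ := by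
  obtain ⟨⟨ρ₀, hρ₀⟩, ⟨S₀, hS₀⟩⟩ := And.intro hIne hJne
  exact he.exists_isShiftedPolytropic (a := fun S => fderiv ℝ h (t, x, S) (1, 0, 0)) hn hI hJ hI'
    hIpos hP ⟨ρ₀, hρ₀⟩ hβ fun ρ hρ S hS => D.pressure t x ρ hρ S hS ρ₀ hρ₀ S₀ hS₀

theorem IsShiftedPolytropic.exists_β_eq_quadratic (hκ : IsShiftedPolytropic n I J P κ p₀)
    (hn : 0 < n) (hI : IsOpen I) (hJ : IsOpen J) (hI' : I.OrdConnected) (hIpos : I ⊆ Ioi 0)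
    (hP : ContDiffOn ℝ ∞ (fun q : ℝ × ℝ => P q.1 q.2) (I ×ˢ J)) (he : IsInternalEnergy I J P e)
    (hIne : I.Nonempty) (hJne : J.Nonempty) (D : DeterminingEquations I J P e β α h) :
    ∃ b₁ b₂ : ℝ, ∀ t x, β (t, x) = β (0, 0) + b₁ * t + b₂ * t ^ 2 := by
  obtain ⟨S, hS⟩ := hJne
  obtain ⟨k, hk⟩ := hκ.exists_mul_internalEnergy_eq hn hI hI' hIpos hP he hIne hS
  exact D.exists_β_eq_quadratic hn hJ hS fun t x =>
    D.fderiv_h_time_add_eq_zero hI hIne (k := k) (d := -(n / 2 * p₀ + p₀)) hS fun ρ hρ => by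
      rw [hk ρ hρ]
      ring

/-- The combinations of the similarity energy and the dilational energy. -/
def extraDensity (e : ℝ → ℝ → ℝ) (b₁ b₂ : ℝ) : Kinematic n ℝ :=
  b₁ • similarityEnergy e + b₂ • dilationalEnergy e

theorem extraDensity_eq_affineDensity (e : ℝ → ℝ → ℝ) (b₁ b₂ : ℝ) :
    (extraDensity e b₁ b₂ : Kinematic n ℝ) = affineDensity e (fun q => b₁ * q.1 + b₂ * q.1 ^ 2)
      (fun q => -((b₁ / 2 + b₂ * q.1) • q.2)) fun q => b₂ / 2 * ‖q.2.1‖ ^ 2 := by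
  funext t x u ρ S
  simp only [extraDensity, similarityEnergy_eq_affineDensity, dilationalEnergy_eq_affineDensity,
    Pi.add_apply, Pi.smul_apply, smul_eq_mul, affineDensity, inner_neg_left, inner_smul_left,
    RCLike.conj_to_real]
  ring

theorem extraDensity_mem_conservedDensity (hn : 0 < n) (hI : IsOpen I) (hJ : IsOpen J)
    (hIpos : I ⊆ Ioi 0) (hP : ContDiffOn ℝ ∞ (fun q : ℝ × ℝ => P q.1 q.2) (I ×ˢ J))
    (hκ : IsShiftedPolytropic n I J P κ p₀) (b₁ b₂ : ℝ) :
    extraDensity (polytropicEnergy n κ) b₁ b₂ ∈ conservedDensity (n := n) hI hJ P := by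
  have he := (hκ.isInternalEnergy hn hIpos hP).1
  have hp : ContDiffOn ℝ ∞ (fun q : ℝ × ℝ => P q.1 q.2 - p₀) (I ×ˢ J) := hP.sub contDiffOn_const
  refine add_mem (Submodule.smul_mem _ b₁ ?similarity) (Submodule.smul_mem _ b₂ ?dilational)
  case similarity =>
    refine (hasMovingFlux_similarityEnergy hn hI hJ hIpos hP hκ).mem_conservedDensity hI hJ ?_
      (contDiffOn_stateFunction_smul (f := fun ρ S => P ρ S - p₀)
        (V := fun q => q.1 • q.2.2.1 - (1 / 2 : ℝ) • q.2.1) hp (by fun_prop))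
    rw [similarityEnergy_eq_affineDensity]
    exact isSmoothKinematic_affineDensity he contDiff_fst (by fun_prop) contDiffOn_const
  case dilational =>
    refine (hasMovingFlux_dilationalEnergy hn hI hJ hIpos hP hκ).mem_conservedDensity hI hJ ?_
      ((ContDiffOn.mul (isSmoothKinematic_stateFunction (f := fun ρ S => P ρ S - p₀) hp)
        contDiffOn_fst).smul
        (ContDiff.contDiffOn (f := fun q : ℝ × Space n × State n => q.1 • q.2.2.1 - q.2.1)
          (by fun_prop)))
    rw [dilationalEnergy_eq_affineDensity]
    exact isSmoothKinematic_affineDensity he (by fun_prop) (by fun_prop)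
      (contDiff_const.mul ((contDiff_fst.comp contDiff_snd).norm_sq ℝ)).contDiffOn

/-- The second difference in `u` of a density, for reading off the coefficient of the kinetic
energy: it annihilates the terms of degree at most one in `u`. -/
def kineticPart (T : Kinematic n ℝ) : Kinematic n ℝ := fun t x u ρ S =>
  T t x u ρ S + T t x (-u) ρ S - 2 * T t x 0 ρ S

theorem kineticPart_sub (T₁ T₂ : Kinematic n ℝ) (t : ℝ) (x u : Space n) (ρ S : ℝ) :
    kineticPart (T₁ - T₂) t x u ρ S = kineticPart T₁ t x u ρ S - kineticPart T₂ t x u ρ S := by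
  simp only [kineticPart, Pi.sub_apply]
  ring

theorem kineticPart_affineDensity (t : ℝ) (x u : Space n) (ρ S : ℝ) :
    kineticPart (affineDensity e β α h) t x u ρ S = ρ * β (t, x) * ‖u‖ ^ 2 := by
  simp only [kineticPart, affineDensity, inner_neg_right, inner_zero_right, norm_neg, norm_zero]
  ring

theorem kineticPart_eq_of_eq_background_add {w₀ : ℝ × Space n → ℝ} {t ρ S : ℝ} {x : Space n}
    (hT : ∀ u, T t x u ρ S = (background w₀ + affineDensity e β α h) t x u ρ S) (u : Space n) :
    kineticPart T t x u ρ S = ρ * β (t, x) * ‖u‖ ^ 2 := by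
  rw [← kineticPart_affineDensity (e := e) (α := α) (h := h) t x u ρ S]
  simp only [kineticPart, hT, background, Pi.add_apply]
  ring

theorem kineticPart_extraDensity (b₁ b₂ t : ℝ) (x u : Space n) (ρ S : ℝ) :
    kineticPart (extraDensity e b₁ b₂) t x u ρ S
      = ρ * (b₁ * t + b₂ * t ^ 2) * ‖u‖ ^ 2 := by
  rw [extraDensity_eq_affineDensity, kineticPart_affineDensity]

theorem IsTrivial.kineticPart_eq_zero (hI : IsOpen I) (hJ : IsOpen J) (hI' : I.OrdConnected)
    (hJ' : J.OrdConnected) (hT : IsSmoothKinematic I J T) (h : IsTrivial I J T) (t : ℝ)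
    (x u : Space n) {ρ S : ℝ} (hρ : ρ ∈ I) (hS : S ∈ J) : kineticPart T t x u ρ S = 0 := by
  have heq (v : Space n) : T t x v ρ S = T t x 0 ρ S :=
    h.eq_of_mem_phase hI hJ hI' hJ' hT t x (v := (v, ρ, S)) (w := (0, ρ, S)) ⟨hρ, hS⟩ ⟨hρ, hS⟩
  rw [kineticPart, heq u, heq (-u)]
  ring

theorem eq_zero_of_isStandard_extraDensity (hn : 0 < n) (hI : IsOpen I) (hJ : IsOpen J)
    (hI' : I.OrdConnected) (hJ' : J.OrdConnected) (hIpos : I ⊆ Ioi 0)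
    (hP : ContDiffOn ℝ ∞ (fun q : ℝ × ℝ => P q.1 q.2) (I ×ˢ J)) (hIne : I.Nonempty)
    (hJne : J.Nonempty) (he : IsInternalEnergy I J P e) (hκ : IsShiftedPolytropic n I J P κ p₀)
    {b₁ b₂ : ℝ} (h : IsStandard (n := n) I J e (extraDensity (polytropicEnergy n κ) b₁ b₂)) :
    b₁ = 0 ∧ b₂ = 0 := by
  obtain ⟨⟨ρ, hρ⟩, ⟨S, hS⟩⟩ := And.intro hIne hJne
  obtain ⟨m, b, a, g, c, f, hf, htriv⟩ := isStandard_iff.1 h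
  have hsmooth := (Submodule.sub_mem _
    (extraDensity_mem_conservedDensity hn hI hJ hIpos hP hκ b₁ b₂)
    (standardDensity_mem_conservedDensity hI hJ hIpos hP he m b a g c hf)).1
  have hcoeff (t : ℝ) : b₁ * t + b₂ * t ^ 2 = b := by
    have hzero := htriv.kineticPart_eq_zero hI hJ hI' hJ' hsmooth t 0 (single ⟨0, hn⟩ 1) hρ hS
    rw [kineticPart_sub, standardDensity_eq_affineDensity, kineticPart_affineDensity,
      kineticPart_extraDensity, PiLp.norm_single, norm_one, one_pow, mul_one, mul_one,
      sub_eq_zero] at hzero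
    exact mul_left_cancel₀ (hIpos hρ).ne' hzero
  have h₀ := hcoeff 0
  have h₁ := hcoeff 1
  have h₂ := hcoeff (-1)
  exact ⟨by linarith, by linarith⟩

theorem isConserved_iff_isStandard (hn : 1 < n) (hI : IsOpen I) (hJ : IsOpen J)
    (hI' : I.OrdConnected) (hJ' : J.OrdConnected) (hIpos : I ⊆ Ioi 0)
    (hP : ContDiffOn ℝ ∞ (fun q : ℝ × ℝ => P q.1 q.2) (I ×ˢ J)) (hIne : I.Nonempty)
    (hJne : J.Nonempty)
    (hPρ : ∀ U ⊆ J, IsOpen U → U.Nonempty → ∃ S ∈ U, ∃ ρ ∈ I, deriv (fun r => P r S) ρ ≠ 0)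
    (he : IsInternalEnergy I J P e) (hpoly : ¬ ∃ κ p₀, IsShiftedPolytropic n I J P κ p₀)
    (hT : IsSmoothKinematic I J T) : IsConserved I J P T ↔ IsStandard I J e T := by
  have hn₀ : 0 < n := zero_lt_one.trans hn
  refine ⟨fun hc => ?_, fun h => h.isConserved hn₀ hI hJ hI' hJ' hIpos hP hIne hJne he hT⟩
  obtain ⟨w₀, β, α, h, hw₀, D, heq⟩ :=
    hc.exists_determiningEquations hn hI hJ hI' hJ' hIpos hP hJne hPρ he hT
  refine D.isStandard hn₀ hI hJ hIne hJne (fun t => ?_) hw₀ heq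
  by_contra hβ
  exact hpoly (D.exists_isShiftedPolytropic hn₀ hI hJ hI' hIpos hP he hIne hJne hβ)

theorem DeterminingEquations.fderiv_β_eq_zero_of_forall_eq (D : DeterminingEquations I J P e β α h)
    {b : ℝ} (hβ : ∀ t, β (t, 0) = b) (t : ℝ) : fderiv ℝ β (t, 0) (1, 0) = 0 :=
  (hasDerivAt_prodMk_right (D.contDiff_β.differentiable (by simp) (t, 0))).unique
    ((hasDerivAt_const t b).congr_of_eventuallyEq (Eventually.of_forall hβ))

theorem IsConserved.exists_isStandard_sub_extraDensity (hn : 1 < n) (hI : IsOpen I) (hJ : IsOpen J)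
    (hI' : I.OrdConnected) (hJ' : J.OrdConnected) (hIpos : I ⊆ Ioi 0)
    (hP : ContDiffOn ℝ ∞ (fun q : ℝ × ℝ => P q.1 q.2) (I ×ˢ J)) (hIne : I.Nonempty)
    (hJne : J.Nonempty)
    (hPρ : ∀ U ⊆ J, IsOpen U → U.Nonempty → ∃ S ∈ U, ∃ ρ ∈ I, deriv (fun r => P r S) ρ ≠ 0)
    (he : IsInternalEnergy I J P e) (hκ : IsShiftedPolytropic n I J P κ p₀)
    (hT : IsSmoothKinematic I J T) (hc : IsConserved I J P T) :
    ∃ b₁ b₂, IsStandard I J e (T - extraDensity (polytropicEnergy n κ) b₁ b₂) := by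
  have hn₀ : 0 < n := zero_lt_one.trans hn
  obtain ⟨w₀, β, α, h, -, D, heq⟩ :=
    hc.exists_determiningEquations hn hI hJ hI' hJ' hIpos hP hJne hPρ he hT
  obtain ⟨b₁, b₂, hβ⟩ := hκ.exists_β_eq_quadratic hn₀ hI hJ hI' hIpos hP he hIne hJne D
  obtain ⟨hT', hc'⟩ := Submodule.sub_mem (conservedDensity hI hJ P) ⟨hT, hc⟩
    (extraDensity_mem_conservedDensity hn₀ hI hJ hIpos hP hκ b₁ b₂)
  obtain ⟨w₀', β', α', h', hw₀', D', heq'⟩ :=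
    IsConserved.exists_determiningEquations hn hI hJ hI' hJ' hIpos hP hJne hPρ he hT' hc'
  have hβ' (t : ℝ) : β' (t, 0) = β (0, 0) := by
    obtain ⟨⟨ρ, hρ⟩, ⟨S, hS⟩⟩ := And.intro hIne hJne
    have hkin := kineticPart_sub T (extraDensity (polytropicEnergy n κ) b₁ b₂) t 0
      (single ⟨0, hn₀⟩ 1) ρ S
    rw [kineticPart_eq_of_eq_background_add fun u => heq' t 0 u ρ hρ S hS,
      kineticPart_eq_of_eq_background_add fun u => heq t 0 u ρ hρ S hS, kineticPart_extraDensity,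
      PiLp.norm_single, norm_one, hβ] at hkin
    refine mul_left_cancel₀ (hIpos hρ).ne' ?_
    linarith
  exact ⟨b₁, b₂, D'.isStandard hn₀ hI hJ hIne hJne (D'.fderiv_β_eq_zero_of_forall_eq hβ') hw₀'
    heq'⟩

theorem IsStandard.isConserved_of_sub_extraDensity (hn : 0 < n) (hI : IsOpen I) (hJ : IsOpen J)
    (hI' : I.OrdConnected) (hJ' : J.OrdConnected) (hIpos : I ⊆ Ioi 0)
    (hP : ContDiffOn ℝ ∞ (fun q : ℝ × ℝ => P q.1 q.2) (I ×ˢ J)) (hIne : I.Nonempty)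
    (hJne : J.Nonempty) (he : IsInternalEnergy I J P e) (hκ : IsShiftedPolytropic n I J P κ p₀)
    (hT : IsSmoothKinematic I J T) {b₁ b₂ : ℝ}
    (h : IsStandard I J e (T - extraDensity (polytropicEnergy n κ) b₁ b₂)) :
    IsConserved I J P T := by
  have hextra := extraDensity_mem_conservedDensity hn hI hJ hIpos hP hκ b₁ b₂
  have hT' : IsSmoothKinematic I J (T - extraDensity (polytropicEnergy n κ) b₁ b₂) :=
    ContDiffOn.sub hT hextra.1
  rw [← sub_add_cancel T (extraDensity (polytropicEnergy n κ) b₁ b₂)]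
  exact (Submodule.add_mem (conservedDensity hI hJ P)
    ⟨hT', h.isConserved hn hI hJ hI' hJ' hIpos hP hIne hJne he hT'⟩ hextra).2

theorem exists_not_isStandard_iff (hn : 1 < n) (hI : IsOpen I) (hJ : IsOpen J)
    (hI' : I.OrdConnected) (hJ' : J.OrdConnected) (hIpos : I ⊆ Ioi 0)
    (hP : ContDiffOn ℝ ∞ (fun q : ℝ × ℝ => P q.1 q.2) (I ×ˢ J)) (hIne : I.Nonempty)
    (hJne : J.Nonempty)
    (hPρ : ∀ U ⊆ J, IsOpen U → U.Nonempty → ∃ S ∈ U, ∃ ρ ∈ I, deriv (fun r => P r S) ρ ≠ 0)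
    (he : IsInternalEnergy I J P e) :
    (∃ T : Kinematic n ℝ, IsSmoothKinematic I J T ∧ IsConserved I J P T ∧ ¬ IsStandard I J e T)
      ↔ ∃ κ p₀, IsShiftedPolytropic n I J P κ p₀ := by
  refine ⟨fun ⟨T, hT, hc, hns⟩ => ?_, fun ⟨κ, p₀, hκ⟩ => ?_⟩
  · by_contra hpoly
    exact hns ((isConserved_iff_isStandard hn hI hJ hI' hJ' hIpos hP hIne hJne hPρ he hpoly hT).1
      hc)
  · have hn₀ : 0 < n := zero_lt_one.trans hn
    obtain ⟨hT, hc⟩ := extraDensity_mem_conservedDensity hn₀ hI hJ hIpos hP hκ 1 0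
    exact ⟨_, hT, hc, fun h => one_ne_zero
      (eq_zero_of_isStandard_extraDensity hn₀ hI hJ hI' hJ' hIpos hP hIne hJne he hκ h).1⟩

end

end

end Euler

theorem theorem1_general (n : ℕ) (hn : 1 < n)
    (I J : Set ℝ) (hI : IsOpen I) (hI' : I.OrdConnected) (hIpos : I ⊆ Ioi 0)
    (hJ : IsOpen J) (hJ' : J.OrdConnected)
    (P : ℝ → ℝ → ℝ) (hP : ContDiffOn ℝ ∞ (fun q : ℝ × ℝ => P q.1 q.2) (I ×ˢ J))
    (hJne : J.Nonempty)
    (hPρ : ∀ U ⊆ J, IsOpen U → U.Nonempty → ∃ S ∈ U, ∃ ρ ∈ I, deriv (fun r => P r S) ρ ≠ 0)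
    (e : ℝ → ℝ → ℝ) (he : IsInternalEnergy I J P e) :
    (HasMovingFlux (n := n) I J P mass (fun _ _ _ _ _ => 0)
      ∧ (∀ k : Fin n, HasMovingFlux I J P (momentum k)
          (fun _ _ _ ρ S => P ρ S • EuclideanSpace.single k 1))
      ∧ (∀ j k : Fin n, HasMovingFlux I J P (angularMomentum j k)
          (fun _ x _ ρ S => P ρ S •
            (x k • EuclideanSpace.single j 1 - x j • EuclideanSpace.single k 1)))
      ∧ (∀ k : Fin n, HasMovingFlux I J P (galileanMomentum k)
          (fun t _ _ ρ S => (t * P ρ S) • EuclideanSpace.single k 1))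
      ∧ HasMovingFlux (n := n) I J P (energy e) (fun _ _ u ρ S => P ρ S • u)
      ∧ (∀ f : ℝ → ℝ, ContDiffOn ℝ ∞ f J →
          HasMovingFlux (n := n) I J P (entropy f) (fun _ _ _ _ _ => 0)))
    ∧ ((¬ ∃ κ p₀, IsShiftedPolytropic n I J P κ p₀) →
        ∀ T : Kinematic n ℝ, IsSmoothKinematic I J T →
          (IsConserved I J P T ↔ IsStandard I J e T))
    ∧ ((∃ T : Kinematic n ℝ, IsSmoothKinematic I J T ∧ IsConserved I J P T ∧ ¬ IsStandard I J e T)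
        ↔ ∃ κ p₀, IsShiftedPolytropic n I J P κ p₀)
    ∧ (∀ κ p₀, IsShiftedPolytropic n I J P κ p₀ →
        IsInternalEnergy I J (fun ρ S => P ρ S - p₀) (polytropicEnergy n κ)
        ∧ (∀ t x, ∀ u : Space n, ∀ ρ ∈ I, ∀ S ∈ J, energy (polytropicEnergy n κ) t x u ρ S
            = ρ * ‖u‖ ^ 2 / 2 + (n : ℝ) / 2 * (P ρ S - p₀))
        ∧ HasMovingFlux (n := n) I J P (similarityEnergy (polytropicEnergy n κ))
            (fun t x u ρ S => (P ρ S - p₀) • (t • u - (1 / 2 : ℝ) • x))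
        ∧ HasMovingFlux (n := n) I J P (dilationalEnergy (polytropicEnergy n κ))
            (fun t x u ρ S => ((P ρ S - p₀) * t) • (t • u - x))
        ∧ (∀ T : Kinematic n ℝ, IsSmoothKinematic I J T →
            (IsConserved I J P T ↔ ∃ b₁ b₂ : ℝ, IsStandard I J e
              (T - (b₁ • similarityEnergy (polytropicEnergy n κ)
                + b₂ • dilationalEnergy (polytropicEnergy n κ)))))
        ∧ (∀ b₁ b₂ : ℝ, IsStandard I J e
            ((b₁ • similarityEnergy (polytropicEnergy n κ)
                + b₂ • dilationalEnergy (polytropicEnergy n κ)) : Kinematic n ℝ) →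
              b₁ = 0 ∧ b₂ = 0)) := by
  have hn₀ : 0 < n := zero_lt_one.trans hn
  obtain ⟨_, _, ρ₀, hρ₀, _⟩ := hPρ J subset_rfl hJ hJne
  have hIne : I.Nonempty := ⟨ρ₀, hρ₀⟩
  refine ⟨⟨hasMovingFlux_mass hI hJ hIpos hP he, hasMovingFlux_momentum hI hJ hIpos hP he,
      hasMovingFlux_angularMomentum hI hJ hIpos hP he,
      hasMovingFlux_galileanMomentum hI hJ hIpos hP he, hasMovingFlux_energy hI hJ hIpos hP he,
      fun f hf => hasMovingFlux_entropy hI hJ hIpos hP he hf⟩,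
    fun hpoly T hT =>
      isConserved_iff_isStandard hn hI hJ hI' hJ' hIpos hP hIne hJne hPρ he hpoly hT,
    exists_not_isStandard_iff hn hI hJ hI' hJ' hIpos hP hIne hJne hPρ he,
    fun κ p₀ hκ => ⟨hκ.isInternalEnergy hn₀ hIpos hP,
      fun t x u ρ hρ S hS => hκ.energy_polytropicEnergy hIpos t x u hρ hS,
      hasMovingFlux_similarityEnergy hn₀ hI hJ hIpos hP hκ,
      hasMovingFlux_dilationalEnergy hn₀ hI hJ hIpos hP hκ, fun T hT => ⟨fun hc => ?_, ?_⟩,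
      fun b₁ b₂ h =>
        eq_zero_of_isStandard_extraDensity hn₀ hI hJ hI' hJ' hIpos hP hIne hJne he hκ h⟩⟩
  · exact hc.exists_isStandard_sub_extraDensity hn hI hJ hI' hJ' hIpos hP hIne hJne hPρ he hκ hT
  · rintro ⟨b₁, b₂, h⟩
    exact h.isConserved_of_sub_extraDensity hn₀ hI hJ hI' hJ' hIpos hP hIne hJne he hκ hT

theorem theorem1 (n : ℕ) (hn : 1 < n)
    -- the ranges of density and entropy: open intervals, with positive densities
    (I J : Set ℝ) (hI : IsOpen I) (hI' : I.OrdConnected) (hIpos : I ⊆ Ioi 0)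
    (hJ : IsOpen J) (hJ' : J.OrdConnected)
    (P : ℝ → ℝ → ℝ) (hP : ContDiffOn ℝ ∞ (fun q : ℝ × ℝ => P q.1 q.2) (I ×ˢ J))
    -- the equation of state is non-isentropic
    (hPS : ∃ ρ ∈ I, ∃ S ∈ J, deriv (fun s => P ρ s) S ≠ 0)
    -- on no open range of entropies is the pressure independent of the density
    (hPρ : ∀ U ⊆ J, IsOpen U → U.Nonempty → ∃ S ∈ U, ∃ ρ ∈ I, deriv (fun r => P r S) ρ ≠ 0)
    (e : ℝ → ℝ → ℝ) (he : IsInternalEnergy I J P e) :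
    -- the standard conservation laws hold for every equation of state
    (HasMovingFlux (n := n) I J P mass (fun _ _ _ _ _ => 0)
      ∧ (∀ k : Fin n, HasMovingFlux I J P (momentum k)
          (fun _ _ _ ρ S => P ρ S • EuclideanSpace.single k 1))
      ∧ (∀ j k : Fin n, HasMovingFlux I J P (angularMomentum j k)
          (fun _ x _ ρ S => P ρ S •
            (x k • EuclideanSpace.single j 1 - x j • EuclideanSpace.single k 1)))
      ∧ (∀ k : Fin n, HasMovingFlux I J P (galileanMomentum k)
          (fun t _ _ ρ S => (t * P ρ S) • EuclideanSpace.single k 1))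
      ∧ HasMovingFlux (n := n) I J P (energy e) (fun _ _ u ρ S => P ρ S • u)
      ∧ (∀ f : ℝ → ℝ, ContDiffOn ℝ ∞ f J →
          HasMovingFlux (n := n) I J P (entropy f) (fun _ _ _ _ _ => 0)))
    -- outside the polytropic case there are no others
    ∧ ((¬ ∃ κ p₀, IsShiftedPolytropic n I J P κ p₀) →
        ∀ T : Kinematic n ℝ, IsSmoothKinematic I J T →
          (IsConserved I J P T ↔ IsStandard I J e T))
    -- additional conservation laws arise exactly in the polytropic case
    ∧ ((∃ T : Kinematic n ℝ, IsSmoothKinematic I J T ∧ IsConserved I J P T ∧ ¬ IsStandard I J e T)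
        ↔ ∃ κ p₀, IsShiftedPolytropic n I J P κ p₀)
    -- in the polytropic case they are the similarity energy and the dilational energy
    ∧ (∀ κ p₀, IsShiftedPolytropic n I J P κ p₀ →
        IsInternalEnergy I J (fun ρ S => P ρ S - p₀) (polytropicEnergy n κ)
        ∧ (∀ t x, ∀ u : Space n, ∀ ρ ∈ I, ∀ S ∈ J, energy (polytropicEnergy n κ) t x u ρ S
            = ρ * ‖u‖ ^ 2 / 2 + (n : ℝ) / 2 * (P ρ S - p₀))
        ∧ HasMovingFlux (n := n) I J P (similarityEnergy (polytropicEnergy n κ))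
            (fun t x u ρ S => (P ρ S - p₀) • (t • u - (1 / 2 : ℝ) • x))
        ∧ HasMovingFlux (n := n) I J P (dilationalEnergy (polytropicEnergy n κ))
            (fun t x u ρ S => ((P ρ S - p₀) * t) • (t • u - x))
        ∧ (∀ T : Kinematic n ℝ, IsSmoothKinematic I J T →
            (IsConserved I J P T ↔ ∃ b₁ b₂ : ℝ, IsStandard I J e
              (T - (b₁ • similarityEnergy (polytropicEnergy n κ)
                + b₂ • dilationalEnergy (polytropicEnergy n κ)))))
        ∧ (∀ b₁ b₂ : ℝ, IsStandard I J e
            ((b₁ • similarityEnergy (polytropicEnergy n κ)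
                + b₂ • dilationalEnergy (polytropicEnergy n κ)) : Kinematic n ℝ) →
              b₁ = 0 ∧ b₂ = 0)) := by
  let ⟨_, _, S, hS, _⟩ := hPS
  exact theorem1_general n hn I J hI hI' hIpos hJ hJ' P hP ⟨S, hS⟩ hPρ e he
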